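/- Let $M$ be a compact smooth manifold with boundary, of real dimension $4$, with a smooth almost complex structure $J$ and a smooth symplectic form $\omega$ taming $J$, that is, $\omega(v,Jv)>0$ for every tangent vector $v\neq 0$. Let $S\subset\partial M$ be a smoothly embedded $2$-sphere which is totally real ($T_pS\cap J(T_pS)=0$) except at finitely many points. (This holds, for instance, if all complex points of $S$ are elliptic or hyperbolic.) Write $\mathbb D$ for the open unit disc in $\mathbb C$. A map $f:\mathbb D\to M$ is called $J$-holomorphic if it is of class $C^1$ and $df\circ i=J\circ df$; its area is $\int_{\mathbb D}f^*\omega\in[0,\infty]$. A Bishop disc for $S$ is a continuous map $\overline{\mathbb D}\to M$ that is $J$-holomorphic on $\mathbb D$ and maps $\partial\mathbb D$ into $S$. Let $(f_k)$ be a sequence of Bishop discs for $S$ with uniformly bounded areas, and let $f:\mathbb D\to M$ be a non-constant $J$-holomorphic disc that belongs to the limit curve of $(f_k)$ in the following sense: there are a subsequence $(f_{n_k})$, conformal automorphisms (Möbius transformations) $\varphi_k$ of $\mathbb D$ and a finite set $\Sigma$ such that $f_{n_k}\circ\varphi_k\to f$ uniformly on compact subsets of $\mathbb D\setminus\Sigma$.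 Then: 1. the cluster set $C(f,\partial\mathbb D)$, i.e. the set of all limits $\lim_n f(\zeta_n)$ along sequences $(\zeta_n)$ in $\mathbb D$ converging to a point of $\partial\mathbb D$, is contained in $S$; 2. $f$ extends to a continuous map $\overline{\mathbb D}\to M$. -/

import Mathlib

open scoped Manifold ContDiff Topology
open Bundle Set Filter MeasureTheory

noncomputable section

namespace BishopDisc

/-- Real 4-space, the model of the tangent spaces of a manifold of complex dimension 2. -/
abbrev E4 : Type := EuclideanSpace ℝ (Fin 4)

/-- The standard 2-sphere. -/
abbrev Sphere2 : Type := Metric.sphere (0 : EuclideanSpace ℝ (Fin 3)) 1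

instance factFinrankThree : Fact (Module.finrank ℝ (EuclideanSpace ℝ (Fin 3)) = 2 + 1) :=
  ⟨by simp⟩

section Structures

variable (M : Type*) [TopologicalSpace M] [ChartedSpace (EuclideanHalfSpace 4) M]
  [IsManifold (𝓡∂ 4) ∞ M]

/-- A smooth almost complex structure on a (real) 4-manifold with boundary: a smooth section `J` of
the endomorphism bundle of the tangent bundle with `J² = -1`. -/
structure AlmostComplexStructure where
  /-- The endomorphism of each tangent space. -/
  J : ∀ x : M, TangentSpace (𝓡∂ 4) x →L[ℝ] TangentSpace (𝓡∂ 4) x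
  smooth : ContMDiff (𝓡∂ 4) ((𝓡∂ 4).prod 𝓘(ℝ, E4 →L[ℝ] E4)) ∞
    (fun x ↦ TotalSpace.mk' (E4 →L[ℝ] E4)
      (E := fun x : M ↦ TangentSpace (𝓡∂ 4) x →L[ℝ] TangentSpace (𝓡∂ 4) x) x (J x))
  sq_eq : ∀ (x : M) (v : TangentSpace (𝓡∂ 4) x), J x (J x v) = -v

variable {M}

/-- The coefficients of a field of bilinear forms in the chart at `x₀`: its pull-back by the inverse
of the extended chart, evaluated at the point `y` on the constant vectors `v` and `w`. -/
def chartForm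
    (Ω : ∀ x : M, TangentSpace (𝓡∂ 4) x →L[ℝ] TangentSpace (𝓡∂ 4) x →L[ℝ] ℝ)
    (x₀ : M) (v w y : E4) : ℝ :=
  Ω ((extChartAt (𝓡∂ 4) x₀).symm y)
    (mfderivWithin 𝓘(ℝ, E4) (𝓡∂ 4) (extChartAt (𝓡∂ 4) x₀).symm (range (𝓡∂ 4)) y v)
    (mfderivWithin 𝓘(ℝ, E4) (𝓡∂ 4) (extChartAt (𝓡∂ 4) x₀).symm (range (𝓡∂ 4)) y w)

/-- A smooth symplectic form taming the almost complex structure `𝒥`. Nondegeneracy follows from the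
taming condition. -/
structure TameSymplecticForm (𝒥 : AlmostComplexStructure M) where
  /-- The bilinear form on each tangent space. -/
  form : ∀ x : M, TangentSpace (𝓡∂ 4) x →L[ℝ] TangentSpace (𝓡∂ 4) x →L[ℝ] ℝ
  smooth : ContMDiff (𝓡∂ 4) ((𝓡∂ 4).prod 𝓘(ℝ, E4 →L[ℝ] E4 →L[ℝ] ℝ)) ∞
    (fun x ↦ TotalSpace.mk' (E4 →L[ℝ] E4 →L[ℝ] ℝ)
      (E := fun x : M ↦ TangentSpace (𝓡∂ 4) x →L[ℝ] TangentSpace (𝓡∂ 4) x →L[ℝ] ℝ) x (form x))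
  antisymm : ∀ (x : M) (v w : TangentSpace (𝓡∂ 4) x), form x v w = -form x w v
  /-- The exterior derivative `dΩ(u, v, w) = ∂ᵤ Ω(v, w) + ∂ᵥ Ω(w, u) + ∂_w Ω(u, v)` of the form `Ω` vanishes in
  every chart. -/
  closed : ∀ (x₀ : M), ∀ y ∈ (extChartAt (𝓡∂ 4) x₀).target, ∀ u v w : E4,
    fderivWithin ℝ (chartForm form x₀ v w) (range (𝓡∂ 4)) y u +
      fderivWithin ℝ (chartForm form x₀ w u) (range (𝓡∂ 4)) y v +
      fderivWithin ℝ (chartForm form x₀ u v) (range (𝓡∂ 4)) y w = 0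
  tames : ∀ (x : M) (v : TangentSpace (𝓡∂ 4) x), v ≠ 0 → 0 < form x v (𝒥.J x v)

/-- `f` restricts to a `J`-holomorphic map of the open unit disc: it is of class `C¹` there and its
differential is complex linear. -/
def IsJHolomorphicDisc (𝒥 : AlmostComplexStructure M) (f : ℂ → M) : Prop :=
  ContMDiffOn 𝓘(ℝ, ℂ) (𝓡∂ 4) 1 f (Metric.ball 0 1) ∧
    ∀ z ∈ Metric.ball (0 : ℂ) 1, ∀ v : ℂ,
      mfderiv 𝓘(ℝ, ℂ) (𝓡∂ 4) f z (Complex.I * v : ℂ) =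
        𝒥.J (f z) (mfderiv 𝓘(ℝ, ℂ) (𝓡∂ 4) f z v)

/-- The symplectic area `∫_𝔻 f^*Ω = ∫_𝔻 Ω(∂f/∂x, ∂f/∂y) dx dy` of a `J`-holomorphic disc, as an
element of `[0, ∞]` (the integrand is nonnegative for a `J`-holomorphic map). -/
def area {𝒥 : AlmostComplexStructure M} (Ω : TameSymplecticForm 𝒥) (f : ℂ → M) : ENNReal :=
  ∫⁻ z in Metric.ball (0 : ℂ) 1, ENNReal.ofReal
    (Ω.form (f z) (mfderiv 𝓘(ℝ, ℂ) (𝓡∂ 4) f z (1 : ℂ))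
      (mfderiv 𝓘(ℝ, ℂ) (𝓡∂ 4) f z Complex.I))

/-- `ι` is a smooth embedding of the 2-sphere in `M` with image in the boundary `∂M`. (An injective
immersion of a compact manifold is an embedding.) -/
structure IsSphereInBoundary (ι : Sphere2 → M) : Prop where
  smooth : ContMDiff (𝓡 2) (𝓡∂ 4) ∞ ι
  injective : Function.Injective ι
  immersion : ∀ s, Function.Injective (mfderiv (𝓡 2) (𝓡∂ 4) ι s)
  boundary : ∀ s, ι s ∈ (𝓡∂ 4).boundary M

/-- `ι s` is a totally real point of the surface `S = ι(S²)`: `T S ∩ J(T S) = 0` there. -/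
def IsTotallyRealAt (𝒥 : AlmostComplexStructure M) (ι : Sphere2 → M) (s : Sphere2) : Prop :=
  ∀ v w : TangentSpace (𝓡 2) s,
    mfderiv (𝓡 2) (𝓡∂ 4) ι s w = 𝒥.J (ι s) (mfderiv (𝓡 2) (𝓡∂ 4) ι s v) → v = 0

/-- The parameters of the complex points of `S = ι(S²)`, i.e. of those where the tangent plane is
`J`-invariant; for a real plane in complex dimension 2 this means not totally real. -/
def complexPoints (𝒥 : AlmostComplexStructure M) (ι : Sphere2 → M) : Set Sphere2 :=
  {s | ¬ IsTotallyRealAt 𝒥 ι s}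

/-- A Bishop disc for `S`: continuous on the closed unit disc, `J`-holomorphic in the open disc, and
with boundary in `S`. (The values of `f` outside the closed disc are irrelevant.) -/
structure IsBishopDisc (𝒥 : AlmostComplexStructure M) (S : Set M) (f : ℂ → M) : Prop where
  continuousOn : ContinuousOn f (Metric.closedBall 0 1)
  holomorphic : IsJHolomorphicDisc 𝒥 f
  boundary : ∀ z ∈ Metric.sphere (0 : ℂ) 1, f z ∈ S

end Structures

/-- The Möbius transformation `z ↦ c (z - a) / (1 - ā z)`; for `|c| = 1` and `|a| < 1` these are
exactly the conformal automorphisms of the unit disc. -/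
def mobius (c a z : ℂ) : ℂ := c * (z - a) / (1 - starRingEnd ℂ a * z)

/-- `f` is a disc of the limit curve of the sequence `F`: some subsequence of `F`, reparametrized by
Möbius transformations of the disc, converges to `f` uniformly on compact subsets of the disc, off a
finite set (where bubbles might arise). Uniform convergence refers to the unique uniform structure
of the compact Hausdorff space `M`. -/
def IsLimitDisc {M : Type*} [TopologicalSpace M] [CompactSpace M] [T2Space M]
    (F : ℕ → ℂ → M) (f : ℂ → M) : Prop :=
  letI : UniformSpace M := uniformSpaceOfCompactR1
  ∃ (n : ℕ → ℕ) (c a : ℕ → ℂ) (B : Set ℂ),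
    StrictMono n ∧ (∀ k, ‖c k‖ = 1) ∧ (∀ k, ‖a k‖ < 1) ∧ B.Finite ∧
    TendstoLocallyUniformlyOn (fun k z ↦ F (n k) (mobius (c k) (a k) z)) f atTop
      (Metric.ball 0 1 \ B)

/-- The cluster set `C(f, A)`, for `A ⊆ ∂𝔻`, of a map of the open unit disc: all limits of
`f(ζₙ)` along sequences `ζₙ` in the open disc that converge to a point of `A`. -/
def clusterSet {M : Type*} [TopologicalSpace M] (f : ℂ → M) (A : Set ℂ) : Set M :=
  {p | ∃ ζ ∈ A, ∃ u : ℕ → ℂ, (∀ n, u n ∈ Metric.ball (0 : ℂ) 1) ∧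
    Tendsto u atTop (𝓝 ζ) ∧ Tendsto (fun n ↦ f (u n)) atTop (𝓝 p)}

end BishopDisc

end

/-! Two tools carry the proof. Monotonicity (`IsJCurveOn.monotonicity`): a holomorphic curve through
the centre of a small coordinate ball of radius t that is proper over this ball has energy at least
c t² in it. Courant-Lebesgue (`exists_short_arc`): among the arcs around a boundary point of the
disc with radius between ρ/2 and ρ, one has an image whose squared diameter is at most a constant
times the energy within distance ρ. Taming bounds energy by area, Möbius reparametrization does not
increase area, and lower semicontinuity under pointwise convergence gives the limit f finite energy.

Cluster values lie in S. Let p be a cluster value at ζ that is not in S, and let l be a cut-off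
function equal to 1 near p and to 0 on S. Near a boundary point where the energy of infinitely many
discs is small, such a disc has an arc on which l oscillates by at most 1/8; the arc ends in S, so l
is small on it, and monotonicity acts as a maximum principle: a large value of l inside would cost a
fixed amount of energy. Hence l stays at most 1/2 there, also for f. By the area bound only finitely
many points are excluded. One of them may be ζ, but f itself has finite energy, so small arcs around
ζ, which end at good points, carry small values of l. Two such arcs enclose a point that f maps
close to p, which contradicts the maximum principle (`mem_of_mapClusterPt`).

Totally real points. Near such a point p, S lies in the zero set of a map β into the plane, and
together with a linear map a the differential of β forms complex coordinates at p. Stokes' theorem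
for β and a gives a reverse Poincaré inequality (`IsJCurveOn.caccioppoli`): the energy off {β = 0}
over a ball is bounded by sup |β| times the energy over a larger ball. Monotonicity bounds sup |β|
by the square root of that energy, since a ball that avoids {β = 0} also avoids S. De Giorgi
iteration makes the energy vanish if it was small, so β = 0 along the curve over a smaller ball, and
positivity of the form built from β and a forces the curve to be constant. Hence, if p is a cluster
value at ζ, every arc around ζ that encloses small energy comes close to p
(`RealModel.exists_arc_mem`).

Continuity. Two distinct totally real cluster values at ζ would force a single short arc to come
close to both. So the cluster set at ζ has at most one totally real point besides the finitely many
complex points of S. It is finite; as the images of half-discs at ζ are connected, it is a single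
point, and f has a limit at ζ (`exists_tendsto_of_finite_cluster`). -/

noncomputable section

namespace BishopDisc

/-! ### Coordinate balls adapted to the almost complex structure and the taming form. -/

section ChartModel

variable {M : Type*} [TopologicalSpace M] [ChartedSpace (EuclideanHalfSpace 4) M]
  [IsManifold (𝓡∂ 4) ∞ M]

/-- The points of the chart domain at `p` whose coordinates are within `ρ` of those of `p`. -/
def chartBall (p : M) (ρ : ℝ) : Set M :=
  {x | x ∈ (extChartAt (𝓡∂ 4) p).source ∧
    ‖extChartAt (𝓡∂ 4) p x - extChartAt (𝓡∂ 4) p p‖ < ρ}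

/-- The closed version of `chartBall`. -/
def chartClosedBall (p : M) (ρ : ℝ) : Set M :=
  {x | x ∈ (extChartAt (𝓡∂ 4) p).source ∧
    ‖extChartAt (𝓡∂ 4) p x - extChartAt (𝓡∂ 4) p p‖ ≤ ρ}

/-- The differential of the chart at `p`, with values in the model space. -/
def chartDeriv (p x : M) : TangentSpace (𝓡∂ 4) x →L[ℝ] E4 :=
  mfderiv (𝓡∂ 4) 𝓘(ℝ, E4) (extChartAt (𝓡∂ 4) p) x

/-- A coordinate ball around `p` on which the coordinate expression of the almost complex structure
is bounded and Lipschitz, and the taming form is comparable with the Euclidean metric. -/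
structure ChartModel (𝒥 : AlmostComplexStructure M) (Ω : TameSymplecticForm 𝒥) (p : M) where
  radius : ℝ
  Jc : E4 → E4 →L[ℝ] E4
  lip : ℝ
  bound : ℝ
  ratio : ℝ
  radius_pos : 0 < radius
  lip_nonneg : 0 ≤ lip
  bound_nonneg : 0 ≤ bound
  ratio_pos : 0 < ratio
  mem_target : ∀ y ∈ Metric.closedBall (extChartAt (𝓡∂ 4) p p) radius, y ∈ range (𝓡∂ 4) →
    y ∈ (extChartAt (𝓡∂ 4) p).target
  Jc_sq : ∀ x ∈ chartBall p radius, ∀ v,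
    Jc (extChartAt (𝓡∂ 4) p x) (Jc (extChartAt (𝓡∂ 4) p x) v) = -v
  Jc_norm : ∀ x ∈ chartBall p radius, ‖Jc (extChartAt (𝓡∂ 4) p x)‖ ≤ bound
  Jc_lip : ∀ x ∈ chartBall p radius, ∀ y ∈ chartBall p radius,
    ‖Jc (extChartAt (𝓡∂ 4) p x) - Jc (extChartAt (𝓡∂ 4) p y)‖ ≤
      lip * ‖extChartAt (𝓡∂ 4) p x - extChartAt (𝓡∂ 4) p y‖
  Jc_comm : ∀ x ∈ chartBall p radius, ∀ v : TangentSpace (𝓡∂ 4) x,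
    chartDeriv p x (𝒥.J x v) = Jc (extChartAt (𝓡∂ 4) p x) (chartDeriv p x v)
  norm_le : ∀ x ∈ chartBall p radius, ∀ v : TangentSpace (𝓡∂ 4) x,
    ‖chartDeriv p x v‖ ^ 2 ≤ ratio * Ω.form x v (𝒥.J x v)

/-- A continuous family of quadratic forms that is positive definite at `x₀` is uniformly so
nearby. -/
theorem exists_norm_sq_le_of_posDef {E : Type*} [NormedAddCommGroup E] [NormedSpace ℝ E]
    [FiniteDimensional ℝ E] [Nontrivial E] {X : Type*} [TopologicalSpace X] {x₀ : X}
    {Q : X → E → ℝ} (hQ : ∀ v, ContinuousAt (fun z : X × E ↦ Q z.1 z.2) (x₀, v))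
    (hom : ∀ x (c : ℝ) v, Q x (c • v) = c ^ 2 * Q x v) (hpos : ∀ v, v ≠ 0 → 0 < Q x₀ v) :
    ∃ C > 0, ∀ᶠ x in 𝓝 x₀, ∀ v, ‖v‖ ^ 2 ≤ C * Q x v := by
  have : ProperSpace E := FiniteDimensional.proper ℝ E
  have hcpt : IsCompact (Metric.sphere (0 : E) 1) := isCompact_sphere 0 1
  have hne : (Metric.sphere (0 : E) 1).Nonempty := NormedSpace.sphere_nonempty.2 zero_le_one
  have hcont : Continuous (fun v : E ↦ Q x₀ v) := continuous_iff_continuousAt.2 fun v ↦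
    ContinuousAt.comp (f := fun v : E ↦ (x₀, v)) (hQ v) (by fun_prop)
  obtain ⟨v₀, hv₀, hmin⟩ := hcpt.exists_isMinOn hne hcont.continuousOn
  set m := Q x₀ v₀ with hm
  have hmpos : 0 < m := hpos v₀ (by rintro rfl; simp at hv₀)
  have hev : ∀ᶠ x in 𝓝 x₀, ∀ v ∈ Metric.sphere (0 : E) 1, m / 2 < Q x v := by
    refine hcpt.eventually_forall_of_forall_eventually fun v hv ↦ ?_
    have h1 : m ≤ Q x₀ v := hmin hv
    exact (hQ v).eventually (lt_mem_nhds (show m / 2 < Q x₀ v by linarith))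
  refine ⟨2 / m, by positivity, hev.mono fun x hx v ↦ ?_⟩
  rcases eq_or_ne v 0 with rfl | hv
  · have h0 : Q x 0 = 0 := by simpa using hom x 0 0
    rw [h0]; simp
  have hn : 0 < ‖v‖ := norm_pos_iff.2 hv
  have h2 := (hx (‖v‖⁻¹ • v) (by simp [norm_smul, hn.ne'])).le
  rw [hom] at h2
  calc ‖v‖ ^ 2 = 2 / m * (m / 2 * ‖v‖ ^ 2) := by field_simp
    _ ≤ 2 / m * ((‖v‖⁻¹ ^ 2 * Q x v) * ‖v‖ ^ 2) := by gcongr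
    _ = 2 / m * Q x v := by field_simp

/-- In the trivialization of the tangent bundle at p the matrix of J is smooth, hence bounded and,
the half-space being convex, Lipschitz near p. Taming says that Ω(v, Jv) is positive definite at p,
and this is uniform nearby. -/
theorem exists_chartModel (𝒥 : AlmostComplexStructure M) (Ω : TameSymplecticForm 𝒥) (p : M) :
    Nonempty (ChartModel 𝒥 Ω p) := by
  set φ := extChartAt (𝓡∂ 4) p with hφ
  set e := trivializationAt E4 (TangentSpace (𝓡∂ 4)) p with he
  have hbase : e.baseSet = φ.source := by
    simp [he, hφ]
  set JC : M → E4 →L[ℝ] E4 := fun x ↦ ContinuousLinearMap.inCoordinates E4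
    (TangentSpace (𝓡∂ 4)) E4 (TangentSpace (𝓡∂ 4)) p x p x (𝒥.J x) with hJC
  set ΩC : M → E4 →L[ℝ] E4 →L[ℝ] ℝ := fun x ↦ ContinuousLinearMap.inCoordinates E4
    (TangentSpace (𝓡∂ 4)) (E4 →L[ℝ] ℝ) (fun x : M ↦ TangentSpace (𝓡∂ 4) x →L[ℝ] ℝ) p x p x
      (Ω.form x) with hΩC
  have hJsm : ContMDiffAt (𝓡∂ 4) 𝓘(ℝ, E4 →L[ℝ] E4) ∞ JC p :=
    ((contMDiffAt_hom_bundle _).1 (𝒥.smooth p)).2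
  have hΩsm : ContMDiffAt (𝓡∂ 4) 𝓘(ℝ, E4 →L[ℝ] E4 →L[ℝ] ℝ) ∞ ΩC p :=
    ((contMDiffAt_hom_bundle _).1 (Ω.smooth p)).2
  have hmf : ∀ x ∈ φ.source, e.continuousLinearMapAt ℝ x = chartDeriv p x := fun x hx ↦
    TangentBundle.continuousLinearMapAt_trivializationAt (by simpa [hφ] using hx)
  have hJapp : ∀ x ∈ φ.source, ∀ v : TangentSpace (𝓡∂ 4) x,
      JC x (e.continuousLinearMapAt ℝ x v) = e.continuousLinearMapAt ℝ x (𝒥.J x v) := by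
    intro x hx v
    have hx' : x ∈ e.baseSet := hbase ▸ hx
    simp only [hJC]
    rw [ContinuousLinearMap.inCoordinates]
    simp only [ContinuousLinearMap.comp_apply]
    rw [Trivialization.symmL_continuousLinearMapAt _ hx']
  have hsymm : ∀ x ∈ φ.source, ∀ v : E4,
      e.continuousLinearMapAt ℝ x (e.symmL ℝ x v) = v := fun x hx v ↦
    Trivialization.continuousLinearMapAt_symmL _ (hbase ▸ hx) v
  have hJsq : ∀ x ∈ φ.source, ∀ v : E4, JC x (JC x v) = -v := by
    intro x hx v
    rw [← hsymm x hx v, hJapp x hx, hJapp x hx, 𝒥.sq_eq, map_neg]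
  set B : M → E4 → ℝ := fun x v ↦ ΩC x v (JC x v) with hB
  have hBcont : ∀ v, ContinuousAt (fun z : M × E4 ↦ B z.1 z.2) (p, v) := by
    intro v
    have h1 : ContinuousAt (fun z : M × E4 ↦ JC z.1) (p, v) :=
      ContinuousAt.fst'' (x := (p, v)) hJsm.continuousAt
    have h2 : ContinuousAt (fun z : M × E4 ↦ ΩC z.1) (p, v) :=
      ContinuousAt.fst'' (x := (p, v)) hΩsm.continuousAt
    exact (h2.clm_apply continuousAt_snd).clm_apply (h1.clm_apply continuousAt_snd)
  have hBapp : ∀ x ∈ φ.source, ∀ v : TangentSpace (𝓡∂ 4) x,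
      B x (e.continuousLinearMapAt ℝ x v) = Ω.form x v (𝒥.J x v) := by
    intro x hx v
    have hx' : x ∈ e.baseSet := hbase ▸ hx
    simp only [hB, hJapp x hx, hΩC]
    rw [inCoordinates_apply_eq₂ (E₃ := fun _ : M ↦ ℝ) hx' hx' (Set.mem_univ _)]
    have key : ∀ w : TangentSpace (𝓡∂ 4) x, e.symm x (e.continuousLinearMapAt ℝ x w) = w :=
      fun w ↦ by
        rw [← e.symmL_apply (R := ℝ) hx']
        exact e.symmL_continuousLinearMapAt (R := ℝ) hx' w
    rw [key, key]
    simp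
  have hpsource : p ∈ φ.source := mem_extChartAt_source p
  obtain ⟨C, hC, hCev⟩ := exists_norm_sq_le_of_posDef hBcont (by
    intro x c v
    simp only [hB, map_smul, smul_apply, smul_eq_mul]
    ring) (by
    intro v hv
    rw [← hsymm p hpsource v, hBapp p hpsource]
    refine Ω.tames p _ fun h ↦ hv ?_
    rw [← hsymm p hpsource v, h, map_zero])
  have hJdiff : ContDiffWithinAt ℝ 1 (JC ∘ φ.symm) (range (𝓡∂ 4)) (φ p) := by
    have := (contMDiffAt_iff.1 hJsm).2
    simp only [extChartAt_model_space_eq_id] at this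
    exact this.of_le (by exact_mod_cast le_top)
  obtain ⟨K, t, ht, hLip⟩ := hJdiff.exists_lipschitzOnWith (𝓡∂ 4).convex_range
  have hJbd : ∀ᶠ x in 𝓝 p, ‖JC x‖ < ‖JC p‖ + 1 :=
    hJsm.continuousAt.norm.eventually (gt_mem_nhds (by simp))
  have hgood : ∀ᶠ x in 𝓝 p, (∀ v, ‖v‖ ^ 2 ≤ C * B x v) ∧ ‖JC x‖ < ‖JC p‖ + 1 := hCev.and hJbd
  have hgood' : ∀ᶠ y in 𝓝[range (𝓡∂ 4)] (φ p), y ∈ t ∧ y ∈ φ.target ∧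
      ((∀ v, ‖v‖ ^ 2 ≤ C * B (φ.symm y) v) ∧ ‖JC (φ.symm y)‖ < ‖JC p‖ + 1) := by
    refine (eventually_mem_set.2 ht).and
      ((eventually_mem_set.2 (extChartAt_target_mem_nhdsWithin p)).and ?_)
    have hc : Tendsto φ.symm (𝓝[range (𝓡∂ 4)] (φ p)) (𝓝 p) := by
      have := (continuousAt_extChartAt_symm (I := 𝓡∂ 4) p)
      have h2 := this.tendsto
      rw [extChartAt_to_inv] at h2
      exact h2.mono_left nhdsWithin_le_nhds
    exact hc.eventually hgood
  obtain ⟨r, hr, hrsub⟩ := Metric.mem_nhdsWithin_iff.1 hgood'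
  have hball : ∀ x ∈ chartBall p (r / 2), x ∈ φ.source ∧ φ x ∈ t ∧ JC (φ.symm (φ x)) = JC x ∧
      ((∀ v, ‖v‖ ^ 2 ≤ C * B x v) ∧ ‖JC x‖ < ‖JC p‖ + 1) := by
    rintro x ⟨hx, hxr⟩
    have h1 : φ x ∈ Metric.ball (φ p) r ∩ range (𝓡∂ 4) := by
      refine ⟨by rw [mem_ball_iff_norm]; exact hxr.trans (by linarith), ?_⟩
      exact extChartAt_target_subset_range p (φ.map_source hx)
    have h2 := hrsub h1
    simp only [mem_ofPred_eq, φ.left_inv hx] at h2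
    exact ⟨hx, h2.1, by rw [φ.left_inv hx], h2.2.2⟩
  refine ⟨{
    -- Half of r, so that the closed ball in `mem_target` still lies in the open ball of radius r.
    radius := r / 2
    Jc := fun y ↦ JC (φ.symm y)
    lip := K
    bound := ‖JC p‖ + 1
    ratio := C
    radius_pos := by positivity
    lip_nonneg := K.2
    bound_nonneg := by positivity
    ratio_pos := hC
    mem_target := ?_
    Jc_sq := ?_
    Jc_norm := ?_
    Jc_lip := ?_
    Jc_comm := ?_
    norm_le := ?_ }⟩
  · intro y hy hy'
    refine (hrsub ⟨?_, hy'⟩).2.1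
    exact Metric.closedBall_subset_ball (by linarith) hy
  · intro x hx v
    obtain ⟨h1, -, h3, -⟩ := hball x hx
    rw [← hφ]
    simp only [h3]
    exact hJsq x h1 v
  · intro x hx
    obtain ⟨h1, -, h3, -, h4⟩ := hball x hx
    rw [← hφ]
    simp only [h3]
    exact h4.le
  · intro x hx y hy
    have := hLip.dist_le_mul _ (hball x hx).2.1 _ (hball y hy).2.1
    rw [dist_eq_norm, dist_eq_norm] at this
    exact this
  · intro x hx v
    obtain ⟨h1, -, h3, -, h4⟩ := hball x hx
    rw [← hφ, ← hmf x h1]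
    simp only [h3]
    exact (hJapp x h1 v).symm
  · intro x hx v
    obtain ⟨h1, -, h3, h4, -⟩ := hball x hx
    rw [← hmf x h1, ← hBapp x h1 v]
    exact h4 _

end ChartModel

/-! ### Holomorphic discs in coordinates; cut-off functions and energy density. -/

section ChartMaps

variable {M : Type*} [TopologicalSpace M] [ChartedSpace (EuclideanHalfSpace 4) M]

theorem isOpen_chartBall (p : M) (ρ : ℝ) : IsOpen (chartBall p ρ) := by
  have h : ContinuousOn (fun x ↦ ‖extChartAt (𝓡∂ 4) p x - extChartAt (𝓡∂ 4) p p‖)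
      (extChartAt (𝓡∂ 4) p).source :=
    ((continuousOn_extChartAt p).sub continuousOn_const).norm
  exact h.isOpen_inter_preimage (isOpen_extChartAt_source p) isOpen_Iio

theorem mem_chartBall_self (p : M) {ρ : ℝ} (hρ : 0 < ρ) : p ∈ chartBall p ρ :=
  ⟨mem_extChartAt_source p, by simpa⟩

theorem chartBall_mem_nhds (p : M) {ρ : ℝ} (hρ : 0 < ρ) : chartBall p ρ ∈ 𝓝 p :=
  (isOpen_chartBall p ρ).mem_nhds (mem_chartBall_self p hρ)

theorem chartBall_mono (p : M) {ρ ρ' : ℝ} (h : ρ ≤ ρ') : chartBall p ρ ⊆ chartBall p ρ' :=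
  fun _ hx ↦ ⟨hx.1, hx.2.trans_le h⟩

theorem chartClosedBall_subset (p : M) {ρ ρ' : ℝ} (h : ρ < ρ') :
    chartClosedBall p ρ ⊆ chartBall p ρ' :=
  fun _ hx ↦ ⟨hx.1, hx.2.trans_lt h⟩

theorem chartBall_subset (p : M) {ρ ρ' : ℝ} (h : ρ ≤ ρ') :
    chartBall p ρ ⊆ chartClosedBall p ρ' :=
  fun _ hx ↦ ⟨hx.1, hx.2.le.trans h⟩

/-- Neighbourhoods of `p` contain small chart balls. -/
theorem exists_chartBall_subset (p : M) {N : Set M} (hN : N ∈ 𝓝 p) :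
    ∃ ρ > 0, chartBall p ρ ⊆ N := by
  set φ := extChartAt (𝓡∂ 4) p
  have h1 : Tendsto φ.symm (𝓝 (φ p)) (𝓝 p) := by
    have := (continuousAt_extChartAt_symm (I := 𝓡∂ 4) p).tendsto
    rwa [extChartAt_to_inv] at this
  obtain ⟨ρ, hρ, hsub⟩ := Metric.mem_nhds_iff.1 (h1 hN)
  refine ⟨ρ, hρ, fun x hx ↦ ?_⟩
  have := hsub (mem_ball_iff_norm.2 hx.2)
  rwa [mem_preimage, φ.left_inv hx.1] at this

/-- The map `ψ`, defined in the coordinates at `p`, seen on the manifold and extended by zero. -/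
def chartLift {F : Type*} [Zero F] (p : M) (ψ : E4 → F) : M → F :=
  (extChartAt (𝓡∂ 4) p).source.indicator (fun x ↦ ψ (extChartAt (𝓡∂ 4) p x))

theorem chartLift_eq_zero {F : Type*} [NormedAddCommGroup F] {p : M} {ψ : E4 → F} {ρ : ℝ}
    (hψ : ∀ y, ρ < ‖y - extChartAt (𝓡∂ 4) p p‖ → ψ y = 0) {x : M}
    (hx : x ∉ chartClosedBall p ρ) : chartLift p ψ x = 0 := by
  by_cases h : x ∈ (extChartAt (𝓡∂ 4) p).source
  · rw [chartLift, indicator_of_mem h]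
    exact hψ _ (not_le.1 fun h' ↦ hx ⟨h, h'⟩)
  · exact indicator_of_notMem h _

variable [IsManifold (𝓡∂ 4) ∞ M] {𝒥 : AlmostComplexStructure M} {Ω : TameSymplecticForm 𝒥} {p : M}

/-- The closed coordinate ball is the image of a compact piece of the half-space under the inverse
chart, so it is compact and therefore closed in the Hausdorff space M. This is what lets functions
supported in it be extended by zero. -/
theorem ChartModel.isClosed_chartClosedBall [T2Space M] (cm : ChartModel 𝒥 Ω p) {ρ : ℝ}
    (hρ : ρ ≤ cm.radius) : IsClosed (chartClosedBall p ρ) := by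
  set φ := extChartAt (𝓡∂ 4) p with hφ
  have hK : IsCompact (Metric.closedBall (φ p) ρ ∩ range (𝓡∂ 4)) :=
    (isCompact_closedBall _ _).inter_right (𝓡∂ 4).isClosed_range
  have hsub : Metric.closedBall (φ p) ρ ∩ range (𝓡∂ 4) ⊆ φ.target := fun y hy ↦
    cm.mem_target y (Metric.closedBall_subset_closedBall hρ hy.1) hy.2
  have himg : φ.symm '' (Metric.closedBall (φ p) ρ ∩ range (𝓡∂ 4)) = chartClosedBall p ρ := by
    ext x
    constructor
    · rintro ⟨y, hy, rfl⟩
      refine ⟨φ.map_target (hsub hy), ?_⟩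
      rw [← hφ, φ.right_inv (hsub hy)]
      exact mem_closedBall_iff_norm.1 hy.1
    · rintro ⟨hx, hx'⟩
      refine ⟨φ x, ⟨mem_closedBall_iff_norm.2 hx', ?_⟩, φ.left_inv hx⟩
      exact extChartAt_target_subset_range p (φ.map_source hx)
  rw [← himg]
  exact (hK.image_of_continuousOn ((continuousOn_extChartAt_symm p).mono hsub)).isClosed

theorem IsJHolomorphicDisc.contMDiffAt {u : ℂ → M} (hu : IsJHolomorphicDisc 𝒥 u) {z : ℂ}
    (hz : z ∈ Metric.ball (0 : ℂ) 1) : ContMDiffAt 𝓘(ℝ, ℂ) (𝓡∂ 4) 1 u z :=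
  hu.1.contMDiffAt (Metric.isOpen_ball.mem_nhds hz)

theorem IsJHolomorphicDisc.contDiffAt_chart {u : ℂ → M} (hu : IsJHolomorphicDisc 𝒥 u) {z : ℂ}
    (hz : z ∈ Metric.ball (0 : ℂ) 1) (hp : u z ∈ (extChartAt (𝓡∂ 4) p).source) :
    ContDiffAt ℝ 1 (fun z ↦ extChartAt (𝓡∂ 4) p (u z)) z := by
  have h1 : ContMDiffAt (𝓡∂ 4) 𝓘(ℝ, E4) 1 (extChartAt (𝓡∂ 4) p) (u z) :=
    contMDiffAt_extChartAt' (by simpa using hp)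
  exact (h1.comp z (hu.contMDiffAt hz)).contDiffAt

theorem IsJHolomorphicDisc.fderiv_chart {u : ℂ → M} (hu : IsJHolomorphicDisc 𝒥 u) {z : ℂ}
    (hz : z ∈ Metric.ball (0 : ℂ) 1) (hp : u z ∈ (extChartAt (𝓡∂ 4) p).source) (h : ℂ) :
    fderiv ℝ (fun z ↦ extChartAt (𝓡∂ 4) p (u z)) z h =
      chartDeriv p (u z) (mfderiv 𝓘(ℝ, ℂ) (𝓡∂ 4) u z h) := by
  have h1 : MDifferentiableAt (𝓡∂ 4) 𝓘(ℝ, E4) (extChartAt (𝓡∂ 4) p) (u z) :=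
    mdifferentiableAt_extChartAt (by simpa using hp)
  have h2 : MDifferentiableAt 𝓘(ℝ, ℂ) (𝓡∂ 4) u z :=
    (hu.contMDiffAt hz).mdifferentiableAt one_ne_zero
  have h3 := mfderiv_comp z h1 h2
  rw [mfderiv_eq_fderiv] at h3
  exact DFunLike.congr_fun h3 h

theorem IsJHolomorphicDisc.fderiv_chart_I (cm : ChartModel 𝒥 Ω p) {u : ℂ → M}
    (hu : IsJHolomorphicDisc 𝒥 u) {z : ℂ} (hz : z ∈ Metric.ball (0 : ℂ) 1)
    (hp : u z ∈ chartBall p cm.radius) :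
    fderiv ℝ (fun z ↦ extChartAt (𝓡∂ 4) p (u z)) z Complex.I =
      cm.Jc (extChartAt (𝓡∂ 4) p (u z))
        (fderiv ℝ (fun z ↦ extChartAt (𝓡∂ 4) p (u z)) z 1) := by
  rw [hu.fderiv_chart hz hp.1, hu.fderiv_chart hz hp.1, ← cm.Jc_comm _ hp, ← hu.2 z hz 1, mul_one]

/-- Holomorphicity turns the area density into Ω(v, Jv) with v the derivative in direction 1; taming
compares this with the Euclidean norm of v. -/
theorem IsJHolomorphicDisc.norm_fderiv_chart_sq_le (cm : ChartModel 𝒥 Ω p) {u : ℂ → M}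
    (hu : IsJHolomorphicDisc 𝒥 u) {z : ℂ} (hz : z ∈ Metric.ball (0 : ℂ) 1)
    (hp : u z ∈ chartBall p cm.radius) :
    ‖fderiv ℝ (fun z ↦ extChartAt (𝓡∂ 4) p (u z)) z 1‖ ^ 2 ≤
      cm.ratio * Ω.form (u z) (mfderiv 𝓘(ℝ, ℂ) (𝓡∂ 4) u z (1 : ℂ))
        (mfderiv 𝓘(ℝ, ℂ) (𝓡∂ 4) u z Complex.I) := by
  rw [hu.fderiv_chart hz hp.1]
  refine (cm.norm_le _ hp _).trans_eq ?_
  rw [← hu.2 z hz 1, mul_one]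

/-- A real linear map on `ℂ` is bounded through its values at `1` and `i`. -/
theorem norm_le_of_apply_one_I {F : Type*} [NormedAddCommGroup F] [NormedSpace ℝ F]
    (T : ℂ →L[ℝ] F) : ‖T‖ ≤ ‖T 1‖ + ‖T Complex.I‖ := by
  refine T.opNorm_le_bound (by positivity) fun h ↦ ?_
  have h1 : h = h.re • (1 : ℂ) + h.im • Complex.I := by
    simp [Complex.re_add_im]
  calc ‖T h‖ = ‖h.re • T 1 + h.im • T Complex.I‖ := by
        conv_lhs => rw [h1]
        simp only [map_add, map_smul]
    _ ≤ |h.re| * ‖T 1‖ + |h.im| * ‖T Complex.I‖ := by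
        refine (norm_add_le _ _).trans ?_
        simp [norm_smul]
    _ ≤ ‖h‖ * ‖T 1‖ + ‖h‖ * ‖T Complex.I‖ := by
        gcongr
        · exact Complex.abs_re_le_norm h
        · exact Complex.abs_im_le_norm h
    _ = _ := by ring

theorem IsJHolomorphicDisc.norm_fderiv_chart_le (cm : ChartModel 𝒥 Ω p) {u : ℂ → M}
    (hu : IsJHolomorphicDisc 𝒥 u) {z : ℂ} (hz : z ∈ Metric.ball (0 : ℂ) 1)
    (hp : u z ∈ chartBall p cm.radius) :
    ‖fderiv ℝ (fun z ↦ extChartAt (𝓡∂ 4) p (u z)) z‖ ≤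
      (1 + cm.bound) * ‖fderiv ℝ (fun z ↦ extChartAt (𝓡∂ 4) p (u z)) z 1‖ := by
  refine (norm_le_of_apply_one_I _).trans ?_
  rw [hu.fderiv_chart_I cm hz hp, add_mul, one_mul]
  gcongr
  exact (ContinuousLinearMap.le_opNorm _ _).trans (by gcongr; exact cm.Jc_norm _ hp)

variable {F : Type*} [NormedAddCommGroup F]

theorem chartLift_comp_eventuallyEq {u : ℂ → M} (hu : IsJHolomorphicDisc 𝒥 u) {z : ℂ}
    (hz : z ∈ Metric.ball (0 : ℂ) 1) (hp : u z ∈ (extChartAt (𝓡∂ 4) p).source) (ψ : E4 → F) :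
    (fun z ↦ chartLift p ψ (u z)) =ᶠ[𝓝 z] fun z ↦ ψ (extChartAt (𝓡∂ 4) p (u z)) := by
  have := (hu.contMDiffAt hz).continuousAt ((isOpen_extChartAt_source p).mem_nhds hp)
  filter_upwards [this] with w hw
  have hw' : u w ∈ (extChartAt (𝓡∂ 4) p).source := hw
  rw [chartLift, indicator_of_mem hw']

theorem chartLift_comp_eventuallyEq_zero [T2Space M] (cm : ChartModel 𝒥 Ω p) {u : ℂ → M}
    (hu : IsJHolomorphicDisc 𝒥 u) {z : ℂ} (hz : z ∈ Metric.ball (0 : ℂ) 1) {ψ : E4 → F} {ρ : ℝ}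
    (hρ : ρ ≤ cm.radius) (hψ : ∀ y, ρ < ‖y - extChartAt (𝓡∂ 4) p p‖ → ψ y = 0)
    (hp : u z ∉ chartClosedBall p ρ) :
    (fun z ↦ chartLift p ψ (u z)) =ᶠ[𝓝 z] fun _ ↦ (0 : F) := by
  have := (hu.contMDiffAt hz).continuousAt
    ((cm.isClosed_chartClosedBall hρ).isOpen_compl.mem_nhds hp)
  filter_upwards [this] with w hw
  exact chartLift_eq_zero hψ hw

theorem contDiffOn_chartLift_comp [NormedSpace ℝ F] [T2Space M] (cm : ChartModel 𝒥 Ω p) {u : ℂ → M}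
    (hu : IsJHolomorphicDisc 𝒥 u) {ψ : E4 → F} {ρ : ℝ} (hρ : ρ ≤ cm.radius)
    (hψ : ∀ y, ρ < ‖y - extChartAt (𝓡∂ 4) p p‖ → ψ y = 0) (hψc : ContDiff ℝ 1 ψ) :
    ContDiffOn ℝ 1 (fun z ↦ chartLift p ψ (u z)) (Metric.ball 0 1) := by
  intro z hz
  refine ContDiffAt.contDiffWithinAt ?_
  by_cases hp : u z ∈ chartClosedBall p ρ
  · exact (hψc.contDiffAt.comp z (hu.contDiffAt_chart hz hp.1)).congr_of_eventuallyEq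
      (chartLift_comp_eventuallyEq hu hz hp.1 ψ)
  · exact contDiffAt_const.congr_of_eventuallyEq
      (chartLift_comp_eventuallyEq_zero cm hu hz hρ hψ hp)

theorem continuous_chartLift [T2Space M] (cm : ChartModel 𝒥 Ω p) {ψ : E4 → F} {ρ : ℝ}
    (hρ : ρ ≤ cm.radius) (hψ : ∀ y, ρ < ‖y - extChartAt (𝓡∂ 4) p p‖ → ψ y = 0)
    (hψc : Continuous ψ) : Continuous (chartLift p ψ) := by
  refine continuous_iff_continuousAt.2 fun x ↦ ?_
  by_cases hp : x ∈ chartClosedBall p ρ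
  · have h1 : chartLift p ψ =ᶠ[𝓝 x] fun x ↦ ψ (extChartAt (𝓡∂ 4) p x) := by
      filter_upwards [(isOpen_extChartAt_source p).mem_nhds hp.1] with y hy
      exact indicator_of_mem hy _
    exact (hψc.continuousAt.comp (continuousAt_extChartAt' hp.1)).congr h1.symm
  · have h1 : chartLift p ψ =ᶠ[𝓝 x] fun _ ↦ 0 := by
      filter_upwards [(cm.isClosed_chartClosedBall hρ).isOpen_compl.mem_nhds hp] with y hy
      exact chartLift_eq_zero hψ hy
    exact continuousAt_const.congr h1.symm

variable [NormedSpace ℝ F]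

/-- The derivative of a compactly supported function is bounded. -/
theorem exists_norm_fderiv_le {ψ : E4 → F} (hψc : ContDiff ℝ 1 ψ) {y₀ : E4} {ρ : ℝ}
    (hψ : ∀ y, ρ < ‖y - y₀‖ → ψ y = 0) : ∃ K > 0, ∀ y, ‖fderiv ℝ ψ y‖ ≤ K := by
  have hs : HasCompactSupport ψ := by
    refine HasCompactSupport.intro (isCompact_closedBall y₀ ρ) fun y hy ↦ hψ y ?_
    rwa [mem_closedBall_iff_norm, not_le] at hy
  obtain ⟨K, hK⟩ := (hs.fderiv (𝕜 := ℝ)).exists_bound_of_continuous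
    (hψc.continuous_fderiv one_ne_zero)
  exact ⟨max K 1, by positivity, fun y ↦ (hK y).trans (le_max_left _ _)⟩

/-- Centred coordinates at `p`, cut off outside the ball of radius `radius / 2`. -/
def ChartModel.vec (cm : ChartModel 𝒥 Ω p) : E4 → E4 :=
  let θ : ContDiffBump (extChartAt (𝓡∂ 4) p p) :=
    ⟨cm.radius / 2, 3 * cm.radius / 4, by linarith [cm.radius_pos], by linarith [cm.radius_pos]⟩
  fun y ↦ θ y • (y - extChartAt (𝓡∂ 4) p p)

theorem ChartModel.contDiff_vec (cm : ChartModel 𝒥 Ω p) : ContDiff ℝ 1 cm.vec := by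
  unfold ChartModel.vec
  exact (ContDiffBump.contDiff _).smul (contDiff_id.sub contDiff_const)

theorem ChartModel.vec_eq_zero (cm : ChartModel 𝒥 Ω p) (y : E4)
    (hy : 3 * cm.radius / 4 < ‖y - extChartAt (𝓡∂ 4) p p‖) : cm.vec y = 0 := by
  unfold ChartModel.vec
  rw [ContDiffBump.zero_of_le_dist, zero_smul]
  rw [dist_eq_norm]
  exact hy.le

theorem ChartModel.vec_eq (cm : ChartModel 𝒥 Ω p) {y : E4}
    (hy : ‖y - extChartAt (𝓡∂ 4) p p‖ ≤ cm.radius / 2) :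
    cm.vec y = y - extChartAt (𝓡∂ 4) p p := by
  unfold ChartModel.vec
  rw [ContDiffBump.one_of_mem_closedBall, one_smul]
  exact mem_closedBall_iff_norm.2 hy

/-- The density of the energy of `u` in the coordinates at `p`. -/
def ChartModel.density (cm : ChartModel 𝒥 Ω p) (u : ℂ → M) (z : ℂ) : ENNReal :=
  ‖fderiv ℝ (fun z ↦ chartLift p cm.vec (u z)) z 1‖ₑ ^ 2

theorem ChartModel.fderiv_vec (cm : ChartModel 𝒥 Ω p) {u : ℂ → M} (hu : IsJHolomorphicDisc 𝒥 u)
    {z : ℂ} (hz : z ∈ Metric.ball (0 : ℂ) 1) (hp : u z ∈ chartBall p (cm.radius / 2)) :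
    fderiv ℝ (fun z ↦ chartLift p cm.vec (u z)) z =
      fderiv ℝ (fun z ↦ extChartAt (𝓡∂ 4) p (u z)) z := by
  have h : (fun z ↦ chartLift p cm.vec (u z)) =ᶠ[𝓝 z]
      fun z ↦ extChartAt (𝓡∂ 4) p (u z) - extChartAt (𝓡∂ 4) p p := by
    filter_upwards [chartLift_comp_eventuallyEq hu hz hp.1 cm.vec,
      (hu.contMDiffAt hz).continuousAt ((isOpen_chartBall p _).mem_nhds hp)] with w hw hw'
    rw [hw, cm.vec_eq hw'.2.le]
  rw [h.fderiv_eq, fderiv_sub_const]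

/-- The cut-off coordinates are defined on all of M, so the bound holds on the whole disc, wherever
u takes its values: off the support the density vanishes, on it the chain rule and taming apply. -/
theorem ChartModel.exists_density_le [T2Space M] (cm : ChartModel 𝒥 Ω p) :
    ∃ C : NNReal, ∀ u : ℂ → M, IsJHolomorphicDisc 𝒥 u → ∀ z ∈ Metric.ball (0 : ℂ) 1,
      cm.density u z ≤ C * ENNReal.ofReal
        (Ω.form (u z) (mfderiv 𝓘(ℝ, ℂ) (𝓡∂ 4) u z (1 : ℂ))
          (mfderiv 𝓘(ℝ, ℂ) (𝓡∂ 4) u z Complex.I)) := by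
  obtain ⟨K, hK, hKb⟩ := exists_norm_fderiv_le cm.contDiff_vec cm.vec_eq_zero
  refine ⟨(K ^ 2 * cm.ratio).toNNReal, fun u hu z hz ↦ ?_⟩
  by_cases hp : u z ∈ chartClosedBall p (3 * cm.radius / 4)
  · have hp' : u z ∈ chartBall p cm.radius :=
      chartClosedBall_subset p (by linarith [cm.radius_pos]) hp
    have h1 := (chartLift_comp_eventuallyEq hu hz hp.1 cm.vec).fderiv_eq (𝕜 := ℝ)
    have h2 : fderiv ℝ (fun z ↦ cm.vec (extChartAt (𝓡∂ 4) p (u z))) z =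
        (fderiv ℝ cm.vec (extChartAt (𝓡∂ 4) p (u z))).comp
          (fderiv ℝ (fun z ↦ extChartAt (𝓡∂ 4) p (u z)) z) :=
      fderiv_comp z (cm.contDiff_vec.differentiable one_ne_zero _)
        ((hu.contDiffAt_chart hz hp.1).differentiableAt one_ne_zero)
    have h3 : ‖fderiv ℝ (fun z ↦ chartLift p cm.vec (u z)) z 1‖ ≤
        K * ‖fderiv ℝ (fun z ↦ extChartAt (𝓡∂ 4) p (u z)) z 1‖ := by
      rw [h1, h2, ContinuousLinearMap.comp_apply]
      exact (ContinuousLinearMap.le_opNorm _ _).trans (by gcongr; exact hKb _)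
    have h4 := hu.norm_fderiv_chart_sq_le cm hz hp'
    rw [ChartModel.density, ← ofReal_norm, ← ENNReal.ofReal_pow (norm_nonneg _),
      ENNReal.ofNNReal_toNNReal, ← ENNReal.ofReal_mul (by have := cm.ratio_pos; positivity)]
    refine ENNReal.ofReal_le_ofReal ?_
    calc _ ≤ (K * ‖fderiv ℝ (fun z ↦ extChartAt (𝓡∂ 4) p (u z)) z 1‖) ^ 2 := by gcongr
      _ = K ^ 2 * ‖fderiv ℝ (fun z ↦ extChartAt (𝓡∂ 4) p (u z)) z 1‖ ^ 2 := by ring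
      _ ≤ K ^ 2 * (cm.ratio * _) := by gcongr
      _ = _ := by rw [← mul_assoc]
  · have h1 := (chartLift_comp_eventuallyEq_zero cm hu hz (by linarith [cm.radius_pos])
      cm.vec_eq_zero hp).fderiv_eq (𝕜 := ℝ)
    rw [ChartModel.density, h1]
    simp

/-- The support lies within half the radius, where `vec` is the centred coordinate map itself and
the density is the squared derivative in direction 1. The derivative in direction i is J of it,
hence controlled by `bound`. -/
theorem ChartModel.exists_fderiv_chartLift_le [T2Space M] (cm : ChartModel 𝒥 Ω p) {ψ : E4 → F}
    {ρ : ℝ} (hρ : ρ < cm.radius / 2) (hψ : ∀ y, ρ < ‖y - extChartAt (𝓡∂ 4) p p‖ → ψ y = 0)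
    (hψc : ContDiff ℝ 1 ψ) :
    ∃ C : NNReal, ∀ u : ℂ → M, IsJHolomorphicDisc 𝒥 u → ∀ z ∈ Metric.ball (0 : ℂ) 1,
      ‖fderiv ℝ (fun z ↦ chartLift p ψ (u z)) z‖ₑ ^ 2 ≤ C * cm.density u z := by
  obtain ⟨K, hK, hKb⟩ := exists_norm_fderiv_le hψc hψ
  have hb := cm.bound_nonneg
  have hr := cm.radius_pos
  refine ⟨((K * (1 + cm.bound)) ^ 2).toNNReal, fun u hu z hz ↦ ?_⟩
  by_cases hp : u z ∈ chartClosedBall p ρ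
  · have hp2 : u z ∈ chartBall p (cm.radius / 2) := chartClosedBall_subset p hρ hp
    have hp' : u z ∈ chartBall p cm.radius := chartBall_mono p (by linarith) hp2
    have h1 := (chartLift_comp_eventuallyEq hu hz hp.1 ψ).fderiv_eq (𝕜 := ℝ)
    have h2 : fderiv ℝ (fun z ↦ ψ (extChartAt (𝓡∂ 4) p (u z))) z =
        (fderiv ℝ ψ (extChartAt (𝓡∂ 4) p (u z))).comp
          (fderiv ℝ (fun z ↦ extChartAt (𝓡∂ 4) p (u z)) z) :=
      fderiv_comp z (hψc.differentiable one_ne_zero _)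
        ((hu.contDiffAt_chart hz hp.1).differentiableAt one_ne_zero)
    have h3 : ‖fderiv ℝ (fun z ↦ chartLift p ψ (u z)) z‖ ≤
        K * ((1 + cm.bound) * ‖fderiv ℝ (fun z ↦ extChartAt (𝓡∂ 4) p (u z)) z 1‖) := by
      rw [h1, h2]
      refine (ContinuousLinearMap.opNorm_comp_le _ _).trans ?_
      gcongr
      · exact hKb _
      · exact hu.norm_fderiv_chart_le cm hz hp'
    rw [ChartModel.density, cm.fderiv_vec hu hz hp2, ← ofReal_norm,
      ← ofReal_norm, ← ENNReal.ofReal_pow (norm_nonneg _),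
      ← ENNReal.ofReal_pow (norm_nonneg _), ENNReal.ofNNReal_toNNReal,
      ← ENNReal.ofReal_mul (by positivity)]
    refine ENNReal.ofReal_le_ofReal ?_
    calc _ ≤ (K * ((1 + cm.bound) *
          ‖fderiv ℝ (fun z ↦ extChartAt (𝓡∂ 4) p (u z)) z 1‖)) ^ 2 := by gcongr
      _ = _ := by rw [← mul_assoc, mul_pow]
  · have h1 := (chartLift_comp_eventuallyEq_zero cm hu hz (by linarith) hψ hp).fderiv_eq (𝕜 := ℝ)
    rw [h1, fderiv_fun_const, Pi.zero_apply, ← ofReal_norm, norm_zero]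
    simp

end ChartMaps

/-! ### Stokes' theorem for maps of class C¹. -/

section Stokes

open scoped RealInnerProductSpace

variable {E : Type*} [NormedAddCommGroup E] [InnerProductSpace ℝ E]

theorem exists_fderiv_bound {f : ℂ → E} (hf : ContDiff ℝ 1 f) (hfc : HasCompactSupport f) :
    ∃ K, 0 ≤ K ∧ ∀ z, ‖fderiv ℝ f z‖ ≤ K := by
  obtain ⟨K, hK⟩ := (hfc.fderiv (𝕜 := ℝ)).exists_bound_of_continuous
    (hf.continuous_fderiv one_ne_zero)
  exact ⟨K, (norm_nonneg _).trans (hK 0), hK⟩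

/-- The mean value inequality dominates the difference quotients. They replace one of the two
derivatives in Stokes' theorem, so that no second derivatives are needed. -/
theorem tendsto_integral_inner_slope {a g : ℂ → E} (ha : Continuous a)
    (hac : HasCompactSupport a) (hg : ContDiff ℝ 1 g) (hgc : HasCompactSupport g) (w : ℂ) :
    Tendsto (fun h : ℝ ↦ ∫ z, ⟪a z, h⁻¹ • (g (z + h • w) - g z)⟫) (𝓝[≠] 0)
      (𝓝 (∫ z, ⟪a z, fderiv ℝ g z w⟫)) := by
  obtain ⟨K, hK0, hK⟩ := exists_fderiv_bound hg hgc
  have hgcont := hg.continuous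
  refine tendsto_integral_filter_of_dominated_convergence (fun z ↦ ‖a z‖ * (K * ‖w‖)) ?_ ?_ ?_ ?_
  · refine Eventually.of_forall fun h ↦ Continuous.aestronglyMeasurable ?_
    fun_prop
  · refine eventually_nhdsWithin_of_forall fun h hh ↦ Eventually.of_forall fun z ↦ ?_
    refine (norm_inner_le_norm _ _).trans ?_
    gcongr
    have h1 : ‖g (z + h • w) - g z‖ ≤ K * ‖(z + h • w) - z‖ :=
      convex_univ.norm_image_sub_le_of_norm_fderiv_le
        (fun x _ ↦ hg.differentiable one_ne_zero x) (fun x _ ↦ hK x) (mem_univ _) (mem_univ _)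
    have hh' : (0 : ℝ) < |h| := abs_pos.2 hh
    rw [norm_smul, norm_inv, Real.norm_eq_abs, inv_mul_le_iff₀ hh']
    refine h1.trans_eq ?_
    rw [add_sub_cancel_left, norm_smul, Real.norm_eq_abs]
    ring
  · exact ((ha.norm.mul continuous_const).integrable_of_hasCompactSupport hac.norm.mul_right)
  · refine Eventually.of_forall fun z ↦ ?_
    have h1 := ((hg.differentiable one_ne_zero z).hasFDerivAt.hasLineDerivAt w).tendsto_slope_zero
    exact tendsto_const_nhds.inner h1

/-- **Stokes' theorem** for maps of class `C¹`: the integral of `⟪df ∧ dg⟫` over the plane vanishes. -/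
theorem integral_inner_fderiv_comm {f g : ℂ → E} (hf : ContDiff ℝ 1 f)
    (hfc : HasCompactSupport f) (hg : ContDiff ℝ 1 g) (hgc : HasCompactSupport g) (v w : ℂ) :
    ∫ z, ⟪fderiv ℝ f z v, fderiv ℝ g z w⟫ = ∫ z, ⟪fderiv ℝ f z w, fderiv ℝ g z v⟫ := by
  have hfd : ∀ v, Continuous fun z ↦ fderiv ℝ f z v := fun v ↦
    (hf.continuous_fderiv one_ne_zero).clm_apply continuous_const
  have hgd : ∀ v, Continuous fun z ↦ fderiv ℝ g z v := fun v ↦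
    (hg.continuous_fderiv one_ne_zero).clm_apply continuous_const
  have hfdc : ∀ v, HasCompactSupport fun z ↦ fderiv ℝ f z v := fun v ↦
    hfc.fderiv_apply (𝕜 := ℝ) v
  have hgdc : ∀ v, HasCompactSupport fun z ↦ fderiv ℝ g z v := fun v ↦
    hgc.fderiv_apply (𝕜 := ℝ) v
  have h1 := tendsto_integral_inner_slope (hfd v) (hfdc v) hg hgc w
  have h2 := tendsto_integral_inner_slope (hgd v) (hgdc v) hf hfc w
  have h2' : Tendsto (fun h : ℝ ↦ ∫ z, ⟪fderiv ℝ g z v, (-h)⁻¹ • (f (z + (-h) • w) - f z)⟫)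
      (𝓝[≠] 0) (𝓝 (∫ z, ⟪fderiv ℝ g z v, fderiv ℝ f z w⟫)) := by
    refine h2.comp (tendsto_nhdsWithin_of_tendsto_nhds_of_eventually_within _ ?_ ?_)
    · have : Tendsto (fun h : ℝ ↦ -h) (𝓝 0) (𝓝 (-0)) := continuous_neg.tendsto 0
      rw [neg_zero] at this
      exact this.mono_left nhdsWithin_le_nhds
    · exact eventually_nhdsWithin_of_forall fun h hh ↦ by simpa using hh
  -- Integration by parts in direction v moves the derivative from f to the difference quotient of
  -- g; translating by h w then moves the quotient from g to f and changes the sign of the step.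
  have key : ∀ h : ℝ, h ≠ 0 → ∫ z, ⟪fderiv ℝ f z v, h⁻¹ • (g (z + h • w) - g z)⟫ =
      ∫ z, ⟪fderiv ℝ g z v, (-h)⁻¹ • (f (z + (-h) • w) - f z)⟫ := by
    intro h hh
    set G : ℂ → E := fun z ↦ h⁻¹ • (g (z + h • w) - g z) with hG
    have hGd : ∀ z, HasFDerivAt G (h⁻¹ • (fderiv ℝ g (z + h • w) - fderiv ℝ g z)) z := by
      intro z
      have e1 : HasFDerivAt (fun z ↦ g (z + h • w)) (fderiv ℝ g (z + h • w)) z := by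
        have := (hg.differentiable one_ne_zero (z + h • w)).hasFDerivAt.comp z
          ((hasFDerivAt_id z).add_const (h • w))
        rw [ContinuousLinearMap.comp_id] at this
        exact this
      exact (e1.sub (hg.differentiable one_ne_zero z).hasFDerivAt).const_smul _
    have hGcont : Continuous G := continuous_iff_continuousAt.2 fun z ↦ (hGd z).continuousAt
    have hGdv : Continuous fun z ↦ fderiv ℝ G z v := by
      have : (fun z ↦ fderiv ℝ G z v) =
          fun z ↦ h⁻¹ • (fderiv ℝ g (z + h • w) v - fderiv ℝ g z v) := by
        ext1 z; rw [(hGd z).fderiv]; simp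
      rw [this]
      have := hgd v
      fun_prop
    have hint : ∀ a b : ℂ → E, Continuous a → HasCompactSupport a → Continuous b →
        Integrable fun z ↦ ⟪a z, b z⟫ := by
      intro a b ha hac hb
      refine (ha.inner hb).integrable_of_hasCompactSupport ?_
      refine hac.mono fun z hz hz' ↦ hz ?_
      simp [hz']
    have hparts : ∫ z, ⟪f z, fderiv ℝ G z v⟫ = -∫ z, ⟪fderiv ℝ f z v, G z⟫ :=
      integral_bilinear_fderiv_right_eq_neg_left_of_integrable (B := innerSL ℝ)
        (hint _ _ (hfd v) (hfdc v) hGcont) (hint _ _ hf.continuous hfc hGdv)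
        (hint _ _ hf.continuous hfc hGcont)
        (fun z _ ↦ hf.differentiable one_ne_zero z) (fun z _ ↦ (hGd z).differentiableAt)
    have htr : ∫ z, ⟪f z, fderiv ℝ g (z + h • w) v⟫ = ∫ z, ⟪f (z + (-h) • w), fderiv ℝ g z v⟫ := by
      rw [← integral_add_right_eq_self
        (fun z ↦ ⟪f (z + (-h) • w), fderiv ℝ g z v⟫) (h • w)]
      congr 1
      ext1 z
      congr 2
      simp
    have hgshift : Continuous fun z ↦ fderiv ℝ g (z + h • w) v := by
      have := hgd v
      fun_prop
    have hfshift : Continuous fun z ↦ f (z + (-h) • w) := by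
      have := hf.continuous
      fun_prop
    calc ∫ z, ⟪fderiv ℝ f z v, G z⟫ = -∫ z, ⟪f z, fderiv ℝ G z v⟫ := by rw [hparts, neg_neg]
      _ = -∫ z, h⁻¹ * (⟪f z, fderiv ℝ g (z + h • w) v⟫ - ⟪f z, fderiv ℝ g z v⟫) := by
          congr 2
          ext1 z
          rw [(hGd z).fderiv]
          simp [inner_smul_right, inner_sub_right]
      _ = -(h⁻¹ * ((∫ z, ⟪f (z + (-h) • w), fderiv ℝ g z v⟫) - ∫ z, ⟪f z, fderiv ℝ g z v⟫)) := by
          rw [integral_const_mul, integral_sub (hint _ _ hf.continuous hfc hgshift)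
            (hint _ _ hf.continuous hfc (hgd v)), htr]
      _ = ∫ z, (-h)⁻¹ * (⟪fderiv ℝ g z v, f (z + (-h) • w)⟫ - ⟪fderiv ℝ g z v, f z⟫) := by
          rw [integral_const_mul, integral_sub (hint _ _ (hgd v) (hgdc v) hfshift)
            (hint _ _ (hgd v) (hgdc v) hf.continuous), inv_neg, neg_mul]
          simp_rw [real_inner_comm]
      _ = _ := by
          congr 1
          ext1 z
          simp [inner_smul_right, inner_sub_right]
  have h1' := h1.congr' (eventually_nhdsWithin_of_forall (s := {(0 : ℝ)}ᶜ) fun h hh ↦ key h hh)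
  have h3 := tendsto_nhds_unique h1' h2'
  rw [h3]
  simp_rw [real_inner_comm]

/-- Local form of Stokes' theorem: `f` vanishes off a compact subset `K` of the open set `W`. -/
theorem setIntegral_inner_fderiv_comm {f g : ℂ → E} {W K : Set ℂ} (hW : IsOpen W)
    (hK : IsCompact K) (hKW : K ⊆ W) (hf : ContDiffOn ℝ 1 f W) (hfK : ∀ z ∈ W, z ∉ K → f z = 0)
    (hg : ContDiffOn ℝ 1 g W) (v w : ℂ) :
    ∫ z in W, ⟪fderiv ℝ f z v, fderiv ℝ g z w⟫ = ∫ z in W, ⟪fderiv ℝ f z w, fderiv ℝ g z v⟫ := by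
  -- Only f vanishes off a compact set. Multiplying g by a cut-off equal to 1 near K makes its
  -- support compact as well, without changing the integrands.
  obtain ⟨K', hK', hKK', hK'W⟩ := exists_compact_between hK hW hKW
  obtain ⟨χ, hχ1, hχ0, -⟩ := exists_contMDiffMap_one_nhds_of_subset_interior (n := 1) 𝓘(ℝ, ℂ)
    hK.isClosed hKK'
  have hχc : ContDiff ℝ 1 χ := χ.contMDiff.contDiff
  -- extension by zero of functions vanishing off a compact subset of `W`
  have hext : ∀ (q : ℂ → E) (L : Set ℂ), IsCompact L → L ⊆ W → ContDiffOn ℝ 1 q W →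
      (∀ z ∈ W, z ∉ L → q z = 0) → ContDiff ℝ 1 (W.indicator q) ∧
        HasCompactSupport (W.indicator q) := by
    intro q L hL hLW hq hq0
    have h0 : ∀ z, z ∉ L → W.indicator q z = 0 := by
      intro z hz
      by_cases hzW : z ∈ W
      · rw [indicator_of_mem hzW, hq0 z hzW hz]
      · exact indicator_of_notMem hzW _
    refine ⟨contDiff_iff_contDiffAt.2 fun z ↦ ?_, HasCompactSupport.intro hL h0⟩
    by_cases hzW : z ∈ W
    · refine ((hq z hzW).contDiffAt (hW.mem_nhds hzW)).congr_of_eventuallyEq ?_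
      filter_upwards [hW.mem_nhds hzW] with y hy using indicator_of_mem hy _
    · refine contDiffAt_const (c := (0 : E)).congr_of_eventuallyEq ?_
      filter_upwards [hL.isClosed.isOpen_compl.mem_nhds fun h ↦ hzW (hLW h)] with y hy
      exact h0 y hy
  obtain ⟨hF, hFc⟩ := hext f K hK hKW hf hfK
  obtain ⟨hG, hGc⟩ := hext (fun z ↦ χ z • g z) K' hK' hK'W (hχc.contDiffOn.smul hg)
    (fun z _ hz ↦ by rw [hχ0 z hz, zero_smul])
  have hmain := integral_inner_fderiv_comm hF hFc hG hGc v w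
  have hχ1' : ∀ z ∈ K, ∀ᶠ y in 𝓝 z, χ y = 1 := fun z hz ↦ hχ1.filter_mono (nhds_le_nhdsSet hz)
  have hconv : ∀ a b : ℂ, ∫ z in W, ⟪fderiv ℝ f z a, fderiv ℝ g z b⟫ =
      ∫ z, ⟪fderiv ℝ (W.indicator f) z a, fderiv ℝ (W.indicator fun z ↦ χ z • g z) z b⟫ := by
    intro a b
    rw [← integral_indicator hW.measurableSet]
    congr 1
    ext1 z
    by_cases hzK : z ∈ K
    · rw [indicator_of_mem (hKW hzK)]
      have e1 : W.indicator f =ᶠ[𝓝 z] f := by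
        filter_upwards [hW.mem_nhds (hKW hzK)] with y hy using indicator_of_mem hy _
      have e2 : (W.indicator fun z ↦ χ z • g z) =ᶠ[𝓝 z] g := by
        filter_upwards [hW.mem_nhds (hKW hzK), hχ1' z hzK] with y hy hy'
        rw [indicator_of_mem hy, hy', one_smul]
      rw [e1.fderiv_eq, e2.fderiv_eq]
    · have e1 : W.indicator f =ᶠ[𝓝 z] fun _ ↦ 0 := by
        filter_upwards [hK.isClosed.isOpen_compl.mem_nhds hzK] with y hy
        by_cases hyW : y ∈ W
        · rw [indicator_of_mem hyW, hfK y hyW hy]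
        · exact indicator_of_notMem hyW _
      rw [e1.fderiv_eq]
      by_cases hzW : z ∈ W
      · rw [indicator_of_mem hzW]
        have e2 : f =ᶠ[𝓝 z] fun _ ↦ 0 := by
          filter_upwards [hK.isClosed.isOpen_compl.mem_nhds hzK, hW.mem_nhds hzW] with y hy hyW
          exact hfK y hyW hy
        rw [e2.fderiv_eq]
        simp
      · rw [indicator_of_notMem hzW]
        simp
  rw [hconv, hconv, hmain]

end Stokes

/-! ### Semicontinuity of the energy and the Courant-Lebesgue lemma. -/

section Energy

/-- Fatou's lemma for almost everywhere convergent sequences with bounded integrals. -/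
theorem lintegral_le_of_tendsto_ae {α : Type*} [MeasurableSpace α] {μ : Measure α}
    {f : ℕ → α → ENNReal} {g : α → ENNReal} {K : ENNReal} (hf : ∀ n, AEMeasurable (f n) μ)
    (hlim : ∀ᵐ a ∂μ, Tendsto (fun n ↦ f n a) atTop (𝓝 (g a)))
    (hK : ∀ᶠ n in atTop, ∫⁻ a, f n a ∂μ ≤ K) : ∫⁻ a, g a ∂μ ≤ K := by
  calc ∫⁻ a, g a ∂μ = ∫⁻ a, liminf (fun n ↦ f n a) atTop ∂μ :=
        lintegral_congr_ae (hlim.mono fun a ha ↦ ha.liminf_eq.symm)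
    _ ≤ liminf (fun n ↦ ∫⁻ a, f n a ∂μ) atTop := lintegral_liminf_le' hf
    _ ≤ K := liminf_le_of_frequently_le' hK.frequently

theorem sq_lintegral_le {α : Type*} [MeasurableSpace α] {μ : Measure α} {f : α → ENNReal}
    (hf : AEMeasurable f μ) : (∫⁻ a, f a ∂μ) ^ 2 ≤ (∫⁻ a, f a ^ 2 ∂μ) * μ univ := by
  have h := ENNReal.lintegral_mul_le_Lp_mul_Lq μ (p := 2) (q := 2)
    Real.HolderConjugate.two_two hf (aemeasurable_const (b := (1 : ENNReal)))
  have h1 : ∫⁻ a, f a ∂μ ≤ (∫⁻ a, f a ^ 2 ∂μ) ^ ((1 : ℝ) / 2) * (μ univ) ^ ((1 : ℝ) / 2) := by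
    simpa using h
  calc (∫⁻ a, f a ∂μ) ^ 2
      ≤ ((∫⁻ a, f a ^ 2 ∂μ) ^ ((1 : ℝ) / 2) * (μ univ) ^ ((1 : ℝ) / 2)) ^ 2 := by gcongr
    _ = _ := by
        rw [mul_pow, ← ENNReal.rpow_natCast, ← ENNReal.rpow_natCast, ← ENNReal.rpow_mul,
          ← ENNReal.rpow_mul]
        norm_num

variable {E : Type*} [NormedAddCommGroup E] [NormedSpace ℝ E]

/-- The increment of a `C¹` map along a curve, through the energy of the derivative. -/
theorem enorm_sub_sq_le {γ : ℝ → E} {a b : ℝ} (hab : a ≤ b) (hγ : ContDiffOn ℝ 1 γ (Icc a b))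
    {κ : ℝ → ENNReal} (hκm : Measurable κ) (hκ : ∀ t ∈ Ioo a b, ‖deriv γ t‖ₑ ≤ κ t) :
    ‖γ b - γ a‖ₑ ^ 2 ≤ (∫⁻ t in Icc a b, κ t ^ 2) * ENNReal.ofReal (b - a) := by
  have h1 := enorm_sub_le_lintegral_deriv_of_contDiffOn_Icc hγ hab
  have h2 : ∫⁻ t in Icc a b, ‖deriv γ t‖ₑ ≤ ∫⁻ t in Icc a b, κ t := by
    rw [← restrict_Ioo_eq_restrict_Icc]
    exact setLIntegral_mono hκm hκ
  calc ‖γ b - γ a‖ₑ ^ 2 ≤ (∫⁻ t in Icc a b, κ t) ^ 2 := by gcongr; exact h1.trans h2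
    _ ≤ (∫⁻ t in Icc a b, κ t ^ 2) * volume.restrict (Icc a b) univ :=
        sq_lintegral_le hκm.aemeasurable
    _ = _ := by simp

theorem hasDerivAt_comp_of_mem {g : ℂ → E} {γ : ℝ → ℂ} {γ' : ℂ} {W : Set ℂ} (hW : IsOpen W)
    (hg : ContDiffOn ℝ 1 g W) {t : ℝ} (ht : γ t ∈ W) (hγ : HasDerivAt γ γ' t) :
    HasDerivAt (fun t ↦ g (γ t)) (fderiv ℝ g (γ t) γ') t := by
  have h1 : DifferentiableAt ℝ g (γ t) :=
    ((hg _ ht).contDiffAt (hW.mem_nhds ht)).differentiableAt one_ne_zero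
  exact h1.hasFDerivAt.comp_hasDerivAt t hγ

/-- The squared difference quotient is at most the average of the squared derivative along the
segment. Exchanging integrals, every translate of the smaller disc along the segment stays in the
unit disc. -/
theorem lintegral_slope_le [CompleteSpace E] [MeasurableSpace E] [BorelSpace E] {g : ℂ → E}
    (hg : ContDiffOn ℝ 1 g (Metric.ball 0 1)) {ρ h : ℝ} (hh : 0 < h) (hρ : ρ + h ≤ 1) :
    ∫⁻ z in Metric.ball (0 : ℂ) ρ, ‖h⁻¹ • (g (z + h) - g z)‖ₑ ^ 2 ≤
      ∫⁻ z in Metric.ball (0 : ℂ) 1, ‖fderiv ℝ g z 1‖ₑ ^ 2 := by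
  set κ : ℂ → ENNReal := fun z ↦ ‖fderiv ℝ g z 1‖ₑ with hκ
  have hκm : Measurable κ := (measurable_fderiv_apply_const ℝ g 1).enorm
  have hmem : ∀ z ∈ Metric.ball (0 : ℂ) ρ, ∀ t ∈ Icc (0 : ℝ) 1,
      z + ((t * h : ℝ) : ℂ) ∈ Metric.ball (0 : ℂ) 1 := by
    intro z hz t ht
    rw [mem_ball_zero_iff] at hz ⊢
    calc ‖z + ((t * h : ℝ) : ℂ)‖ ≤ ‖z‖ + ‖((t * h : ℝ) : ℂ)‖ := norm_add_le _ _
      _ = ‖z‖ + t * h := by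
          rw [Complex.norm_real, Real.norm_of_nonneg (mul_nonneg ht.1 hh.le)]
      _ < ρ + h := by nlinarith [ht.2]
      _ ≤ 1 := by linarith
  have hpt : ∀ z ∈ Metric.ball (0 : ℂ) ρ, ‖h⁻¹ • (g (z + h) - g z)‖ₑ ^ 2 ≤
      ∫⁻ t in Icc (0 : ℝ) 1, κ (z + ((t * h : ℝ) : ℂ)) ^ 2 := by
    intro z hz
    have hγd : ∀ t : ℝ, HasDerivAt (fun t : ℝ ↦ z + ((t * h : ℝ) : ℂ)) (h : ℂ) t := by
      intro t
      have : HasDerivAt (fun t : ℝ ↦ ((t * h : ℝ) : ℂ)) ((1 * h : ℝ) : ℂ) t :=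
        ((hasDerivAt_id t).mul_const h).ofReal_comp
      simpa using this.const_add z
    have hγc : ContDiff ℝ 1 (fun t : ℝ ↦ z + ((t * h : ℝ) : ℂ)) := by
      have : ContDiff ℝ 1 (fun t : ℝ ↦ ((t * h : ℝ) : ℂ)) :=
        Complex.ofRealCLM.contDiff.comp (contDiff_id.mul contDiff_const)
      exact contDiff_const.add this
    have h1 := enorm_sub_sq_le (γ := fun t ↦ h⁻¹ • g (z + ((t * h : ℝ) : ℂ))) zero_le_one
      ((hg.comp hγc.contDiffOn (hmem z hz)).const_smul h⁻¹)
      (κ := fun t ↦ κ (z + ((t * h : ℝ) : ℂ))) (by fun_prop) (by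
        intro t ht
        have hd := (hasDerivAt_comp_of_mem (γ := fun t : ℝ ↦ z + ((t * h : ℝ) : ℂ))
          Metric.isOpen_ball hg (hmem z hz t (Ioo_subset_Icc_self ht)) (hγd t)).const_smul h⁻¹
        rw [show deriv (fun t : ℝ ↦ h⁻¹ • g (z + ((t * h : ℝ) : ℂ))) t = _ from hd.deriv]
        have : (h : ℂ) = h • (1 : ℂ) := by simp
        rw [this, map_smul, smul_smul, inv_mul_cancel₀ hh.ne', one_smul])
    rw [← smul_sub] at h1
    simpa using h1
  calc ∫⁻ z in Metric.ball (0 : ℂ) ρ, ‖h⁻¹ • (g (z + h) - g z)‖ₑ ^ 2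
      ≤ ∫⁻ z in Metric.ball (0 : ℂ) ρ, ∫⁻ t in Icc (0 : ℝ) 1, κ (z + ((t * h : ℝ) : ℂ)) ^ 2 :=
        setLIntegral_mono' Metric.isOpen_ball.measurableSet hpt
    _ = ∫⁻ t in Icc (0 : ℝ) 1, ∫⁻ z in Metric.ball (0 : ℂ) ρ, κ (z + ((t * h : ℝ) : ℂ)) ^ 2 := by
        refine lintegral_lintegral_swap (Measurable.aemeasurable ?_)
        have : Measurable fun p : ℂ × ℝ ↦ p.1 + ((p.2 * h : ℝ) : ℂ) := by fun_prop
        exact (hκm.comp this).pow_const 2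
    _ ≤ ∫⁻ t in Icc (0 : ℝ) 1, ∫⁻ z in Metric.ball (0 : ℂ) 1, κ z ^ 2 := by
        refine setLIntegral_mono' measurableSet_Icc fun t ht ↦ ?_
        rw [← lintegral_indicator Metric.isOpen_ball.measurableSet,
          ← lintegral_indicator Metric.isOpen_ball.measurableSet,
          ← lintegral_add_right_eq_self ((Metric.ball (0 : ℂ) 1).indicator fun z ↦ κ z ^ 2)
            ((t * h : ℝ) : ℂ)]
        refine lintegral_mono fun z ↦ ?_
        by_cases hz : z ∈ Metric.ball (0 : ℂ) ρ
        · rw [indicator_of_mem hz, indicator_of_mem (hmem z hz t ht)]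
        · rw [indicator_of_notMem hz]; exact zero_le
    _ = _ := by simp [hκ]

/-- The energy of maps of the disc is lower semicontinuous under pointwise convergence. -/
theorem lintegral_fderiv_le_of_tendsto [CompleteSpace E] [MeasurableSpace E] [BorelSpace E]
    {g : ℕ → ℂ → E} {w : ℂ → E} {B : Set ℂ} (hB : B.Finite) {K : ENNReal}
    (hg : ∀ k, ContDiffOn ℝ 1 (g k) (Metric.ball 0 1)) (hw : ContDiffOn ℝ 1 w (Metric.ball 0 1))
    (hlim : ∀ z ∈ Metric.ball (0 : ℂ) 1 \ B, Tendsto (fun k ↦ g k z) atTop (𝓝 (w z)))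
    (hK : ∀ k, ∫⁻ z in Metric.ball (0 : ℂ) 1, ‖fderiv ℝ (g k) z 1‖ₑ ^ 2 ≤ K) :
    ∫⁻ z in Metric.ball (0 : ℂ) 1, ‖fderiv ℝ w z 1‖ₑ ^ 2 ≤ K := by
  have hmeas : ∀ (q : ℂ → E), ContDiffOn ℝ 1 q (Metric.ball 0 1) → ∀ ρ h : ℝ, 0 < h →
      ρ + h ≤ 1 → AEMeasurable (fun z : ℂ ↦ ‖h⁻¹ • (q (z + h) - q z)‖ₑ ^ 2)
        (volume.restrict (Metric.ball 0 ρ)) := by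
    intro q hq ρ h hh hρ
    have hc : ContinuousOn (fun z : ℂ ↦ h⁻¹ • (q (z + h) - q z)) (Metric.ball 0 ρ) := by
      refine ContinuousOn.const_smul (ContinuousOn.sub ?_ ?_) _
      · refine hq.continuousOn.comp (by fun_prop) fun z hz ↦ ?_
        rw [mem_ball_zero_iff] at hz ⊢
        calc ‖z + (h : ℂ)‖ ≤ ‖z‖ + ‖(h : ℂ)‖ := norm_add_le _ _
          _ = ‖z‖ + h := by rw [Complex.norm_real, Real.norm_of_nonneg hh.le]
          _ < 1 := by linarith
      · exact hq.continuousOn.mono (Metric.ball_subset_ball (by linarith))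
    exact (hc.aemeasurable Metric.isOpen_ball.measurableSet).enorm.pow_const 2
  -- For a fixed step, difference quotients converge as soon as the maps converge pointwise, off B
  -- and a translate of it, so Fatou's lemma applies without any convergence of derivatives. A
  -- second use of Fatou, with the step tending to zero, recovers the derivative of w.
  have hslope : ∀ ρ h : ℝ, 0 < h → ρ + h ≤ 1 →
      ∫⁻ z in Metric.ball (0 : ℂ) ρ, ‖h⁻¹ • (w (z + h) - w z)‖ₑ ^ 2 ≤ K := by
    intro ρ h hh hρ
    refine lintegral_le_of_tendsto_ae (f := fun k z ↦ ‖h⁻¹ • (g k (z + h) - g k z)‖ₑ ^ 2)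
      (fun k ↦ hmeas (g k) (hg k) ρ h hh hρ) ?_
      (Eventually.of_forall fun k ↦ (lintegral_slope_le (hg k) hh hρ).trans (hK k))
    have hB0 : ∀ᵐ z : ℂ ∂volume.restrict (Metric.ball 0 ρ), z ∉ B :=
      ae_restrict_of_ae (measure_eq_zero_iff_ae_notMem.1 (hB.measure_zero _))
    have hB1 : ∀ᵐ z : ℂ ∂volume.restrict (Metric.ball 0 ρ), z + h ∉ B := by
      have hf : ((fun z : ℂ ↦ z + h) ⁻¹' B).Finite := hB.preimage (add_left_injective _).injOn
      exact ae_restrict_of_ae (measure_eq_zero_iff_ae_notMem.1 (hf.measure_zero _))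
    filter_upwards [hB0, hB1, ae_restrict_mem Metric.isOpen_ball.measurableSet] with z h0 h1 hz
    rw [mem_ball_zero_iff] at hz
    have hz1 : z ∈ Metric.ball (0 : ℂ) 1 := by rw [mem_ball_zero_iff]; linarith
    have hz2 : z + (h : ℂ) ∈ Metric.ball (0 : ℂ) 1 := by
      rw [mem_ball_zero_iff]
      calc ‖z + (h : ℂ)‖ ≤ ‖z‖ + ‖(h : ℂ)‖ := norm_add_le _ _
        _ = ‖z‖ + h := by rw [Complex.norm_real, Real.norm_of_nonneg hh.le]
        _ < 1 := by linarith
    have ht := ((hlim _ ⟨hz2, h1⟩).sub (hlim _ ⟨hz1, h0⟩)).const_smul h⁻¹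
    exact ENNReal.Tendsto.pow ht.enorm
  have hball : ∀ ρ : ℝ, ρ < 1 → ∫⁻ z in Metric.ball (0 : ℂ) ρ, ‖fderiv ℝ w z 1‖ₑ ^ 2 ≤ K := by
    intro ρ hρ
    set s : ℕ → ℝ := fun n ↦ (1 - ρ) / (n + 1) with hs
    have hs0 : ∀ n, 0 < s n := fun n ↦ div_pos (by linarith) (by positivity)
    have hs1 : ∀ n, ρ + s n ≤ 1 := by
      intro n
      have : s n ≤ 1 - ρ := div_le_self (by linarith) (by simp)
      linarith
    have hslim : Tendsto s atTop (𝓝[≠] 0) := by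
      refine tendsto_nhdsWithin_of_tendsto_nhds_of_eventually_within _ ?_
        (Eventually.of_forall fun n ↦ (hs0 n).ne')
      have h1 := (tendsto_one_div_add_atTop_nhds_zero_nat (𝕜 := ℝ)).const_mul (1 - ρ)
      simpa [hs, div_eq_mul_inv] using h1
    refine lintegral_le_of_tendsto_ae
      (f := fun n z ↦ ‖(s n)⁻¹ • (w (z + (s n : ℂ)) - w z)‖ₑ ^ 2)
      (fun n ↦ hmeas w hw ρ (s n) (hs0 n) (hs1 n)) ?_
      (Eventually.of_forall fun n ↦ hslope ρ (s n) (hs0 n) (hs1 n))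
    filter_upwards [ae_restrict_mem Metric.isOpen_ball.measurableSet] with z hz
    have hz1 : z ∈ Metric.ball (0 : ℂ) 1 := Metric.ball_subset_ball hρ.le hz
    have hd : DifferentiableAt ℝ w z :=
      ((hw z hz1).contDiffAt (Metric.isOpen_ball.mem_nhds hz1)).differentiableAt one_ne_zero
    have h1 := (hd.hasFDerivAt.hasLineDerivAt 1).tendsto_slope_zero.comp hslim
    have h2 := ENNReal.Tendsto.pow (n := 2) h1.enorm
    simpa [Function.comp_def] using h2
  have hmono : Monotone fun n : ℕ ↦ Metric.ball (0 : ℂ) (1 - 1 / (n + 1)) := by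
    intro m n hmn
    refine Metric.ball_subset_ball ?_
    have : (1 : ℝ) / (n + 1) ≤ 1 / (m + 1) := by gcongr
    linarith
  have hU : Metric.ball (0 : ℂ) 1 = ⋃ n : ℕ, Metric.ball (0 : ℂ) (1 - 1 / ((n : ℝ) + 1)) := by
    ext z
    simp only [mem_ball_zero_iff, mem_iUnion]
    constructor
    · intro hz
      obtain ⟨n, hn⟩ := exists_nat_one_div_lt (show 0 < 1 - ‖z‖ by linarith)
      exact ⟨n, by linarith⟩
    · rintro ⟨n, hn⟩
      have : (0 : ℝ) < 1 / ((n : ℝ) + 1) := by positivity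
      linarith
  rw [hU, setLIntegral_iUnion_of_directed _ hmono.directed_le]
  refine iSup_le fun n ↦ hball _ ?_
  have : (0 : ℝ) < 1 / ((n : ℝ) + 1) := by positivity
  linarith

/-- The arcs of circles around a boundary point `ξ` that lie in the disc, in polar coordinates. -/
theorem norm_one_sub_polar_lt {s τ : ℝ} (hs : 0 < s) (h : s / 2 < Real.cos τ) :
    ‖1 - s * Complex.exp (τ * Complex.I)‖ < 1 := by
  have h1 : ‖1 - s * Complex.exp (τ * Complex.I)‖ ^ 2 = 1 - 2 * s * Real.cos τ + s ^ 2 := by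
    rw [Complex.sq_norm, Complex.normSq_apply]
    simp only [Complex.sub_re, Complex.one_re, Complex.re_ofReal_mul, Complex.sub_im,
      Complex.one_im, Complex.im_ofReal_mul, Complex.exp_ofReal_mul_I_re,
      Complex.exp_ofReal_mul_I_im]
    nlinarith [Real.sin_sq_add_cos_sq τ]
  have h2 : ‖1 - s * Complex.exp (τ * Complex.I)‖ ^ 2 < 1 ^ 2 := by rw [h1]; nlinarith
  exact lt_of_pow_lt_pow_left₀ 2 zero_le_one h2

/-- For ζ = 1 - z/ξ the condition that z lies in the disc becomes s/2 < cos(arg ζ), so the arc is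
parametrized by a set of angles on which the real part of ζ is positive. -/
theorem exists_polar_of_mem {ξ : ℂ} (hξ : ‖ξ‖ = 1) {s : ℝ} (hs : 0 < s) {z : ℂ}
    (hz : z ∈ Metric.ball (0 : ℂ) 1) (hzs : z ∈ Metric.sphere ξ s) :
    ∃ τ ∈ Ioo (-(Real.pi / 2)) (Real.pi / 2), s / 2 < Real.cos τ ∧
      z = ξ * (1 - s * Complex.exp (τ * Complex.I)) := by
  have hξ0 : ξ ≠ 0 := by rintro rfl; simp at hξ
  set ζ := 1 - z / ξ with hζ
  have hzζ : z = ξ * (1 - ζ) := by rw [hζ]; field_simp; ring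
  have hnζ : ‖ζ‖ = s := by
    have h1 : z - ξ = -(ξ * ζ) := by rw [hzζ]; ring
    rw [mem_sphere_iff_norm, h1, norm_neg, norm_mul, hξ, one_mul] at hzs
    exact hzs
  have hpol : ζ = s * Complex.exp (ζ.arg * Complex.I) := by
    rw [← hnζ]; exact (Complex.norm_mul_exp_arg_mul_I ζ).symm
  have hre : ζ.re = s * Real.cos ζ.arg := by
    conv_lhs => rw [hpol]
    rw [Complex.re_ofReal_mul, Complex.exp_ofReal_mul_I_re]
  have hcos : s / 2 < Real.cos ζ.arg := by
    have h1 : ‖1 - ζ‖ < 1 := by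
      rw [mem_ball_zero_iff, hzζ, norm_mul, hξ, one_mul] at hz
      exact hz
    have h2 : ‖1 - ζ‖ ^ 2 < 1 := by nlinarith [norm_nonneg (1 - ζ)]
    have h3 : ‖1 - ζ‖ ^ 2 = 1 - 2 * ζ.re + ‖ζ‖ ^ 2 := by
      rw [Complex.sq_norm, Complex.sq_norm, Complex.normSq_apply, Complex.normSq_apply]
      simp only [Complex.sub_re, Complex.one_re, Complex.sub_im, Complex.one_im]
      ring
    rw [h3, hnζ, hre] at h2
    nlinarith
  refine ⟨ζ.arg, ?_, hcos, by rw [← hpol]; exact hzζ⟩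
  have hre0 : 0 < ζ.re := by rw [hre]; exact mul_pos hs (by linarith)
  exact abs_lt.1 (Complex.abs_arg_lt_pi_div_two_iff.2 (Or.inl hre0))

/-- **Courant–Lebesgue lemma**: some arc around a boundary point of the disc has a short image. -/
theorem exists_short_arc [CompleteSpace E] {w : ℂ → E}
    (hw : ContDiffOn ℝ 1 w (Metric.ball 0 1)) {ξ : ℂ} (hξ : ‖ξ‖ = 1) {ρ : ℝ} (hρ : 0 < ρ) :
    ∃ s ∈ Ioo (ρ / 2) ρ, ∀ z ∈ Metric.ball (0 : ℂ) 1 ∩ Metric.sphere ξ s,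
      ∀ z' ∈ Metric.ball (0 : ℂ) 1 ∩ Metric.sphere ξ s, ‖w z - w z'‖ₑ ^ 2 ≤
        16 * ∫⁻ z in Metric.ball (0 : ℂ) 1 ∩ Metric.ball ξ ρ, ‖fderiv ℝ w z‖ₑ ^ 2 := by
  set U := Metric.ball (0 : ℂ) 1 ∩ Metric.ball ξ ρ with hU
  have hUm : MeasurableSet U := (Metric.isOpen_ball.inter Metric.isOpen_ball).measurableSet
  set e := ∫⁻ z in U, ‖fderiv ℝ w z‖ₑ ^ 2 with he
  set κ : ℂ → ENNReal := U.indicator fun z ↦ ‖fderiv ℝ w z‖ₑ ^ 2 with hκ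
  have hκm : Measurable κ := ((measurable_fderiv ℝ w).enorm.pow_const 2).indicator hUm
  set G : ℂ → ENNReal := fun ζ ↦ κ (ξ * (1 - ζ)) with hG
  have hGm : Measurable G := hκm.comp (by fun_prop)
  have hGe : ∫⁻ ζ, G ζ = e := by
    have h1 : ∫⁻ ζ, κ (ξ - ζ) = e := by
      rw [lintegral_sub_left_eq_self κ ξ, hκ, lintegral_indicator hUm]
    have hc : ‖ξ‖ = 1 := hξ
    let c : Circle := ⟨ξ, mem_sphere_zero_iff_norm.2 hξ⟩
    have h2 := (rotation c).measurePreserving.lintegral_comp_emb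
      (rotation c).toHomeomorph.measurableEmbedding (fun ζ ↦ κ (ξ - ζ))
    rw [h1] at h2
    rw [← h2]
    refine lintegral_congr fun ζ ↦ ?_
    have h3 : rotation c ζ = ξ * ζ := rotation_apply c ζ
    simp only [hG, h3]
    congr 1
    ring
  set H : ℝ → ENNReal := fun s ↦
    ∫⁻ θ in Ioo (-Real.pi) Real.pi, G (s * Complex.exp (θ * Complex.I)) with hH
  have hGpm : Measurable fun q : ℝ × ℝ ↦ G (q.1 * Complex.exp (q.2 * Complex.I)) :=
    hGm.comp (by fun_prop)
  have hHm : Measurable H := hGpm.lintegral_prod_right'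
  have hpolar : ∫⁻ s in Ioi (0 : ℝ), ENNReal.ofReal s * H s = e := by
    have h1 := Complex.lintegral_comp_polarCoord_symm G
    rw [hGe, polarCoord_target, Measure.volume_eq_prod, setLIntegral_prod] at h1
    · rw [← h1]
      refine lintegral_congr fun s ↦ ?_
      rw [hH, ← lintegral_const_mul' _ _ ENNReal.ofReal_ne_top]
      refine lintegral_congr fun θ ↦ ?_
      rw [Complex.polarCoord_symm_apply, smul_eq_mul, Complex.exp_mul_I]
      simp
    · refine Measurable.aemeasurable ?_
      have h2 : (fun q : ℝ × ℝ ↦ ENNReal.ofReal q.1 • G (Complex.polarCoord.symm q)) =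
          fun q : ℝ × ℝ ↦ ENNReal.ofReal q.1 * G (q.1 * Complex.exp (q.2 * Complex.I)) := by
        ext1 q
        rw [Complex.polarCoord_symm_apply, smul_eq_mul, Complex.exp_mul_I]
        simp
      rw [h2]
      exact (ENNReal.measurable_ofReal.comp measurable_fst).mul hGpm
  have hvol : volume (Ioo (ρ / 2) ρ) = ENNReal.ofReal (ρ / 2) := by
    rw [Real.volume_Ioo]; congr 1; ring
  -- A radius at which s H(s) does not exceed its average over the interval.
  obtain ⟨s, hs, hsle⟩ := exists_le_setLAverage (μ := volume) (s := Ioo (ρ / 2) ρ)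
    (f := fun s ↦ ENNReal.ofReal s * H s) (by rw [hvol]; simpa using by linarith)
    (by rw [hvol]; exact ENNReal.ofReal_ne_top)
    (ENNReal.measurable_ofReal.mul hHm).aemeasurable
  have hs0 : 0 < s := by linarith [hs.1]
  -- Here s² H(s) is the integral over the angle of the squared speed along the circle. By
  -- Cauchy-Schwarz the squared length of the arc is at most 2 e times the range of angles; the
  -- crude bound 8 for the latter gives the factor 16.
  have hsH : ENNReal.ofReal s * (ENNReal.ofReal s * H s) ≤ 2 * e := by
    have h1 : ENNReal.ofReal s * H s ≤ e / ENNReal.ofReal (ρ / 2) := by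
      refine hsle.trans ?_
      rw [setLAverage_eq, hvol]
      gcongr
      rw [← hpolar]
      exact lintegral_mono_set fun x hx ↦ lt_trans (half_pos hρ) hx.1
    calc ENNReal.ofReal s * (ENNReal.ofReal s * H s)
        ≤ ENNReal.ofReal ρ * (e / ENNReal.ofReal (ρ / 2)) := by
          gcongr
          exact hs.2.le
      _ = (ENNReal.ofReal ρ / ENNReal.ofReal (ρ / 2)) * e := by
          rw [ENNReal.div_eq_inv_mul, ENNReal.div_eq_inv_mul]; ring
      _ = 2 * e := by
          rw [← ENNReal.ofReal_div_of_pos (half_pos hρ)]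
          have : ρ / (ρ / 2) = 2 := by field_simp
          rw [this]; simp
  refine ⟨s, hs, ?_⟩
  have hmemU : ∀ τ : ℝ, s / 2 < Real.cos τ →
      ξ * (1 - s * Complex.exp (τ * Complex.I)) ∈ U := by
    intro τ hτ
    refine ⟨?_, ?_⟩
    · rw [mem_ball_zero_iff, norm_mul, hξ, one_mul]
      exact norm_one_sub_polar_lt hs0 hτ
    · rw [mem_ball_iff_norm, show ξ * (1 - s * Complex.exp (τ * Complex.I)) - ξ =
        -(ξ * (s * Complex.exp (τ * Complex.I))) by ring, norm_neg, norm_mul, hξ, one_mul,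
        norm_mul, Complex.norm_exp_ofReal_mul_I, mul_one, Complex.norm_real,
        Real.norm_of_nonneg hs0.le]
      exact hs.2
  have key : ∀ τ₁ τ₂ : ℝ, τ₁ ∈ Ioo (-(Real.pi / 2)) (Real.pi / 2) →
      τ₂ ∈ Ioo (-(Real.pi / 2)) (Real.pi / 2) → s / 2 < Real.cos τ₁ → s / 2 < Real.cos τ₂ →
      τ₁ ≤ τ₂ → ‖w (ξ * (1 - s * Complex.exp (τ₂ * Complex.I))) -
        w (ξ * (1 - s * Complex.exp (τ₁ * Complex.I)))‖ₑ ^ 2 ≤ 16 * e := by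
    intro τ₁ τ₂ h₁ h₂ hc₁ hc₂ hle
    -- The admissible angles form an interval, because the cosine is even and decreases on [0, π].
    have hcos : ∀ τ ∈ Icc τ₁ τ₂, s / 2 < Real.cos τ := by
      intro τ hτ
      have hab : |τ| ≤ max |τ₁| |τ₂| := abs_le_max_abs_abs hτ.1 hτ.2
      have hm : s / 2 < Real.cos (max |τ₁| |τ₂|) := by
        rcases max_choice |τ₁| |τ₂| with h | h <;> rw [h, Real.cos_abs] <;> assumption
      have hpi : max |τ₁| |τ₂| ≤ Real.pi := by
        have a1 := abs_lt.2 h₁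
        have a2 := abs_lt.2 h₂
        have := Real.pi_pos
        exact max_le (by linarith) (by linarith)
      calc s / 2 < Real.cos (max |τ₁| |τ₂|) := hm
        _ ≤ Real.cos |τ| := Real.cos_le_cos_of_nonneg_of_le_pi (abs_nonneg _) hpi hab
        _ = Real.cos τ := Real.cos_abs τ
    have hγd : ∀ τ : ℝ, HasDerivAt (fun τ : ℝ ↦ ξ * (1 - s * Complex.exp (τ * Complex.I)))
        (ξ * -(s * (Complex.exp (τ * Complex.I) * Complex.I))) τ := by
      intro τ
      have e1 : HasDerivAt (fun τ : ℝ ↦ (τ : ℂ) * Complex.I) Complex.I τ := by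
        simpa using (Complex.ofRealCLM.hasDerivAt (x := τ)).mul_const Complex.I
      exact ((e1.cexp.const_mul (s : ℂ)).const_sub 1).const_mul ξ
    have hγc : ContDiff ℝ 1 (fun τ : ℝ ↦ ξ * (1 - s * Complex.exp (τ * Complex.I))) := by
      have e1 : ContDiff ℝ 1 (fun τ : ℝ ↦ (τ : ℂ) * Complex.I) :=
        Complex.ofRealCLM.contDiff.mul contDiff_const
      exact contDiff_const.mul (contDiff_const.sub (contDiff_const.mul e1.cexp))
    have hwm : Measurable fun τ : ℝ ↦
        ‖fderiv ℝ w (ξ * (1 - s * Complex.exp (τ * Complex.I)))‖ₑ :=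
      (measurable_fderiv ℝ w).enorm.comp (by fun_prop)
    have h3 := enorm_sub_sq_le (γ := fun τ ↦ w (ξ * (1 - s * Complex.exp (τ * Complex.I)))) hle
      (hw.comp hγc.contDiffOn fun τ hτ ↦ (hmemU τ (hcos τ hτ)).1)
      (κ := fun τ ↦ ENNReal.ofReal s *
        ‖fderiv ℝ w (ξ * (1 - s * Complex.exp (τ * Complex.I)))‖ₑ) (hwm.const_mul _) (by
        intro τ hτ
        have hd := hasDerivAt_comp_of_mem
          (γ := fun τ : ℝ ↦ ξ * (1 - s * Complex.exp (τ * Complex.I))) Metric.isOpen_ball hw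
          (hmemU τ (hcos τ (Ioo_subset_Icc_self hτ))).1 (hγd τ)
        rw [hd.deriv]
        refine (ContinuousLinearMap.le_opENorm _ _).trans_eq ?_
        rw [mul_comm]
        congr 1
        rw [← ofReal_norm, norm_mul, hξ, one_mul, norm_neg, norm_mul, norm_mul,
          Complex.norm_exp_ofReal_mul_I, Complex.norm_I, mul_one, mul_one, Complex.norm_real,
          Real.norm_of_nonneg hs0.le])
    refine h3.trans ?_
    have h4 : ∫⁻ τ in Icc τ₁ τ₂, (ENNReal.ofReal s *
        ‖fderiv ℝ w (ξ * (1 - s * Complex.exp (τ * Complex.I)))‖ₑ) ^ 2 ≤ 2 * e := by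
      refine le_trans ?_ hsH
      have hpi := Real.pi_pos
      rw [hH, ← lintegral_const_mul' _ _ ENNReal.ofReal_ne_top,
        ← lintegral_const_mul' _ _ ENNReal.ofReal_ne_top]
      refine (setLIntegral_mono' measurableSet_Icc fun τ hτ ↦ ?_).trans
        (lintegral_mono_set (show Icc τ₁ τ₂ ⊆ Ioo (-Real.pi) Real.pi from fun x hx ↦
          ⟨by linarith [hx.1, h₁.1], by linarith [hx.2, h₂.2]⟩))
      rw [hG, hκ]
      simp only
      rw [indicator_of_mem (hmemU τ (hcos τ hτ)), mul_pow, sq (ENNReal.ofReal s), mul_assoc]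
    calc _ ≤ 2 * e * ENNReal.ofReal (τ₂ - τ₁) := by gcongr
      _ ≤ 2 * e * 8 := by
          gcongr
          rw [show (8 : ENNReal) = ENNReal.ofReal 8 by simp]
          exact ENNReal.ofReal_le_ofReal (by
            linarith [h₁.1, h₂.2, Real.pi_le_four])
      _ = 16 * e := by rw [mul_right_comm]; norm_num
  rintro z ⟨hz, hzs⟩ z' ⟨hz', hzs'⟩
  obtain ⟨τ, hτ, hc, rfl⟩ := exists_polar_of_mem hξ hs0 hz hzs
  obtain ⟨τ', hτ', hc', rfl⟩ := exists_polar_of_mem hξ hs0 hz' hzs'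
  rcases le_total τ τ' with h | h
  · rw [enorm_sub_rev]
    exact key τ τ' hτ hτ' hc hc' h
  · exact key τ' τ hτ' hτ hc' hc h

end Energy

/-! ### Monotonicity, I: linear algebra of a complex structure and the radial weight. -/

section Monotonicity

open scoped RealInnerProductSpace

variable {E : Type*} [NormedAddCommGroup E] [InnerProductSpace ℝ E]

/-- The symmetrization of the inner product by a complex structure `J`. -/
def gForm (J : E →L[ℝ] E) (v w : E) : ℝ := ⟪v, w⟫ + ⟪J v, J w⟫

/-- The two-form `gForm J (J ·) ·`. -/
def wForm (J : E →L[ℝ] E) (v w : E) : ℝ := ⟪J v, w⟫ - ⟪v, J w⟫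

theorem gForm_self (J : E →L[ℝ] E) (v : E) : gForm J v v = ‖v‖ ^ 2 + ‖J v‖ ^ 2 := by
  rw [gForm, real_inner_self_eq_norm_sq, real_inner_self_eq_norm_sq]

theorem gForm_self_nonneg (J : E →L[ℝ] E) (v : E) : 0 ≤ gForm J v v := by
  rw [gForm_self]; positivity

theorem norm_sq_le_gForm (J : E →L[ℝ] E) (v : E) : ‖v‖ ^ 2 ≤ gForm J v v := by
  rw [gForm_self]; nlinarith [sq_nonneg ‖J v‖]

theorem gForm_self_le {J : E →L[ℝ] E} {Λ : ℝ} (hΛ : ‖J‖ ≤ Λ) (v : E) :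
    gForm J v v ≤ (1 + Λ ^ 2) * ‖v‖ ^ 2 := by
  rw [gForm_self]
  have h : ‖J v‖ ≤ Λ * ‖v‖ := J.le_of_opNorm_le hΛ v
  nlinarith [norm_nonneg (J v), mul_self_le_mul_self (norm_nonneg (J v)) h]

theorem abs_gForm_le {J : E →L[ℝ] E} {Λ : ℝ} (hΛ : ‖J‖ ≤ Λ) (v w : E) :
    |gForm J v w| ≤ (1 + Λ ^ 2) * (‖v‖ * ‖w‖) := by
  have hΛ0 : 0 ≤ Λ := (norm_nonneg _).trans hΛ
  have h1 : ‖J v‖ ≤ Λ * ‖v‖ := J.le_of_opNorm_le hΛ v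
  have h2 : ‖J w‖ ≤ Λ * ‖w‖ := J.le_of_opNorm_le hΛ w
  calc |gForm J v w| ≤ |⟪v, w⟫| + |⟪J v, J w⟫| := abs_add_le _ _
    _ ≤ ‖v‖ * ‖w‖ + ‖J v‖ * ‖J w‖ :=
        add_le_add (abs_real_inner_le_norm _ _) (abs_real_inner_le_norm _ _)
    _ ≤ ‖v‖ * ‖w‖ + (Λ * ‖v‖) * (Λ * ‖w‖) := by gcongr
    _ = _ := by ring

theorem abs_wForm_le {J : E →L[ℝ] E} {Λ : ℝ} (hΛ : ‖J‖ ≤ Λ) (v w : E) :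
    |wForm J v w| ≤ 2 * Λ * (‖v‖ * ‖w‖) := by
  have h1 : ‖J v‖ ≤ Λ * ‖v‖ := J.le_of_opNorm_le hΛ v
  have h2 : ‖J w‖ ≤ Λ * ‖w‖ := J.le_of_opNorm_le hΛ w
  calc |wForm J v w| ≤ |⟪J v, w⟫| + |⟪v, J w⟫| := abs_sub _ _
    _ ≤ ‖J v‖ * ‖w‖ + ‖v‖ * ‖J w‖ :=
        add_le_add (abs_real_inner_le_norm _ _) (abs_real_inner_le_norm _ _)
    _ ≤ (Λ * ‖v‖) * ‖w‖ + ‖v‖ * (Λ * ‖w‖) := by gcongr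
    _ = _ := by ring

theorem wForm_apply_right {J : E →L[ℝ] E} (hJ : ∀ v, J (J v) = -v) (v w : E) :
    wForm J v (J w) = gForm J v w := by
  rw [wForm, gForm, hJ, inner_neg_right]; ring

theorem gForm_apply_right {J : E →L[ℝ] E} (hJ : ∀ v, J (J v) = -v) (v w : E) :
    gForm J v (J w) = -wForm J v w := by
  rw [wForm, gForm, hJ, inner_neg_right]; ring

/-- This is Bessel's inequality: ξ and Jξ are orthogonal and of equal length for `gForm J`, and
`wForm J ξ v` is the product of Jξ with v. -/
theorem gForm_sq_add_wForm_sq_le {J : E →L[ℝ] E} (hJ : ∀ v, J (J v) = -v) (ξ v : E) :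
    gForm J ξ v ^ 2 + wForm J ξ v ^ 2 ≤ gForm J ξ ξ * gForm J v v := by
  rcases eq_or_ne ξ 0 with rfl | hξ
  · simp [gForm, wForm]
  set p := gForm J ξ v with hp
  set q := wForm J ξ v with hq
  set σ := gForm J ξ ξ with hσ
  have hσ0 : 0 < σ := lt_of_lt_of_le (by positivity) (norm_sq_le_gForm J ξ)
  have key : 0 ≤ gForm J (σ • v - (p • ξ + q • J ξ)) (σ • v - (p • ξ + q • J ξ)) :=
    gForm_self_nonneg _ _
  have hexp : gForm J (σ • v - (p • ξ + q • J ξ)) (σ • v - (p • ξ + q • J ξ)) =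
      σ * (σ * gForm J v v - (p ^ 2 + q ^ 2)) := by
    have e1 : gForm J (σ • v - (p • ξ + q • J ξ)) (σ • v - (p • ξ + q • J ξ)) =
        σ ^ 2 * gForm J v v - 2 * σ * (p * gForm J ξ v + q * wForm J ξ v)
          + (p ^ 2 + q ^ 2) * gForm J ξ ξ := by
      simp only [gForm, wForm, map_sub, map_add, map_smul, hJ, inner_sub_left, inner_sub_right,
        inner_add_left, inner_add_right, real_inner_smul_left, real_inner_smul_right,
        inner_neg_left, inner_neg_right]
      rw [real_inner_comm ξ v, real_inner_comm (J ξ) v, real_inner_comm (J ξ) ξ,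
        real_inner_comm (J ξ) (J v), real_inner_comm ξ (J v)]
      ring
    rw [e1, ← hp, ← hq, ← hσ]
    ring
  rw [hexp] at key
  nlinarith [pos_of_mul_pos_right (a := σ) (b := 1) (by linarith) hσ0.le,
    nonneg_of_mul_nonneg_right key hσ0]

/-- The first of the two estimates behind the monotonicity formula. -/
theorem wForm_ge {J : E →L[ℝ] E} (hJ : ∀ v, J (J v) = -v) {Λ ε : ℝ} (hΛ : ‖J‖ ≤ Λ) {v w : E}
    (hw : ‖w - J v‖ ≤ ε * ‖v‖) (hε : 0 ≤ ε) :
    gForm J v v * (1 - 2 * Λ * ε) ≤ wForm J v w := by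
  have hΛ0 : 0 ≤ Λ := (norm_nonneg _).trans hΛ
  have h1 : wForm J v w = gForm J v v + wForm J v (w - J v) := by
    rw [← wForm_apply_right hJ]
    simp only [wForm, map_sub, inner_sub_right]; ring
  have h2 := abs_wForm_le hΛ v (w - J v)
  have h3 : 2 * Λ * (‖v‖ * ‖w - J v‖) ≤ 2 * Λ * ε * gForm J v v := by
    calc 2 * Λ * (‖v‖ * ‖w - J v‖) ≤ 2 * Λ * (‖v‖ * (ε * ‖v‖)) := by gcongr
      _ = 2 * Λ * ε * ‖v‖ ^ 2 := by ring
      _ ≤ _ := by gcongr; exact norm_sq_le_gForm J v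
  rw [h1]
  nlinarith [(abs_le.1 h2).1]

/-- The second of the two estimates behind the monotonicity formula. -/
theorem gForm_mul_wForm_sub_le {J : E →L[ℝ] E} (hJ : ∀ v, J (J v) = -v) {Λ ε : ℝ} (hΛ : ‖J‖ ≤ Λ)
    {v w : E} (hw : ‖w - J v‖ ≤ ε * ‖v‖) (hε : 0 ≤ ε) (ξ : E) :
    gForm J ξ v * wForm J ξ w - gForm J ξ w * wForm J ξ v ≤
      gForm J ξ ξ * gForm J v v * (1 + 4 * Λ * (1 + Λ ^ 2) * ε) := by
  have hΛ0 : 0 ≤ Λ := (norm_nonneg _).trans hΛ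
  set d := w - J v with hd
  have hwd : w = J v + d := by rw [hd]; abel
  have h1 : wForm J ξ w = gForm J ξ v + wForm J ξ d := by
    rw [hwd, ← wForm_apply_right hJ]
    simp only [wForm, map_add, inner_add_right]; ring
  have h2 : gForm J ξ w = -wForm J ξ v + gForm J ξ d := by
    rw [hwd, ← gForm_apply_right hJ]
    simp only [gForm, map_add, inner_add_right]; ring
  have h3 := gForm_sq_add_wForm_sq_le hJ ξ v
  have h4 : gForm J ξ v * wForm J ξ d ≤ ((1 + Λ ^ 2) * (‖ξ‖ * ‖v‖)) * (2 * Λ * (‖ξ‖ * ‖d‖)) := by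
    refine (le_abs_self _).trans ?_
    rw [abs_mul]
    gcongr
    · exact abs_gForm_le hΛ _ _
    · exact abs_wForm_le hΛ _ _
  have h5 : -(gForm J ξ d * wForm J ξ v) ≤
      ((1 + Λ ^ 2) * (‖ξ‖ * ‖d‖)) * (2 * Λ * (‖ξ‖ * ‖v‖)) := by
    refine (neg_le_abs _).trans ?_
    rw [abs_mul]
    gcongr
    · exact abs_gForm_le hΛ _ _
    · exact abs_wForm_le hΛ _ _
  have h6 : 4 * Λ * (1 + Λ ^ 2) * (‖ξ‖ ^ 2 * (‖v‖ * ‖d‖)) ≤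
      4 * Λ * (1 + Λ ^ 2) * (gForm J ξ ξ * (ε * gForm J v v)) := by
    have a1 := norm_sq_le_gForm J ξ
    have a2 := norm_sq_le_gForm J v
    have a3 := gForm_self_nonneg J ξ
    have a4 : ‖v‖ * ‖d‖ ≤ ε * gForm J v v := by
      calc ‖v‖ * ‖d‖ ≤ ‖v‖ * (ε * ‖v‖) := by gcongr
        _ = ε * ‖v‖ ^ 2 := by ring
        _ ≤ _ := by gcongr
    exact mul_le_mul_of_nonneg_left (mul_le_mul a1 a4 (by positivity) a3) (by positivity)
  rw [h1, h2]
  nlinarith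

/-- The square of the positive part is of class `C¹`. -/
theorem hasDerivAt_max_zero_sq (x : ℝ) : HasDerivAt (fun x : ℝ ↦ max x 0 ^ 2) (2 * max x 0) x := by
  rcases lt_trichotomy x 0 with h | rfl | h
  · have h1 : (fun x : ℝ ↦ max x 0 ^ 2) =ᶠ[𝓝 x] fun _ ↦ 0 := by
      filter_upwards [gt_mem_nhds h] with y hy
      simp [max_eq_right hy.le]
    rw [max_eq_right h.le, mul_zero]
    exact (hasDerivAt_const x (0 : ℝ)).congr_of_eventuallyEq h1
  · rw [hasDerivAt_iff_isLittleO]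
    simp only [max_self, ne_eq, OfNat.ofNat_ne_zero, not_false_eq_true, zero_pow, sub_zero,
      mul_zero, smul_zero]
    have h2 : (fun x : ℝ ↦ x ^ 2) =o[𝓝 0] fun x : ℝ ↦ x := by
      simpa using Asymptotics.isLittleO_pow_id (𝕜 := ℝ) (n := 2) (by norm_num)
    refine Asymptotics.IsBigO.trans_isLittleO (Asymptotics.IsBigO.of_bound 1 ?_) h2
    refine Eventually.of_forall fun y ↦ ?_
    rw [one_mul, norm_pow, norm_pow]
    gcongr
    rw [Real.norm_eq_abs, Real.norm_eq_abs]
    rcases le_total y 0 with hy | hy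
    · simp [max_eq_right hy]
    · simp [max_eq_left hy]
  · have h1 : (fun x : ℝ ↦ max x 0 ^ 2) =ᶠ[𝓝 x] fun x ↦ x ^ 2 := by
      filter_upwards [lt_mem_nhds h] with y hy
      simp [max_eq_left hy.le]
    rw [max_eq_left h.le]
    exact (by simpa using hasDerivAt_pow 2 x : HasDerivAt (fun x : ℝ ↦ x ^ 2) (2 * x) x
      ).congr_of_eventuallyEq h1

/-- The weight `1 / (s + δ) + 8 C / √(s + δ)`, cut off at `s₀`. -/
def weight (C δ s₀ s : ℝ) : ℝ :=
  (1 / (s + δ) + 8 * C / Real.sqrt (s + δ)) * max (1 - s / s₀) 0 ^ 2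

/-- The derivative of `weight`. -/
def weightDeriv (C δ s₀ s : ℝ) : ℝ :=
  -(1 / (s + δ) ^ 2 + 4 * C / ((s + δ) * Real.sqrt (s + δ))) * max (1 - s / s₀) 0 ^ 2 -
    (1 / (s + δ) + 8 * C / Real.sqrt (s + δ)) * (2 / s₀ * max (1 - s / s₀) 0)

theorem hasDerivAt_weight (C s₀ : ℝ) {δ s : ℝ} (h : 0 < s + δ) :
    HasDerivAt (weight C δ s₀) (weightDeriv C δ s₀ s) s := by
  have hq : 0 < Real.sqrt (s + δ) := Real.sqrt_pos.2 h
  have h0 : HasDerivAt (fun s ↦ s + δ) 1 s := (hasDerivAt_id s).add_const δ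
  have h1 : HasDerivAt (fun s ↦ 1 / (s + δ)) (-1 / (s + δ) ^ 2) s := by
    simp only [one_div]
    exact h0.inv h.ne'
  have h2 : HasDerivAt (fun s ↦ 8 * C / Real.sqrt (s + δ))
      (8 * C * (-(1 / (2 * Real.sqrt (s + δ))) / Real.sqrt (s + δ) ^ 2)) s := by
    simpa [div_eq_mul_inv] using ((h0.sqrt h.ne').inv hq.ne').const_mul (8 * C)
  have h3 : HasDerivAt (fun s ↦ 1 - s / s₀) (-(1 / s₀)) s :=
    ((hasDerivAt_id s).div_const s₀).const_sub 1
  have h4 := (hasDerivAt_max_zero_sq (1 - s / s₀)).comp s h3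
  refine ((h1.add h2).mul h4).congr_deriv ?_
  have hsq : Real.sqrt (s + δ) ^ 2 = s + δ := Real.sq_sqrt h.le
  simp only [weightDeriv, Function.comp_apply, Pi.add_apply]
  rw [hsq]
  field_simp
  ring

theorem weight_nonneg {C δ s₀ s : ℝ} (hC : 0 ≤ C) (h : 0 < s + δ) : 0 ≤ weight C δ s₀ s := by
  unfold weight; positivity

theorem weight_eq_zero {C δ s₀ s : ℝ} (hs₀ : 0 < s₀) (h : s₀ ≤ s) : weight C δ s₀ s = 0 := by
  have : 1 - s / s₀ ≤ 0 := by
    rw [sub_nonpos, le_div_iff₀ hs₀]; linarith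
  simp [weight, max_eq_right this]

theorem weightDeriv_eq_zero {C δ s₀ s : ℝ} (hs₀ : 0 < s₀) (h : s₀ ≤ s) :
    weightDeriv C δ s₀ s = 0 := by
  have : 1 - s / s₀ ≤ 0 := by
    rw [sub_nonpos, le_div_iff₀ hs₀]; linarith
  simp [weightDeriv, max_eq_right this]

theorem weightDeriv_nonpos {C δ s₀ s : ℝ} (hC : 0 ≤ C) (hs₀ : 0 < s₀) (h : 0 < s + δ) :
    weightDeriv C δ s₀ s ≤ 0 := by
  unfold weightDeriv
  have h1 : 0 ≤ (1 / (s + δ) ^ 2 + 4 * C / ((s + δ) * Real.sqrt (s + δ))) *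
      max (1 - s / s₀) 0 ^ 2 := by positivity
  have h2 : 0 ≤ (1 / (s + δ) + 8 * C / Real.sqrt (s + δ)) * (2 / s₀ * max (1 - s / s₀) 0) := by
    positivity
  linarith

/-- The differential inequality satisfied by `weight`. -/
theorem weight_ineq {C δ s₀ s r : ℝ} (hC : 0 ≤ C) (hδ : 0 < δ) (hs₀ : 0 < s₀) (hs : 0 ≤ s)
    (hrs : r ^ 2 ≤ s) (hsmall : C * Real.sqrt (s + δ) ≤ 1 / 6) :
    max (1 - s / s₀) 0 ^ 2 * (δ / (s + δ) ^ 2) - 12 / s₀ ≤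
      weight C δ s₀ s * (1 - C * r) + weightDeriv C δ s₀ s * s * (1 + C * r) := by
  set τ := Real.sqrt (s + δ) with hτ
  have hpos : 0 < s + δ := by linarith
  have hτ0 : 0 < τ := Real.sqrt_pos.2 hpos
  have hτ2 : s + δ = τ ^ 2 := (Real.sq_sqrt hpos.le).symm
  have hrτ : r ≤ τ := by
    refine Real.le_sqrt_of_sq_le ?_
    linarith
  have hw0 := weight_nonneg (s₀ := s₀) hC hpos
  have hd0 := weightDeriv_nonpos (s₀ := s₀) hC hs₀ hpos
  have hCr : C * r ≤ C * τ := by gcongr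
  have step1 : weight C δ s₀ s * (1 - C * τ) + weightDeriv C δ s₀ s * s * (1 + C * τ) ≤
      weight C δ s₀ s * (1 - C * r) + weightDeriv C δ s₀ s * s * (1 + C * r) := by
    have a1 : weight C δ s₀ s * (1 - C * τ) ≤ weight C δ s₀ s * (1 - C * r) := by
      gcongr
    have a2 : weightDeriv C δ s₀ s * s * (1 + C * τ) ≤ weightDeriv C δ s₀ s * s * (1 + C * r) := by
      refine mul_le_mul_of_nonpos_left (by linarith) ?_
      exact mul_nonpos_of_nonpos_of_nonneg hd0 hs
    linarith
  refine le_trans ?_ step1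
  set k := max (1 - s / s₀) 0 with hk
  have hk0 : 0 ≤ k := le_max_right _ _
  have hk1 : k ≤ 1 := max_le (by have : 0 ≤ s / s₀ := by positivity
                                 linarith) zero_le_one
  -- For C = 0 this is an equality. The variation of J costs about 2C/τ, and the second summand of
  -- the weight gains about 4C/τ; the remainder 2C/τ - 12C² is nonnegative since C τ ≤ 1/6.
  have hcore : δ / (s + δ) ^ 2 ≤ (1 / (s + δ) + 8 * C / τ) * (1 - C * τ) -
      (1 / (s + δ) ^ 2 + 4 * C / ((s + δ) * τ)) * s * (1 + C * τ) := by
    have hs' : s = τ ^ 2 - δ := by linarith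
    rw [hs', show τ ^ 2 - δ + δ = τ ^ 2 by ring]
    have e : (1 / τ ^ 2 + 8 * C / τ) * (1 - C * τ) -
        (1 / (τ ^ 2) ^ 2 + 4 * C / (τ ^ 2 * τ)) * (τ ^ 2 - δ) * (1 + C * τ) - δ / (τ ^ 2) ^ 2 =
        (2 * C * τ ^ 3 - 12 * C ^ 2 * τ ^ 4 + δ * C * τ + 4 * C * δ * τ * (1 + C * τ)) / τ ^ 4 := by
      field_simp
      ring
    have e2 : 0 ≤ (2 * C * τ ^ 3 - 12 * C ^ 2 * τ ^ 4 + δ * C * τ +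
        4 * C * δ * τ * (1 + C * τ)) / τ ^ 4 := by
      refine div_nonneg ?_ (by positivity)
      have a1 : 12 * C ^ 2 * τ ^ 4 ≤ 2 * C * τ ^ 3 := by
        have : 12 * C ^ 2 * τ ^ 4 = 12 * (C * τ ^ 3) * (C * τ) := by ring
        rw [this]
        have a2 : 0 ≤ C * τ ^ 3 := by positivity
        nlinarith
      have a3 : 0 ≤ δ * C * τ + 4 * C * δ * τ * (1 + C * τ) := by positivity
      linarith
    linarith
  -- The contribution of the derivative of the cut-off, which becomes the energy term on the right
  -- of the monotonicity estimate.
  have htail : (1 / (s + δ) + 8 * C / τ) * (2 / s₀ * k) * s * (1 + C * τ) ≤ 12 / s₀ := by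
    have b1 : (1 / (s + δ) + 8 * C / τ) * s ≤ 3 := by
      have c1 : 1 / (s + δ) * s ≤ 1 := by
        rw [one_div, inv_mul_le_iff₀ hpos]; linarith
      have c2 : 8 * C / τ * s ≤ 8 * (C * τ) := by
        calc 8 * C / τ * s ≤ 8 * C / τ * τ ^ 2 := by gcongr; linarith
          _ = 8 * (C * τ) := by field_simp
      nlinarith
    calc (1 / (s + δ) + 8 * C / τ) * (2 / s₀ * k) * s * (1 + C * τ)
        = ((1 / (s + δ) + 8 * C / τ) * s) * (2 / s₀) * k * (1 + C * τ) := by ring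
      _ ≤ 3 * (2 / s₀) * 1 * 2 := by
          gcongr
          linarith
      _ = 12 / s₀ := by ring
  have hunf : weight C δ s₀ s * (1 - C * τ) + weightDeriv C δ s₀ s * s * (1 + C * τ) =
      k ^ 2 * ((1 / (s + δ) + 8 * C / τ) * (1 - C * τ) -
      (1 / (s + δ) ^ 2 + 4 * C / ((s + δ) * τ)) * s * (1 + C * τ)) -
      (1 / (s + δ) + 8 * C / τ) * (2 / s₀ * k) * s * (1 + C * τ) := by
    simp only [weight, weightDeriv, ← hτ, ← hk]
    ring
  rw [hunf]
  have := mul_le_mul_of_nonneg_left hcore (sq_nonneg k)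
  linarith

end Monotonicity

/-! ### Monotonicity, II: the integrated inequality for holomorphic curves. -/

section Monotonicity

open scoped RealInnerProductSpace

/-- A continuous function on an open set that vanishes off a compact subset is integrable. -/
theorem integrableOn_of_eq_zero_off_compact {F : Type*} [NormedAddCommGroup F] {h : ℂ → F}
    {W K : Set ℂ} (hW : IsOpen W) (hK : IsCompact K) (hKW : K ⊆ W) (hh : ContinuousOn h W)
    (h0 : ∀ z ∈ W, z ∉ K → h z = 0) : IntegrableOn h W :=
  ((hh.mono hKW).integrableOn_compact hK).of_forall_sdiff_eq_zero hW.measurableSet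
    fun z hz ↦ h0 z hz.1 hz.2

variable {E : Type*} [NormedAddCommGroup E] [InnerProductSpace ℝ E]

/-- `u` is a holomorphic curve on the open set `W` for the almost complex structure `Jc` on `E`,
which is bounded by `Λ` and Lipschitz with constant `L` along `u`. -/
structure IsJCurveOn (Jc : E → E →L[ℝ] E) (Λ L : ℝ) (W : Set ℂ) (u : ℂ → E) : Prop where
  isOpen : IsOpen W
  contDiffOn : ContDiffOn ℝ 1 u W
  fderiv_I : ∀ z ∈ W, fderiv ℝ u z Complex.I = Jc (u z) (fderiv ℝ u z 1)
  sq : ∀ z ∈ W, ∀ v, Jc (u z) (Jc (u z) v) = -v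
  norm_le : ∀ z ∈ W, ‖Jc (u z)‖ ≤ Λ
  lip : ∀ z ∈ W, ∀ z' ∈ W, ‖Jc (u z) - Jc (u z')‖ ≤ L * ‖u z - u z'‖

theorem gForm_self_continuous (J : E →L[ℝ] E) : Continuous fun v ↦ gForm J v v := by
  simp only [gForm]; fun_prop

theorem hasFDerivAt_gForm_self (J : E →L[ℝ] E) {u : ℂ → E} {x : E} {z : ℂ}
    (hu : DifferentiableAt ℝ u z) :
    DifferentiableAt ℝ (fun z ↦ gForm J (u z - x) (u z - x)) z ∧
    ∀ h, fderiv ℝ (fun z ↦ gForm J (u z - x) (u z - x)) z h =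
      2 * gForm J (u z - x) (fderiv ℝ u z h) := by
  have h1 : HasFDerivAt (fun z ↦ u z - x) (fderiv ℝ u z) z := hu.hasFDerivAt.sub_const x
  have h2 : HasFDerivAt (fun z ↦ J (u z - x)) (J.comp (fderiv ℝ u z)) z :=
    J.hasFDerivAt.comp z h1
  have h3 := (h1.inner ℝ h1).add (h2.inner ℝ h2)
  refine ⟨h3.differentiableAt, fun h ↦ ?_⟩
  have h4 : fderiv ℝ (fun z ↦ gForm J (u z - x) (u z - x)) z = _ := h3.fderiv
  rw [h4]
  simp only [add_apply, ContinuousLinearMap.comp_apply,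
    ContinuousLinearMap.prod_apply, fderivInnerCLM_apply, gForm]
  rw [real_inner_comm (u z - x) (fderiv ℝ u z h),
    real_inner_comm (J (u z - x)) (J (fderiv ℝ u z h))]
  ring

theorem continuousOn_weightDeriv {C δ s₀ : ℝ} :
    ContinuousOn (weightDeriv C δ s₀) (Ioi (-δ)) := by
  have h1 : ∀ s ∈ Ioi (-δ), (s + δ) ^ 2 ≠ 0 := fun s hs ↦ by
    have : 0 < s + δ := by have : -δ < s := hs
                           linarith
    positivity
  have h2 : ∀ s ∈ Ioi (-δ), s + δ ≠ 0 := fun s hs h ↦ h1 s hs (by rw [h]; norm_num)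
  have h4 : ∀ s ∈ Ioi (-δ), Real.sqrt (s + δ) ≠ 0 := fun s hs ↦ by
    have : 0 < s + δ := by have : -δ < s := hs
                           linarith
    exact (Real.sqrt_pos.2 this).ne'
  have h3 : ∀ s ∈ Ioi (-δ), (s + δ) * Real.sqrt (s + δ) ≠ 0 := fun s hs ↦
    mul_ne_zero (h2 s hs) (h4 s hs)
  unfold weightDeriv
  fun_prop (disch := assumption)

theorem contDiffOn_weight {C δ s₀ : ℝ} :
    ContDiffOn ℝ 1 (weight C δ s₀) (Ioi (-δ)) := by
  have hd : ∀ s ∈ Ioi (-δ), HasDerivAt (weight C δ s₀) (weightDeriv C δ s₀ s) s := fun s hs ↦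
    hasDerivAt_weight C s₀ (by have : -δ < s := hs
                               linarith)
  rw [show (1 : WithTop ℕ∞) = 0 + 1 from rfl, contDiffOn_succ_iff_deriv_of_isOpen isOpen_Ioi]
  refine ⟨fun s hs ↦ (hd s hs).differentiableAt.differentiableWithinAt, by simp, ?_⟩
  rw [contDiffOn_zero]
  exact (continuousOn_weightDeriv).congr fun s hs ↦ (hd s hs).deriv

namespace IsJCurveOn

variable {Jc : E → E →L[ℝ] E} {Λ L : ℝ} {W : Set ℂ} {u : ℂ → E}

theorem differentiableAt (hu : IsJCurveOn Jc Λ L W u) {z : ℂ} (hz : z ∈ W) :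
    DifferentiableAt ℝ u z :=
  (hu.contDiffOn.contDiffAt (hu.isOpen.mem_nhds hz)).differentiableAt one_ne_zero

theorem continuousOn_fderiv (hu : IsJCurveOn Jc Λ L W u) (h : ℂ) :
    ContinuousOn (fun z ↦ fderiv ℝ u z h) W :=
  (hu.contDiffOn.continuousOn_fderiv_of_isOpen hu.isOpen le_rfl).clm_apply continuousOn_const

theorem nonneg (hu : IsJCurveOn Jc Λ L W u) {z : ℂ} (hz : z ∈ W) : 0 ≤ Λ :=
  (norm_nonneg _).trans (hu.norm_le z hz)

/-- The integrated differential inequality behind the monotonicity formula. -/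
theorem integral_weight_le (hu : IsJCurveOn Jc Λ L W u) (hL : 0 ≤ L) {z₁ : ℂ} (hz₁ : z₁ ∈ W)
    {t δ C : ℝ} (ht : 0 < t) (hδ : 0 < δ) (hC : 4 * Λ * (1 + Λ ^ 2) * L ≤ C)
    (hsmall : C * Real.sqrt (t ^ 2 + δ) ≤ 1 / 6)
    (hK : IsCompact {z | z ∈ W ∧ ‖u z - u z₁‖ ≤ t}) :
    ∫ z in W, gForm (Jc (u z₁)) (fderiv ℝ u z 1) (fderiv ℝ u z 1) *
      (max (1 - gForm (Jc (u z₁)) (u z - u z₁) (u z - u z₁) / t ^ 2) 0 ^ 2 *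
        (δ / (gForm (Jc (u z₁)) (u z - u z₁) (u z - u z₁) + δ) ^ 2)) ≤
    12 / t ^ 2 * ∫ z in {z | z ∈ W ∧ ‖u z - u z₁‖ < t},
      gForm (Jc (u z₁)) (fderiv ℝ u z 1) (fderiv ℝ u z 1) := by
  set x := u z₁ with hx
  set J := Jc x with hJdef
  set K : Set ℂ := {z | z ∈ W ∧ ‖u z - x‖ ≤ t} with hKdef
  set A : Set ℂ := {z | z ∈ W ∧ ‖u z - x‖ < t} with hAdef
  set σ : ℂ → ℝ := fun z ↦ gForm J (u z - x) (u z - x) with hσdef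
  set m : ℂ → ℝ := fun z ↦ gForm J (fderiv ℝ u z 1) (fderiv ℝ u z 1) with hmdef
  have hΛ0 : 0 ≤ Λ := hu.nonneg hz₁
  have hC0 : 0 ≤ C := le_trans (by positivity) hC
  have hJsq : ∀ v, J (J v) = -v := hu.sq z₁ hz₁
  have hJn : ‖J‖ ≤ Λ := hu.norm_le z₁ hz₁
  have hW := hu.isOpen
  have hKW : K ⊆ W := fun z hz ↦ hz.1
  have hAW : A ⊆ W := fun z hz ↦ hz.1
  have hAK : A ⊆ K := fun z hz ↦ ⟨hz.1, hz.2.le⟩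
  have hcu : ContinuousOn u W := hu.contDiffOn.continuousOn
  have hA : IsOpen A := by
    have : A = W ∩ (fun z ↦ ‖u z - x‖) ⁻¹' Iio t := rfl
    rw [this]
    exact (by fun_prop : ContinuousOn (fun z ↦ ‖u z - x‖) W).isOpen_inter_preimage hW isOpen_Iio
  have hσ0 : ∀ z, 0 ≤ σ z := fun z ↦ gForm_self_nonneg _ _
  have hσA : ∀ z ∈ W, z ∉ A → t ^ 2 ≤ σ z := fun z hz hzA ↦ by
    have : t ≤ ‖u z - x‖ := by
      by_contra hlt
      exact hzA ⟨hz, not_le.1 hlt⟩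
    exact (pow_le_pow_left₀ ht.le this 2).trans (norm_sq_le_gForm J _)
  have hm0 : ∀ z, 0 ≤ m z := fun z ↦ gForm_self_nonneg _ _
  have hcv := hu.continuousOn_fderiv 1
  have hcσ : ContinuousOn σ W := (gForm_self_continuous J).comp_continuousOn (hcu.sub continuousOn_const)
  have hcm : ContinuousOn m W := (gForm_self_continuous J).comp_continuousOn hcv
  have hσd : ContDiffOn ℝ 1 σ W := by
    have h1 : ContDiffOn ℝ 1 (fun z ↦ u z - x) W := hu.contDiffOn.sub contDiffOn_const
    have h2 : ContDiffOn ℝ 1 (fun z ↦ J (u z - x)) W := J.contDiff.comp_contDiffOn h1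
    exact (h1.inner ℝ h1).add (h2.inner ℝ h2)
  set χ : ℂ → ℝ := fun z ↦ weight C δ (t ^ 2) (σ z) with hχdef
  set χ' : ℂ → ℝ := fun z ↦ weightDeriv C δ (t ^ 2) (σ z) with hχ'def
  have hσm : MapsTo σ W (Ioi (-δ)) := fun z _ ↦ by
    have := hσ0 z
    show -δ < σ z
    linarith
  have hχd : ContDiffOn ℝ 1 χ W := (contDiffOn_weight).comp hσd hσm
  have hcχ' : ContinuousOn χ' W := (continuousOn_weightDeriv).comp hcσ hσm
  -- The radial field at x times the weight. It is tested against the two-form `wForm J` with J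
  -- frozen at x; the coefficients are constant, so Stokes' theorem applies, and properness removes
  -- boundary terms.
  set F : ℂ → E := fun z ↦ χ z • (u z - x) with hFdef
  have hFd : ContDiffOn ℝ 1 F W := hχd.smul (hu.contDiffOn.sub contDiffOn_const)
  have hχ0 : ∀ z ∈ W, z ∉ A → χ z = 0 := fun z hz hzA ↦
    weight_eq_zero (by positivity) (hσA z hz hzA)
  have hχ'0 : ∀ z ∈ W, z ∉ A → χ' z = 0 := fun z hz hzA ↦
    weightDeriv_eq_zero (by positivity) (hσA z hz hzA)
  have hF0 : ∀ z ∈ W, z ∉ K → F z = 0 := fun z hz hzK ↦ by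
    simp only [hFdef, hχ0 z hz (fun h ↦ hzK (hAK h)), zero_smul]
  have hFf : ∀ z ∈ W, ∀ h, fderiv ℝ F z h = χ z • fderiv ℝ u z h +
      (χ' z * (2 * gForm J (u z - x) (fderiv ℝ u z h))) • (u z - x) := fun z hz h ↦ by
    have hd := hu.differentiableAt hz
    obtain ⟨g1, g2⟩ := hasFDerivAt_gForm_self J (x := x) hd
    have e1 : HasFDerivAt χ (weightDeriv C δ (t ^ 2) (σ z) • fderiv ℝ σ z) z :=
      (hasDerivAt_weight C (t ^ 2) (by have := hσ0 z
                                       linarith)).comp_hasFDerivAt z g1.hasFDerivAt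
    have e2 := e1.smul (hd.hasFDerivAt.sub_const x)
    have e3 : fderiv ℝ F z = _ := e2.fderiv
    rw [e3]
    simp only [add_apply, smul_apply,
      ContinuousLinearMap.smulRight_apply, smul_eq_mul]
    rw [g2 h]
  have hJF : ∀ z ∈ W, ∀ h, fderiv ℝ (fun z ↦ J (F z)) z h = J (fderiv ℝ F z h) := fun z hz h ↦ by
    have hd : DifferentiableAt ℝ F z :=
      (hFd.contDiffAt (hW.mem_nhds hz)).differentiableAt one_ne_zero
    have e3 : fderiv ℝ (fun z ↦ J (F z)) z = _ := (J.hasFDerivAt.comp z hd.hasFDerivAt).fderiv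
    rw [e3]; rfl
  have hJu : ∀ z ∈ W, ∀ h, fderiv ℝ (fun z ↦ J (u z)) z h = J (fderiv ℝ u z h) := fun z hz h ↦ by
    have e3 : fderiv ℝ (fun z ↦ J (u z)) z = _ :=
      (J.hasFDerivAt.comp z (hu.differentiableAt hz).hasFDerivAt).fderiv
    rw [e3]; rfl
  -- The form `wForm J` is a difference of two inner products, so Stokes is applied to the pairs (J
  -- F, u) and (F, J u). Subtracting, the integral of 2 Q vanishes.
  have st1 := setIntegral_inner_fderiv_comm (f := fun z ↦ J (F z)) hW hK hKW
    (J.contDiff.comp_contDiffOn hFd) (fun z hz hzK ↦ by simp [hF0 z hz hzK])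
    hu.contDiffOn 1 Complex.I
  have st2 := setIntegral_inner_fderiv_comm hW hK hKW hFd hF0
    (J.contDiff.comp_contDiffOn hu.contDiffOn) 1 Complex.I
  have hcF : ∀ h, ContinuousOn (fun z ↦ fderiv ℝ F z h) W := fun h ↦
    (hFd.continuousOn_fderiv_of_isOpen hW le_rfl).clm_apply continuousOn_const
  have hF'0 : ∀ z ∈ W, z ∉ K → ∀ h, fderiv ℝ F z h = 0 := fun z hz hzK h ↦ by
    rw [hFf z hz h, hχ0 z hz (fun h ↦ hzK (hAK h)), hχ'0 z hz (fun h ↦ hzK (hAK h))]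
    simp
  -- the integral identity
  have hi : ∀ h k, IntegrableOn (fun z ↦ ⟪J (fderiv ℝ F z h), fderiv ℝ u z k⟫) W := fun h k ↦ by
    refine integrableOn_of_eq_zero_off_compact hW hK hKW ?_ fun z hz hzK ↦ by
      simp [hF'0 z hz hzK]
    have := hcF h
    have := hu.continuousOn_fderiv k
    fun_prop
  have hi' : ∀ h k, IntegrableOn (fun z ↦ ⟪fderiv ℝ F z h, J (fderiv ℝ u z k)⟫) W := fun h k ↦ by
    refine integrableOn_of_eq_zero_off_compact hW hK hKW ?_ fun z hz hzK ↦ by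
      simp [hF'0 z hz hzK]
    have := hcF h
    have := hu.continuousOn_fderiv k
    fun_prop
  have st1' : ∫ z in W, ⟪J (fderiv ℝ F z 1), fderiv ℝ u z Complex.I⟫ =
      ∫ z in W, ⟪J (fderiv ℝ F z Complex.I), fderiv ℝ u z 1⟫ := by
    rw [setIntegral_congr_fun hW.measurableSet
      (g := fun z ↦ ⟪J (fderiv ℝ F z 1), fderiv ℝ u z Complex.I⟫)
      (fun z hz ↦ by simp only [hJF z hz])] at st1
    rw [st1]
    exact setIntegral_congr_fun hW.measurableSet (fun z hz ↦ by simp only [hJF z hz])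
  have st2' : ∫ z in W, ⟪fderiv ℝ F z 1, J (fderiv ℝ u z Complex.I)⟫ =
      ∫ z in W, ⟪fderiv ℝ F z Complex.I, J (fderiv ℝ u z 1)⟫ := by
    rw [setIntegral_congr_fun hW.measurableSet
      (g := fun z ↦ ⟪fderiv ℝ F z 1, J (fderiv ℝ u z Complex.I)⟫)
      (fun z hz ↦ by
        show ⟪fderiv ℝ F z 1, fderiv ℝ (fun z ↦ J (u z)) z Complex.I⟫ = _
        simp only [hJu z hz])] at st2
    rw [st2]
    exact setIntegral_congr_fun hW.measurableSet (fun z hz ↦ by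
      show ⟪fderiv ℝ F z Complex.I, fderiv ℝ (fun z ↦ J (u z)) z 1⟫ = _
      simp only [hJu z hz])
  set Q : ℂ → ℝ := fun z ↦ χ z * wForm J (fderiv ℝ u z 1) (fderiv ℝ u z Complex.I) +
    χ' z * (gForm J (u z - x) (fderiv ℝ u z 1) * wForm J (u z - x) (fderiv ℝ u z Complex.I) -
      gForm J (u z - x) (fderiv ℝ u z Complex.I) * wForm J (u z - x) (fderiv ℝ u z 1)) with hQdef
  have hQ2 : ∀ z ∈ W, ((⟪J (fderiv ℝ F z 1), fderiv ℝ u z Complex.I⟫ -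
      ⟪fderiv ℝ F z 1, J (fderiv ℝ u z Complex.I)⟫) -
      (⟪J (fderiv ℝ F z Complex.I), fderiv ℝ u z 1⟫ -
      ⟪fderiv ℝ F z Complex.I, J (fderiv ℝ u z 1)⟫)) = 2 * Q z := fun z hz ↦ by
    rw [hFf z hz, hFf z hz]
    simp only [hQdef, wForm, map_add, map_smul, inner_add_left, real_inner_smul_left]
    rw [real_inner_comm (fderiv ℝ u z 1) (J (fderiv ℝ u z Complex.I)),
      real_inner_comm (J (fderiv ℝ u z 1)) (fderiv ℝ u z Complex.I)]
    ring
  have hQint : IntegrableOn Q W := by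
    have := ((((hi 1 Complex.I).sub (hi' 1 Complex.I)).sub
      ((hi Complex.I 1).sub (hi' Complex.I 1))).const_mul (1 / 2))
    refine IntegrableOn.congr_fun this (fun z hz ↦ ?_) hW.measurableSet
    have := hQ2 z hz
    simp only [Pi.sub_apply]
    rw [this]; ring
  have hQ0 : ∫ z in W, Q z = 0 := by
    have e : ∫ z in W, 2 * Q z = 0 := by
      have hii : ∀ h k, IntegrableOn (fun z ↦ ⟪J (fderiv ℝ F z h), fderiv ℝ u z k⟫ -
          ⟪fderiv ℝ F z h, J (fderiv ℝ u z k)⟫) W := fun h k ↦ (hi h k).sub (hi' h k)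
      rw [← setIntegral_congr_fun hW.measurableSet hQ2]
      rw [integral_sub (hii 1 Complex.I) (hii Complex.I 1),
        integral_sub (hi 1 Complex.I) (hi' 1 Complex.I),
        integral_sub (hi Complex.I 1) (hi' Complex.I 1), st1', st2', sub_self]
    rw [integral_const_mul] at e
    linarith
  -- the pointwise inequality
  have hpt : ∀ z ∈ W, m z * (max (1 - σ z / t ^ 2) 0 ^ 2 * (δ / (σ z + δ) ^ 2)) -
      A.indicator (fun z ↦ 12 / t ^ 2 * m z) z ≤ Q z := fun z hz ↦ by
    by_cases hst : σ z < t ^ 2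
    · have hzA : z ∈ A := by
        by_contra hzA
        exact absurd (hσA z hz hzA) (not_le.2 hst)
      rw [indicator_of_mem hzA]
      set r := ‖u z - x‖ with hr
      have hpos : 0 < σ z + δ := by have := hσ0 z
                                    linarith
      have hw : ‖fderiv ℝ u z Complex.I - J (fderiv ℝ u z 1)‖ ≤ (L * r) * ‖fderiv ℝ u z 1‖ := by
        rw [hu.fderiv_I z hz, ← sub_apply]
        exact ContinuousLinearMap.le_of_opNorm_le _ (hu.lip z hz z₁ hz₁) _
      have hε : 0 ≤ L * r := by positivity
      have k1 := wForm_ge hJsq hJn hw hε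
      have k2 := gForm_mul_wForm_sub_le hJsq hJn hw hε (u z - x)
      have k3 := weight_ineq (s₀ := t ^ 2) (s := σ z) (r := r) hC0 hδ (by positivity) (hσ0 z)
        (norm_sq_le_gForm J (u z - x)) (by
          refine le_trans ?_ hsmall
          gcongr)
      have w0 : 0 ≤ χ z := weight_nonneg hC0 hpos
      have d0 : χ' z ≤ 0 := weightDeriv_nonpos hC0 (by positivity) hpos
      have k4 : χ z * (m z * (1 - C * r)) ≤
          χ z * wForm J (fderiv ℝ u z 1) (fderiv ℝ u z Complex.I) := by
        refine mul_le_mul_of_nonneg_left (le_trans ?_ k1) w0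
        refine mul_le_mul_of_nonneg_left ?_ (hm0 z)
        have : 2 * Λ * (L * r) ≤ C * r := by
          calc 2 * Λ * (L * r) = (2 * Λ * L) * r := by ring
            _ ≤ C * r := by
              gcongr
              refine le_trans ?_ hC
              nlinarith [mul_nonneg hΛ0 hL, mul_nonneg (mul_nonneg hΛ0 hL) (sq_nonneg Λ)]
        linarith
      have k5 : χ' z * (σ z * m z * (1 + C * r)) ≤ χ' z *
          (gForm J (u z - x) (fderiv ℝ u z 1) * wForm J (u z - x) (fderiv ℝ u z Complex.I) -
          gForm J (u z - x) (fderiv ℝ u z Complex.I) * wForm J (u z - x) (fderiv ℝ u z 1)) := by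
        refine mul_le_mul_of_nonpos_left (k2.trans ?_) d0
        refine mul_le_mul_of_nonneg_left ?_ (mul_nonneg (hσ0 z) (hm0 z))
        have : 4 * Λ * (1 + Λ ^ 2) * (L * r) ≤ C * r := by
          calc 4 * Λ * (1 + Λ ^ 2) * (L * r) = (4 * Λ * (1 + Λ ^ 2) * L) * r := by ring
            _ ≤ C * r := by gcongr
        linarith
      have k6 := mul_le_mul_of_nonneg_left k3 (hm0 z)
      simp only [hQdef]
      calc _ = m z * (max (1 - σ z / t ^ 2) 0 ^ 2 * (δ / (σ z + δ) ^ 2) - 12 / t ^ 2) := by ring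
        _ ≤ m z * (χ z * (1 - C * r) + χ' z * σ z * (1 + C * r)) := k6
        _ = χ z * (m z * (1 - C * r)) + χ' z * (σ z * m z * (1 + C * r)) := by ring
        _ ≤ _ := add_le_add k4 k5
    · have hge := not_lt.1 hst
      have e1 : χ z = 0 := weight_eq_zero (by positivity) hge
      have e2 : χ' z = 0 := weightDeriv_eq_zero (by positivity) hge
      have e3 : max (1 - σ z / t ^ 2) 0 = 0 := by
        refine max_eq_right ?_
        rw [sub_nonpos, le_div_iff₀ (by positivity)]; linarith
      have e4 : 0 ≤ A.indicator (fun z ↦ 12 / t ^ 2 * m z) z :=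
        indicator_nonneg (fun z _ ↦ mul_nonneg (by positivity) (hm0 z)) z
      simp only [hQdef, e1, e2, e3]
      linarith
  have hmA : IntegrableOn m A := ((hcm.mono hKW).integrableOn_compact hK).mono_set hAK
  have hind : IntegrableOn (A.indicator (fun z ↦ 12 / t ^ 2 * m z)) W :=
    ((integrable_indicator_iff hA.measurableSet).2 (hmA.const_mul _)).integrableOn
  have hlhs : IntegrableOn (fun z ↦ m z * (max (1 - σ z / t ^ 2) 0 ^ 2 * (δ / (σ z + δ) ^ 2))) W := by
    refine integrableOn_of_eq_zero_off_compact hW hK hKW ?_ fun z hz hzK ↦ ?_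
    · have hne : ∀ z ∈ W, (σ z + δ) ^ 2 ≠ 0 := fun z hz ↦ by
        have := hσ0 z
        positivity
      fun_prop (disch := assumption)
    · have e3 : max (1 - σ z / t ^ 2) 0 = 0 := by
        refine max_eq_right ?_
        rw [sub_nonpos, le_div_iff₀ (by positivity), one_mul]
        exact hσA z hz (fun h ↦ hzK (hAK h))
      simp [e3]
  have fin := setIntegral_mono_on (hlhs.sub hind) hQint hW.measurableSet hpt
  simp only [Pi.sub_apply] at fin
  rw [hQ0, integral_sub hlhs hind, setIntegral_indicator hA.measurableSet, inter_eq_self_of_subset_right hAW,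
    integral_const_mul] at fin
  linarith

end IsJCurveOn
end Monotonicity

/-! ### Monotonicity, III: the lower bound for the energy. -/

section Monotonicity

open scoped RealInnerProductSpace

variable {E : Type*} [NormedAddCommGroup E] [InnerProductSpace ℝ E]

/-- The constant of the monotonicity formula at a regular point. -/
def monoConst (Λ : ℝ) : ℝ := Real.pi / (3072 * (1 + Λ ^ 2) ^ 2 * (1 + Λ) ^ 2)

theorem monoConst_pos {Λ : ℝ} (hΛ : 0 ≤ Λ) : 0 < monoConst Λ := by
  unfold monoConst
  have := Real.pi_pos
  positivity

namespace IsJCurveOn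

variable {Jc : E → E →L[ℝ] E} {Λ L : ℝ} {W : Set ℂ} {u : ℂ → E}

theorem norm_fderiv_le (hu : IsJCurveOn Jc Λ L W u) {z : ℂ} (hz : z ∈ W) :
    ‖fderiv ℝ u z‖ ≤ (1 + Λ) * ‖fderiv ℝ u z 1‖ := by
  have hΛ := hu.nonneg hz
  refine ContinuousLinearMap.opNorm_le_bound _ (by positivity) fun h ↦ ?_
  have e : fderiv ℝ u z h = h.re • fderiv ℝ u z 1 + h.im • fderiv ℝ u z Complex.I := by
    rw [← map_smul, ← map_smul, ← map_add]
    congr 1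
    simp [Complex.re_add_im]
  rw [e, hu.fderiv_I z hz]
  have h1 : ‖Jc (u z) (fderiv ℝ u z 1)‖ ≤ Λ * ‖fderiv ℝ u z 1‖ :=
    ContinuousLinearMap.le_of_opNorm_le _ (hu.norm_le z hz) _
  calc _ ≤ ‖h.re • fderiv ℝ u z 1‖ + ‖h.im • Jc (u z) (fderiv ℝ u z 1)‖ := norm_add_le _ _
    _ = |h.re| * ‖fderiv ℝ u z 1‖ + |h.im| * ‖Jc (u z) (fderiv ℝ u z 1)‖ := by
        rw [norm_smul, norm_smul]; rfl
    _ ≤ ‖h‖ * ‖fderiv ℝ u z 1‖ + ‖h‖ * (Λ * ‖fderiv ℝ u z 1‖) := by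
        gcongr
        · exact Complex.abs_re_le_norm h
        · exact Complex.abs_im_le_norm h
    _ = _ := by ring

/-- Monotonicity at a point where the differential does not vanish. -/
theorem monotonicity_of_ne (hu : IsJCurveOn Jc Λ L W u) (hL : 0 ≤ L) {z₁ : ℂ} (hz₁ : z₁ ∈ W)
    (hne : fderiv ℝ u z₁ 1 ≠ 0) {t C : ℝ} (ht : 0 < t) (hC : 4 * Λ * (1 + Λ ^ 2) * L ≤ C)
    (hsmall : C * t ≤ 1 / 12) (hK : IsCompact {z | z ∈ W ∧ ‖u z - u z₁‖ ≤ t}) :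
    ENNReal.ofReal (monoConst Λ * t ^ 2) ≤
      ∫⁻ z in {z | z ∈ W ∧ ‖u z - u z₁‖ < t}, ‖fderiv ℝ u z 1‖ₑ ^ 2 := by
  set x := u z₁ with hx
  set J := Jc x with hJdef
  set A : Set ℂ := {z | z ∈ W ∧ ‖u z - x‖ < t} with hAdef
  set b := ‖fderiv ℝ u z₁ 1‖ with hb
  have hb0 : 0 < b := norm_pos_iff.2 hne
  have hΛ0 : 0 ≤ Λ := hu.nonneg hz₁
  have hC0 : 0 ≤ C := le_trans (by positivity) hC
  have hJn : ‖J‖ ≤ Λ := hu.norm_le z₁ hz₁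
  have hW := hu.isOpen
  have hcu : ContinuousOn u W := hu.contDiffOn.continuousOn
  have hcv := hu.continuousOn_fderiv 1
  have hA : IsOpen A :=
    (by fun_prop : ContinuousOn (fun z ↦ ‖u z - x‖) W).isOpen_inter_preimage hW isOpen_Iio
  have hKW : {z | z ∈ W ∧ ‖u z - x‖ ≤ t} ⊆ W := fun z hz ↦ hz.1
  have hAK : A ⊆ {z | z ∈ W ∧ ‖u z - x‖ ≤ t} := fun z hz ↦ ⟨hz.1, hz.2.le⟩
  -- a small ball around `z₁`
  have hev : ∀ᶠ z in 𝓝 z₁, z ∈ W ∧ b / 2 < ‖fderiv ℝ u z 1‖ ∧ ‖fderiv ℝ u z 1‖ < 2 * b := by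
    have hc : ContinuousAt (fun z ↦ ‖fderiv ℝ u z 1‖) z₁ :=
      (hcv.continuousAt (hW.mem_nhds hz₁)).norm
    filter_upwards [hW.mem_nhds hz₁, hc.eventually (lt_mem_nhds (by linarith : b / 2 < b)),
      hc.eventually (gt_mem_nhds (by linarith : b < 2 * b))] with z h1 h2 h3 using ⟨h1, h2, h3⟩
  obtain ⟨R₀, hR₀, hball⟩ := Metric.eventually_nhds_iff_ball.1 hev
  set q : ℝ := 4 * (1 + Λ ^ 2) * (1 + Λ) ^ 2 * b ^ 2 with hq
  have hq0 : 0 < q := by positivity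
  -- The kernel δ/(σ + δ)² concentrates at z₁ as δ becomes small. The radius R = √(δ/q) is such that
  -- σ ≤ δ on the ball of radius R around z₁, which lies in the region where the differential has
  -- size about b. The resulting lower bound π R² b²/(64 δ) no longer depends on δ or b, and this is
  -- where `monoConst` comes from.
  set δ : ℝ := min (t ^ 2 / 2) (q * R₀ ^ 2) with hδdef
  have hδ : 0 < δ := lt_min (by positivity) (by positivity)
  have hδt : δ ≤ t ^ 2 / 2 := min_le_left _ _
  set R : ℝ := Real.sqrt (δ / q) with hR
  have hR2 : R ^ 2 = δ / q := Real.sq_sqrt (by positivity)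
  have hR0 : 0 < R := Real.sqrt_pos.2 (by positivity)
  have hRR₀ : R ≤ R₀ := by
    refine Real.sqrt_le_iff.2 ⟨hR₀.le, ?_⟩
    rw [div_le_iff₀ hq0]
    calc δ ≤ q * R₀ ^ 2 := min_le_right _ _
      _ = _ := by ring
  have hballR : ∀ z ∈ Metric.ball z₁ R, z ∈ W ∧ b / 2 < ‖fderiv ℝ u z 1‖ ∧
      ‖fderiv ℝ u z 1‖ < 2 * b := fun z hz ↦ hball z (Metric.ball_subset_ball hRR₀ hz)
  have key := hu.integral_weight_le hL hz₁ ht hδ hC (by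
    have : Real.sqrt (t ^ 2 + δ) ≤ 2 * t := by
      refine Real.sqrt_le_iff.2 ⟨by positivity, ?_⟩
      nlinarith
    calc C * Real.sqrt (t ^ 2 + δ) ≤ C * (2 * t) := by gcongr
      _ ≤ 1 / 6 := by linarith) hK
  rw [← hx, ← hJdef] at key
  set σ : ℂ → ℝ := fun z ↦ gForm J (u z - x) (u z - x) with hσdef
  set m : ℂ → ℝ := fun z ↦ gForm J (fderiv ℝ u z 1) (fderiv ℝ u z 1) with hmdef
  have hσ0 : ∀ z, 0 ≤ σ z := fun z ↦ gForm_self_nonneg _ _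
  have hm0 : ∀ z, 0 ≤ m z := fun z ↦ gForm_self_nonneg _ _
  have hcσ : ContinuousOn σ W :=
    (gForm_self_continuous J).comp_continuousOn (hcu.sub continuousOn_const)
  have hcm : ContinuousOn m W := (gForm_self_continuous J).comp_continuousOn hcv
  set h : ℂ → ℝ := fun z ↦ m z * (max (1 - σ z / t ^ 2) 0 ^ 2 * (δ / (σ z + δ) ^ 2)) with hhdef
  have hh0 : ∀ z, 0 ≤ h z := fun z ↦ by
    have h1 := hm0 z
    have h2 := hσ0 z
    simp only [hhdef]; positivity
  have hpt : ∀ z ∈ Metric.ball z₁ R, b ^ 2 / (64 * δ) ≤ h z := fun z hz ↦ by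
    obtain ⟨g1, g2, g3⟩ := hballR z hz
    have hξ : ‖u z - x‖ ≤ ((1 + Λ) * (2 * b)) * R := by
      have h1 := Convex.norm_image_sub_le_of_norm_fderiv_le (𝕜 := ℝ) (f := u)
        (C := (1 + Λ) * (2 * b)) (s := Metric.ball z₁ R)
        (fun y hy ↦ hu.differentiableAt (hballR y hy).1)
        (fun y hy ↦ (hu.norm_fderiv_le (hballR y hy).1).trans (by
          have := (hballR y hy).2.2.le
          gcongr)) (convex_ball z₁ R) (Metric.mem_ball_self hR0) hz
      refine h1.trans ?_
      gcongr
      exact (mem_ball_iff_norm.1 hz).le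
    have hσδ : σ z ≤ δ := by
      calc σ z ≤ (1 + Λ ^ 2) * ‖u z - x‖ ^ 2 := gForm_self_le hJn _
        _ ≤ (1 + Λ ^ 2) * (((1 + Λ) * (2 * b)) * R) ^ 2 := by gcongr
        _ = q * R ^ 2 := by rw [hq]; ring
        _ = δ := by rw [hR2]; field_simp
    have hmz : b ^ 2 / 4 ≤ m z := by
      calc b ^ 2 / 4 = (b / 2) ^ 2 := by ring
        _ ≤ ‖fderiv ℝ u z 1‖ ^ 2 := by gcongr
        _ ≤ m z := norm_sq_le_gForm J _
    have hκ : (1 / 2) ^ 2 ≤ max (1 - σ z / t ^ 2) 0 ^ 2 := by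
      have : 1 / 2 ≤ 1 - σ z / t ^ 2 := by
        have : σ z / t ^ 2 ≤ 1 / 2 := by
          rw [div_le_iff₀ (by positivity)]; linarith
        linarith
      gcongr
      exact this.trans (le_max_left _ _)
    have hfr : 1 / (4 * δ) ≤ δ / (σ z + δ) ^ 2 := by
      have h2 := hσ0 z
      rw [div_le_div_iff₀ (by positivity) (by positivity)]
      nlinarith
    calc b ^ 2 / (64 * δ) = b ^ 2 / 4 * ((1 / 2) ^ 2 * (1 / (4 * δ))) := by
          field_simp; norm_num
      _ ≤ h z := by
          simp only [hhdef]
          gcongr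
          exact hm0 z
  have hmA : IntegrableOn m A :=
    ((hcm.mono hKW).integrableOn_compact hK).mono_set hAK
  have hhint : IntegrableOn h W := by
    refine integrableOn_of_eq_zero_off_compact hW hK hKW ?_ fun z hz hzK ↦ ?_
    · have hne : ∀ z ∈ W, (σ z + δ) ^ 2 ≠ 0 := fun z hz ↦ by
        have := hσ0 z
        positivity
      fun_prop (disch := assumption)
    · have e3 : max (1 - σ z / t ^ 2) 0 = 0 := by
        refine max_eq_right ?_
        rw [sub_nonpos, le_div_iff₀ (by positivity), one_mul]
        have : t ≤ ‖u z - x‖ := by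
          by_contra hlt
          exact hzK ⟨hz, (not_le.1 hlt).le⟩
        exact (pow_le_pow_left₀ ht.le this 2).trans (norm_sq_le_gForm J _)
      simp [hhdef, e3]
  have hvol : (volume (Metric.ball z₁ R)).toReal = Real.pi * R ^ 2 := by
    rw [Complex.volume_ball]
    simp [ENNReal.toReal_ofReal hR0.le, mul_comm]
  have hlow : Real.pi * R ^ 2 * (b ^ 2 / (64 * δ)) ≤ ∫ z in W, h z := by
    calc Real.pi * R ^ 2 * (b ^ 2 / (64 * δ)) = ∫ z in Metric.ball z₁ R, b ^ 2 / (64 * δ) := by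
          rw [setIntegral_const, smul_eq_mul, Measure.real, hvol]
      _ ≤ ∫ z in Metric.ball z₁ R, h z :=
          setIntegral_mono_on (integrableOn_const (by simp [Complex.volume_ball, ENNReal.mul_eq_top]))
            (hhint.mono_set fun z hz ↦ (hballR z hz).1) measurableSet_ball hpt
      _ ≤ ∫ z in W, h z :=
          setIntegral_mono_set hhint (Eventually.of_forall hh0)
            (Eventually.of_forall fun z hz ↦ (hballR z hz).1)
  have hn2 : IntegrableOn (fun z ↦ ‖fderiv ℝ u z 1‖ ^ 2) A :=
    (((hcv.norm.pow 2).mono hKW).integrableOn_compact hK).mono_set hAK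
  have hup : ∫ z in A, m z ≤ (1 + Λ ^ 2) * ∫ z in A, ‖fderiv ℝ u z 1‖ ^ 2 := by
    rw [← integral_const_mul]
    exact setIntegral_mono_on hmA (hn2.const_mul _) hA.measurableSet
      fun z _ ↦ gForm_self_le hJn _
  have hfin : monoConst Λ * t ^ 2 ≤ ∫ z in A, ‖fderiv ℝ u z 1‖ ^ 2 := by
    have h1 : Real.pi * R ^ 2 * (b ^ 2 / (64 * δ)) ≤
        12 / t ^ 2 * ((1 + Λ ^ 2) * ∫ z in A, ‖fderiv ℝ u z 1‖ ^ 2) :=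
      (hlow.trans key).trans (by gcongr)
    have h2 : Real.pi * R ^ 2 * (b ^ 2 / (64 * δ)) =
        12 / t ^ 2 * ((1 + Λ ^ 2) * (monoConst Λ * t ^ 2)) := by
      rw [hR2, hq, monoConst]
      field_simp
      norm_num
    rw [h2] at h1
    exact le_of_mul_le_mul_left (le_of_mul_le_mul_left h1 (by positivity)) (by positivity)
  calc ENNReal.ofReal (monoConst Λ * t ^ 2)
      ≤ ENNReal.ofReal (∫ z in A, ‖fderiv ℝ u z 1‖ ^ 2) := ENNReal.ofReal_le_ofReal hfin
    _ = ∫⁻ z in A, ENNReal.ofReal (‖fderiv ℝ u z 1‖ ^ 2) :=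
        ofReal_integral_eq_lintegral_ofReal hn2 (Eventually.of_forall fun z ↦ by positivity)
    _ = _ := by
        refine lintegral_congr fun z ↦ ?_
        rw [ENNReal.ofReal_pow (norm_nonneg _), ofReal_norm]

/-- **Monotonicity**: a holomorphic curve that is proper over the ball of radius `t` around one of
its points has energy at least `c t ^ 2` in that ball. -/
theorem monotonicity (hu : IsJCurveOn Jc Λ L W u) (hL : 0 ≤ L) {z₀ : ℂ} (hz₀ : z₀ ∈ W)
    {t C : ℝ} (ht : 0 < t) (hC : 4 * Λ * (1 + Λ ^ 2) * L ≤ C)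
    (hsmall : C * t ≤ 1 / 12) (hK : IsCompact {z | z ∈ W ∧ ‖u z - u z₀‖ ≤ t}) :
    ENNReal.ofReal (monoConst Λ / 4 * t ^ 2) ≤
      ∫⁻ z in {z | z ∈ W ∧ ‖u z - u z₀‖ < t}, ‖fderiv ℝ u z 1‖ₑ ^ 2 := by
  have hΛ0 : 0 ≤ Λ := hu.nonneg hz₀
  have hC0 : 0 ≤ C := le_trans (by positivity) hC
  have hW := hu.isOpen
  have hcu : ContinuousOn u W := hu.contDiffOn.continuousOn
  have hsub : ∀ (y : E) (s : ℝ), {z | z ∈ W ∧ ‖u z - y‖ ≤ s} ⊆ {z | z ∈ W ∧ ‖u z - u z₀‖ ≤ t} →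
      IsCompact {z | z ∈ W ∧ ‖u z - y‖ ≤ s} := fun y s hs ↦ by
    refine hK.of_isClosed_subset ?_ hs
    have e : {z | z ∈ W ∧ ‖u z - y‖ ≤ s} =
        {z | z ∈ W ∧ ‖u z - u z₀‖ ≤ t} ∩ (fun z ↦ ‖u z - y‖) ⁻¹' Iic s := by
      ext z
      exact ⟨fun h ↦ ⟨hs h, h.2⟩, fun h ↦ ⟨h.1.1, h.2⟩⟩
    rw [e]
    refine ContinuousOn.preimage_isClosed_of_isClosed ?_ hK.isClosed isClosed_Iic
    exact ((hcu.mono fun z hz ↦ hz.1).sub continuousOn_const).norm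
  -- If the differential is nonzero at a point mapped within t/2 of the centre, the previous
  -- estimate on a ball of radius t/2 loses only the factor 4. Otherwise u is locally constant
  -- there, and its level set through z₀ is nonempty, compact and open in the plane, which is
  -- absurd.
  by_cases hex : ∃ z₁ ∈ W, ‖u z₁ - u z₀‖ < t / 2 ∧ fderiv ℝ u z₁ 1 ≠ 0
  · obtain ⟨z₁, hz₁, hlt, hne⟩ := hex
    have htri : ∀ z, ‖u z - u z₀‖ ≤ ‖u z - u z₁‖ + ‖u z₁ - u z₀‖ := fun z ↦ by
      have := norm_add_le (u z - u z₁) (u z₁ - u z₀)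
      simpa using this
    have h1 := hu.monotonicity_of_ne hL hz₁ hne (t := t / 2) (by positivity) hC (by nlinarith)
      (hsub _ _ fun z hz ↦ ⟨hz.1, by linarith [htri z, hz.2]⟩)
    calc ENNReal.ofReal (monoConst Λ / 4 * t ^ 2)
        = ENNReal.ofReal (monoConst Λ * (t / 2) ^ 2) := by congr 1; ring
      _ ≤ _ := h1
      _ ≤ _ := by
          refine lintegral_mono_set ?_
          rintro z ⟨hz, hz'⟩
          exact ⟨hz, by linarith [htri z]⟩
  · exfalso
    push Not at hex
    set Z : Set ℂ := {z | z ∈ W ∧ ‖u z - u z₀‖ ≤ 0} with hZ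
    have hZc : IsCompact Z := hsub _ _ fun z hz ↦ ⟨hz.1, hz.2.trans ht.le⟩
    have hZo : IsOpen Z := by
      rw [Metric.isOpen_iff]
      rintro z ⟨hz, hz0⟩
      have hzu : u z = u z₀ := by
        have := le_antisymm hz0 (norm_nonneg _)
        rwa [norm_eq_zero, sub_eq_zero] at this
      have hV : IsOpen (W ∩ (fun z ↦ ‖u z - u z₀‖) ⁻¹' Iio (t / 2)) :=
        (by fun_prop : ContinuousOn (fun z ↦ ‖u z - u z₀‖) W).isOpen_inter_preimage hW isOpen_Iio
      obtain ⟨ε, hε, hεV⟩ := Metric.isOpen_iff.1 hV z ⟨hz, by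
        show ‖u z - u z₀‖ < t / 2
        linarith⟩
      refine ⟨ε, hε, fun y hy ↦ ⟨(hεV hy).1, ?_⟩⟩
      have h1 := Convex.norm_image_sub_le_of_norm_fderiv_le (𝕜 := ℝ) (f := u)
        (C := 0) (s := Metric.ball z ε)
        (fun y hy ↦ hu.differentiableAt (hεV hy).1)
        (fun y hy ↦ (hu.norm_fderiv_le (hεV hy).1).trans (by
          rw [hex y (hεV hy).1 (hεV hy).2]; simp)) (convex_ball z ε) (Metric.mem_ball_self hε) hy
      rw [← hzu]
      simpa using h1
    have huniv : Z = univ := IsClopen.eq_univ ⟨hZc.isClosed, hZo⟩ ⟨z₀, hz₀, by simp⟩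
    rw [huniv] at hZc
    exact noncompact_univ ℂ hZc

end IsJCurveOn
end Monotonicity

/-! ### Monotonicity for discs in the manifold. -/

section ChartMonotonicity

variable {M : Type*} [TopologicalSpace M] [ChartedSpace (EuclideanHalfSpace 4) M]

/-- The points of the chart domain at `p` whose coordinates are within `t` of those of `x`. -/
def chartNear (p x : M) (t : ℝ) : Set M :=
  {y | y ∈ (extChartAt (𝓡∂ 4) p).source ∧
    ‖extChartAt (𝓡∂ 4) p y - extChartAt (𝓡∂ 4) p x‖ ≤ t}

theorem chartNear_subset {p x : M} {ρ t : ℝ} (hx : x ∈ chartBall p (ρ - t)) :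
    chartNear p x t ⊆ chartBall p ρ := fun y hy ↦ ⟨hy.1, by
  have h := norm_add_le (extChartAt (𝓡∂ 4) p y - extChartAt (𝓡∂ 4) p x)
    (extChartAt (𝓡∂ 4) p x - extChartAt (𝓡∂ 4) p p)
  rw [sub_add_sub_cancel] at h
  linarith [hy.2, hx.2]⟩

variable [IsManifold (𝓡∂ 4) ∞ M] {𝒥 : AlmostComplexStructure M} {Ω : TameSymplecticForm 𝒥} {p : M}

theorem ChartModel.isClosed_chartNear [T2Space M] (cm : ChartModel 𝒥 Ω p) {x : M} {t : ℝ}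
    (hx : x ∈ chartBall p (cm.radius - t)) : IsClosed (chartNear p x t) := by
  have h1 := cm.isClosed_chartClosedBall le_rfl
  have e : chartNear p x t = chartClosedBall p cm.radius ∩
      (fun y ↦ ‖extChartAt (𝓡∂ 4) p y - extChartAt (𝓡∂ 4) p x‖) ⁻¹' Iic t := by
    ext y
    exact ⟨fun h ↦ ⟨chartBall_subset p le_rfl (chartNear_subset hx h), h.2⟩,
      fun h ↦ ⟨h.1.1, h.2⟩⟩
  rw [e]
  refine ContinuousOn.preimage_isClosed_of_isClosed ?_ h1 isClosed_Iic
  exact (((continuousOn_extChartAt p).mono fun y hy ↦ hy.1).sub continuousOn_const).norm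

theorem IsJHolomorphicDisc.continuousOn {u : ℂ → M} (hu : IsJHolomorphicDisc 𝒥 u) :
    ContinuousOn u (Metric.ball 0 1) := hu.1.continuousOn

theorem IsJHolomorphicDisc.isJCurveOn (cm : ChartModel 𝒥 Ω p) {u : ℂ → M}
    (hu : IsJHolomorphicDisc 𝒥 u) {U : Set ℂ} (hU : IsOpen U) (hUD : U ⊆ Metric.ball 0 1) {ρ : ℝ}
    (hρ : ρ ≤ cm.radius) :
    IsJCurveOn cm.Jc cm.bound cm.lip (U ∩ u ⁻¹' chartBall p ρ)
      (fun z ↦ extChartAt (𝓡∂ 4) p (u z)) where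
  isOpen := (hu.continuousOn.mono hUD).isOpen_inter_preimage hU (isOpen_chartBall p ρ)
  contDiffOn _ hz := (hu.contDiffAt_chart (hUD hz.1) hz.2.1).contDiffWithinAt
  fderiv_I _ hz := hu.fderiv_chart_I cm (hUD hz.1) (chartBall_mono p hρ hz.2)
  sq _ hz := cm.Jc_sq _ (chartBall_mono p hρ hz.2)
  norm_le _ hz := cm.Jc_norm _ (chartBall_mono p hρ hz.2)
  lip _ hz _ hz' := cm.Jc_lip _ (chartBall_mono p hρ hz.2) _ (chartBall_mono p hρ hz'.2)

/-- **Monotonicity** for holomorphic discs near `p`. -/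
theorem ChartModel.exists_monotonicity [T2Space M] (cm : ChartModel 𝒥 Ω p) :
    ∃ t₀ > 0, ∃ c > 0, ∀ u : ℂ → M, IsJHolomorphicDisc 𝒥 u → ∀ U : Set ℂ, IsOpen U →
      U ⊆ Metric.ball 0 1 → ∀ z₀ ∈ U, ∀ t : ℝ, 0 < t → t ≤ t₀ →
      u z₀ ∈ chartBall p (cm.radius / 2 - t) →
      (∀ ζ ∈ Metric.closedBall (0 : ℂ) 1, ζ ∉ U → ∀ᶠ z in 𝓝[U] ζ, u z ∉ chartNear p (u z₀) t) →
      ENNReal.ofReal (c * t ^ 2) ≤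
        ∫⁻ z in U ∩ u ⁻¹' chartNear p (u z₀) t, cm.density u z := by
  have hb := cm.bound_nonneg
  have hl := cm.lip_nonneg
  have hr := cm.radius_pos
  -- The summand 1 makes C positive, so that t₀ = 1/(12 C) makes sense even when J is constant in
  -- the chart.
  set C := 4 * cm.bound * (1 + cm.bound ^ 2) * cm.lip + 1 with hC
  have hCpos : 0 < C := by positivity
  refine ⟨1 / (12 * C), by positivity, monoConst cm.bound / 4,
    by have := monoConst_pos hb; positivity, ?_⟩
  intro u hu U hU hUD z₀ hz₀ t ht htt hz hfr
  have hcurve := hu.isJCurveOn cm hU hUD (ρ := cm.radius / 2) (by linarith)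
  set W := U ∩ u ⁻¹' chartBall p (cm.radius / 2) with hW
  have hzW : z₀ ∈ W := ⟨hz₀, chartBall_mono p (by linarith) hz⟩
  have hKeq : {z | z ∈ W ∧ ‖extChartAt (𝓡∂ 4) p (u z) - extChartAt (𝓡∂ 4) p (u z₀)‖ ≤ t} =
      U ∩ u ⁻¹' chartNear p (u z₀) t := by
    ext z
    exact ⟨fun h ↦ ⟨h.1.1, h.1.2.1, h.2⟩, fun h ↦ ⟨⟨h.1, chartNear_subset hz h.2⟩, h.2.2⟩⟩
  -- Properness over the ball: limit points inside U are handled by continuity, and those outside U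
  -- are excluded by the assumption on the frontier. No extension of u to the unit circle is needed.
  have hK : IsCompact (U ∩ u ⁻¹' chartNear p (u z₀) t) := by
    refine (isCompact_closedBall (0 : ℂ) 1).of_isClosed_subset ?_
      (inter_subset_left.trans (hUD.trans Metric.ball_subset_closedBall))
    refine isClosed_of_closure_subset fun ζ hζ ↦ ?_
    have hfreq := mem_closure_iff_frequently.1 hζ
    have hζD : ζ ∈ Metric.closedBall (0 : ℂ) 1 :=
      Metric.isClosed_closedBall.closure_subset_iff.2
        (inter_subset_left.trans (hUD.trans Metric.ball_subset_closedBall)) hζ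
    by_cases hζU : ζ ∈ U
    · refine ⟨hζU, ?_⟩
      have hcl := cm.isClosed_chartNear (x := u z₀) (t := t) (chartBall_mono p (by linarith) hz)
      have hcont : ContinuousAt u ζ :=
        hu.continuousOn.continuousAt (Metric.isOpen_ball.mem_nhds (hUD hζU))
      by_contra hnot
      have hev := hcont.eventually (hcl.isOpen_compl.mem_nhds hnot)
      obtain ⟨z, hz1, hz2⟩ := (hfreq.and_eventually hev).exists
      exact hz2 hz1.2
    · exfalso
      have hev := eventually_nhdsWithin_iff.1 (hfr ζ hζD hζU)
      obtain ⟨z, hz1, hz2⟩ := (hfreq.and_eventually hev).exists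
      exact hz2 hz1.1 hz1.2
  have key := hcurve.monotonicity hl hzW ht (C := C) (by linarith)
    (by rw [le_div_iff₀ (by positivity)] at htt; linarith) (by rw [hKeq]; exact hK)
  refine key.trans ?_
  calc _ ≤ ∫⁻ z in U ∩ u ⁻¹' chartNear p (u z₀) t,
        ‖fderiv ℝ (fun z ↦ extChartAt (𝓡∂ 4) p (u z)) z 1‖ₑ ^ 2 := by
        refine lintegral_mono_set ?_
        rintro z ⟨h1, h2⟩
        exact ⟨h1.1, h1.2.1, h2.le⟩
    _ = _ := by
        refine setLIntegral_congr_fun hK.measurableSet fun z hz' ↦ ?_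
        simp only [ChartModel.density]
        rw [cm.fderiv_vec hu (hUD hz'.1) (chartNear_subset hz hz'.2)]

end ChartMonotonicity

/-! ### Möbius reparametrizations preserve Bishop discs and do not increase area. -/

section Mobius

variable {c a : ℂ}

theorem one_sub_conj_mul_ne_zero (ha : ‖a‖ < 1) {z : ℂ} (hz : ‖z‖ ≤ 1) :
    1 - starRingEnd ℂ a * z ≠ 0 := by
  intro h
  have h1 : starRingEnd ℂ a * z = 1 := (sub_eq_zero.1 h).symm
  have h2 : ‖starRingEnd ℂ a * z‖ < 1 := by
    rw [norm_mul, Complex.norm_conj]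
    nlinarith [norm_nonneg a, norm_nonneg z]
  rw [h1] at h2
  simp at h2

theorem norm_sq_one_sub_conj_mul (a z : ℂ) :
    ‖1 - starRingEnd ℂ a * z‖ ^ 2 - ‖z - a‖ ^ 2 = (1 - ‖a‖ ^ 2) * (1 - ‖z‖ ^ 2) := by
  simp only [← Complex.normSq_eq_norm_sq, Complex.normSq_apply]
  simp
  ring

theorem norm_mobius_sq (hc : ‖c‖ = 1) (ha : ‖a‖ < 1) {z : ℂ} (hz : ‖z‖ ≤ 1) :
    1 - ‖mobius c a z‖ ^ 2 =
      (1 - ‖a‖ ^ 2) * (1 - ‖z‖ ^ 2) / ‖1 - starRingEnd ℂ a * z‖ ^ 2 := by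
  have h : ‖1 - starRingEnd ℂ a * z‖ ≠ 0 := norm_ne_zero_iff.2 (one_sub_conj_mul_ne_zero ha hz)
  rw [← norm_sq_one_sub_conj_mul, mobius, norm_div, norm_mul, hc, one_mul,
    div_pow, sub_div, div_self (pow_ne_zero 2 h)]

theorem mobius_mem_ball (hc : ‖c‖ = 1) (ha : ‖a‖ < 1) {z : ℂ} (hz : z ∈ Metric.ball (0 : ℂ) 1) :
    mobius c a z ∈ Metric.ball (0 : ℂ) 1 := by
  rw [mem_ball_zero_iff] at hz ⊢
  have h0 := norm_pos_iff.2 (one_sub_conj_mul_ne_zero ha hz.le)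
  have h := norm_mobius_sq hc ha hz.le
  have h1 : 0 < (1 - ‖a‖ ^ 2) * (1 - ‖z‖ ^ 2) / ‖1 - starRingEnd ℂ a * z‖ ^ 2 := by
    have := norm_nonneg a
    have := norm_nonneg z
    have h2 : 0 < 1 - ‖a‖ ^ 2 := by nlinarith
    have h3 : 0 < 1 - ‖z‖ ^ 2 := by nlinarith
    positivity
  nlinarith [norm_nonneg (mobius c a z)]

theorem mobius_mem_sphere (hc : ‖c‖ = 1) (ha : ‖a‖ < 1) {z : ℂ}
    (hz : z ∈ Metric.sphere (0 : ℂ) 1) : mobius c a z ∈ Metric.sphere (0 : ℂ) 1 := by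
  rw [mem_sphere_zero_iff_norm] at hz ⊢
  have h := norm_mobius_sq hc ha hz.le
  rw [hz] at h
  simp at h
  have h1 : ‖mobius c a z‖ ^ 2 = 1 := by linarith
  nlinarith [norm_nonneg (mobius c a z)]

theorem hasDerivAt_mobius (c : ℂ) (ha : ‖a‖ < 1) {z : ℂ} (hz : ‖z‖ ≤ 1) :
    HasDerivAt (mobius c a) (c * (1 - starRingEnd ℂ a * a) / (1 - starRingEnd ℂ a * z) ^ 2) z := by
  have h0 := one_sub_conj_mul_ne_zero ha hz
  have h1 : HasDerivAt (fun z ↦ c * (z - a)) c z := by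
    simpa using ((hasDerivAt_id z).sub_const a).const_mul c
  have h2 : HasDerivAt (fun z ↦ 1 - starRingEnd ℂ a * z) (-starRingEnd ℂ a) z := by
    simpa using ((hasDerivAt_id z).const_mul (starRingEnd ℂ a)).const_sub 1
  refine (h1.div h2 h0).congr_deriv ?_
  congr 1
  ring

theorem injOn_mobius (hc : ‖c‖ = 1) (ha : ‖a‖ < 1) : InjOn (mobius c a) (Metric.ball 0 1) := by
  intro z hz w hw h
  have h1 := one_sub_conj_mul_ne_zero ha (mem_ball_zero_iff.1 hz).le
  have h2 := one_sub_conj_mul_ne_zero ha (mem_ball_zero_iff.1 hw).le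
  have hc0 : c ≠ 0 := by rintro rfl; simp at hc
  have h3 : 1 - starRingEnd ℂ a * a ≠ 0 := one_sub_conj_mul_ne_zero ha ha.le
  rw [mobius, mobius, div_eq_div_iff h1 h2, mul_assoc, mul_assoc] at h
  have h4 := mul_left_cancel₀ hc0 h
  have h5 : (1 - starRingEnd ℂ a * a) * (z - w) = 0 := by linear_combination h4
  rcases mul_eq_zero.1 h5 with h6 | h6
  · exact absurd h6 h3
  · exact sub_eq_zero.1 h6

variable {M : Type*} [TopologicalSpace M] [ChartedSpace (EuclideanHalfSpace 4) M]
  [IsManifold (𝓡∂ 4) ∞ M] {𝒥 : AlmostComplexStructure M}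

theorem continuousOn_mobius (c : ℂ) (ha : ‖a‖ < 1) :
    ContinuousOn (mobius c a) (Metric.closedBall 0 1) := fun _ hz ↦
  (hasDerivAt_mobius c ha (mem_closedBall_zero_iff.1 hz)).continuousAt.continuousWithinAt

theorem contDiffOn_mobius (c : ℂ) (ha : ‖a‖ < 1) :
    ContDiffOn ℝ 1 (mobius c a) (Metric.ball 0 1) := by
  have h : DifferentiableOn ℂ (mobius c a) (Metric.ball 0 1) := fun z hz ↦
    (hasDerivAt_mobius c ha (mem_ball_zero_iff.1 hz).le).differentiableAt.differentiableWithinAt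
  exact (h.contDiffOn Metric.isOpen_ball).restrict_scalars ℝ

theorem fderiv_mobius (c : ℂ) (ha : ‖a‖ < 1) {z : ℂ} (hz : ‖z‖ ≤ 1) :
    HasFDerivAt (mobius c a) ((ContinuousLinearMap.toSpanSingleton ℂ
      (c * (1 - starRingEnd ℂ a * a) / (1 - starRingEnd ℂ a * z) ^ 2)).restrictScalars ℝ) z :=
  (hasDerivAt_mobius c ha hz).hasFDerivAt.restrictScalars ℝ

theorem mfderiv_comp_mobius {u : ℂ → M} (hu : IsJHolomorphicDisc 𝒥 u) (hc : ‖c‖ = 1) (ha : ‖a‖ < 1)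
    {z : ℂ} (hz : z ∈ Metric.ball (0 : ℂ) 1) (v : ℂ) :
    mfderiv 𝓘(ℝ, ℂ) (𝓡∂ 4) (fun z ↦ u (mobius c a z)) z v =
      mfderiv 𝓘(ℝ, ℂ) (𝓡∂ 4) u (mobius c a z)
        (v * (c * (1 - starRingEnd ℂ a * a) / (1 - starRingEnd ℂ a * z) ^ 2) : ℂ) := by
  have h1 := (hu.contMDiffAt (mobius_mem_ball hc ha hz)).mdifferentiableAt one_ne_zero
  have h2 := (fderiv_mobius c ha (mem_ball_zero_iff.1 hz).le)
  have h3 := mfderiv_comp z h1 h2.differentiableAt.mdifferentiableAt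
  rw [mfderiv_eq_fderiv, h2.fderiv] at h3
  exact congrArg (fun T ↦ T v) h3

theorem IsJHolomorphicDisc.comp_mobius {u : ℂ → M} (hu : IsJHolomorphicDisc 𝒥 u) (hc : ‖c‖ = 1)
    (ha : ‖a‖ < 1) : IsJHolomorphicDisc 𝒥 (fun z ↦ u (mobius c a z)) := by
  refine ⟨hu.1.comp (contDiffOn_mobius c ha).contMDiffOn
    fun _ hz ↦ mobius_mem_ball hc ha hz, fun z hz v ↦ ?_⟩
  rw [mfderiv_comp_mobius hu hc ha hz, mfderiv_comp_mobius hu hc ha hz, mul_assoc]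
  exact hu.2 _ (mobius_mem_ball hc ha hz) _

theorem IsBishopDisc.comp_mobius {S : Set M} {u : ℂ → M} (hu : IsBishopDisc 𝒥 S u) (hc : ‖c‖ = 1)
    (ha : ‖a‖ < 1) : IsBishopDisc 𝒥 S (fun z ↦ u (mobius c a z)) where
  continuousOn := hu.continuousOn.comp (continuousOn_mobius c ha) fun z hz ↦ by
    rw [← Metric.ball_union_sphere] at hz ⊢
    exact hz.imp (mobius_mem_ball hc ha) (mobius_mem_sphere hc ha)
  holomorphic := hu.holomorphic.comp_mobius hc ha
  boundary z hz := hu.boundary _ (mobius_mem_sphere hc ha hz)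

/-- Antisymmetry kills the diagonal terms and leaves the determinant of multiplication by m. -/
theorem form_smul_I {Ω : TameSymplecticForm 𝒥} {u : ℂ → M} {z : ℂ} (m : ℂ) :
    Ω.form (u z) (mfderiv 𝓘(ℝ, ℂ) (𝓡∂ 4) u z (1 * m : ℂ))
      (mfderiv 𝓘(ℝ, ℂ) (𝓡∂ 4) u z (Complex.I * m : ℂ)) =
    ‖m‖ ^ 2 * Ω.form (u z) (mfderiv 𝓘(ℝ, ℂ) (𝓡∂ 4) u z (1 : ℂ))
      (mfderiv 𝓘(ℝ, ℂ) (𝓡∂ 4) u z Complex.I) := by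
  set T : ℂ →L[ℝ] TangentSpace (𝓡∂ 4) (u z) := mfderiv 𝓘(ℝ, ℂ) (𝓡∂ 4) u z with hT
  have e1 : T (1 * m) = m.re • T 1 + m.im • T Complex.I := by
    rw [← map_smul, ← map_smul, ← map_add]
    congr 1
    simp [Complex.re_add_im]
  have e2 : T (Complex.I * m) = (-m.im) • T 1 + m.re • T Complex.I := by
    rw [← map_smul, ← map_smul, ← map_add]
    congr 1
    apply Complex.ext <;> simp
  have h1 : ∀ v, Ω.form (u z) v v = 0 := fun v ↦ by linarith [Ω.antisymm (u z) v v]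
  have h2 := Ω.antisymm (u z) (T Complex.I) (T 1)
  show Ω.form (u z) (T (1 * m)) (T (Complex.I * m)) =
    ‖m‖ ^ 2 * Ω.form (u z) (T 1) (T Complex.I)
  rw [e1, e2]
  simp only [map_add, map_smul, add_apply, smul_apply, smul_eq_mul, h1]
  rw [h2, ← Complex.normSq_eq_norm_sq, Complex.normSq_apply]
  ring

theorem det_restrictScalars_toSpanSingleton (m : ℂ) :
    ((ContinuousLinearMap.toSpanSingleton ℂ m).restrictScalars ℝ : ℂ →L[ℝ] ℂ).det = ‖m‖ ^ 2 := by
  have : (((ContinuousLinearMap.toSpanSingleton ℂ m).restrictScalars ℝ : ℂ →L[ℝ] ℂ) : ℂ →ₗ[ℝ] ℂ) =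
      Algebra.lmul ℝ ℂ m := by
    ext
    simp [mul_comm]
  rw [ContinuousLinearMap.det, this, ← Complex.normSq_eq_norm_sq, ← Algebra.norm_complex_apply]
  rfl

/-- A complex derivative m scales the area density by |m|², which is also its real Jacobian, so the
change of variables formula applies. That the image lies in the disc is enough for the inequality
needed. -/
theorem area_comp_mobius_le {Ω : TameSymplecticForm 𝒥} {u : ℂ → M} (hu : IsJHolomorphicDisc 𝒥 u)
    (hc : ‖c‖ = 1) (ha : ‖a‖ < 1) : area Ω (fun z ↦ u (mobius c a z)) ≤ area Ω u := by
  set e : ℂ → ENNReal := fun z ↦ ENNReal.ofReal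
    (Ω.form (u z) (mfderiv 𝓘(ℝ, ℂ) (𝓡∂ 4) u z (1 : ℂ))
      (mfderiv 𝓘(ℝ, ℂ) (𝓡∂ 4) u z Complex.I)) with he
  have h := lintegral_image_eq_lintegral_abs_det_fderiv_mul volume
    (Metric.isOpen_ball (x := (0 : ℂ)) (ε := 1)).measurableSet
    (fun z hz ↦ (fderiv_mobius c ha (mem_ball_zero_iff.1 hz).le).hasFDerivWithinAt)
    (injOn_mobius hc ha) e
  calc area Ω (fun z ↦ u (mobius c a z)) = ∫⁻ z in mobius c a '' Metric.ball 0 1, e z := by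
        rw [h, area]
        refine setLIntegral_congr_fun Metric.isOpen_ball.measurableSet fun z hz ↦ ?_
        simp only [he, det_restrictScalars_toSpanSingleton]
        rw [abs_of_nonneg (by positivity), ← ENNReal.ofReal_mul (by positivity),
          mfderiv_comp_mobius hu hc ha hz, mfderiv_comp_mobius hu hc ha hz]
        exact congrArg _ (form_smul_I _)
    _ ≤ ∫⁻ z in Metric.ball 0 1, e z :=
        lintegral_mono_set (image_subset_iff.2 fun z hz ↦ mobius_mem_ball hc ha hz)
    _ = area Ω u := rfl

end Mobius

/-- The arcs `𝔻 ∩ ∂B(ξ, s)` end on the unit circle. -/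
theorem exists_mem_closure_arc {ξ : ℂ} (hξ : ‖ξ‖ = 1) {s : ℝ} (hs : 0 < s) (hs2 : s < 2) :
    ∃ η ∈ Metric.sphere (0 : ℂ) 1, η ∈ Metric.sphere ξ s ∧
      η ∈ closure (Metric.ball (0 : ℂ) 1 ∩ Metric.sphere ξ s) := by
  -- The angle at which the circle of radius s around ξ meets the unit circle; smaller positive
  -- angles give points of the open disc.
  set θ := Real.arccos (s / 2) with hθ
  have hcos : Real.cos θ = s / 2 := Real.cos_arccos (by linarith) (by linarith)
  have hθ0 : 0 < θ := Real.arccos_pos.2 (by linarith)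
  set γ : ℝ → ℂ := fun τ ↦ ξ * (1 - s * Complex.exp (τ * Complex.I)) with hγ
  have hγc : Continuous γ := by simp only [hγ]; fun_prop
  have hsph : ∀ τ, γ τ ∈ Metric.sphere ξ s := fun τ ↦ by
    rw [mem_sphere_iff_norm]
    have : γ τ - ξ = -(ξ * (s * Complex.exp (τ * Complex.I))) := by simp only [hγ]; ring
    rw [this, norm_neg, norm_mul, norm_mul, hξ, Complex.norm_exp_ofReal_mul_I]
    simp [abs_of_pos hs]
  refine ⟨γ θ, ?_, hsph θ, ?_⟩
  · rw [mem_sphere_zero_iff_norm, hγ, norm_mul, hξ, one_mul]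
    have h1 : ‖1 - s * Complex.exp (θ * Complex.I)‖ ^ 2 = 1 := by
      rw [Complex.sq_norm, Complex.normSq_apply]
      simp only [Complex.sub_re, Complex.one_re, Complex.re_ofReal_mul, Complex.sub_im,
        Complex.one_im, Complex.im_ofReal_mul, Complex.exp_ofReal_mul_I_re,
        Complex.exp_ofReal_mul_I_im]
      have := Real.sin_sq_add_cos_sq θ
      rw [hcos] at this ⊢
      nlinarith
    exact (pow_eq_one_iff_of_nonneg (norm_nonneg _) two_ne_zero).1 h1
  · have hmem : θ ∈ closure (Ioo 0 θ) := by
      rw [closure_Ioo hθ0.ne]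
      exact right_mem_Icc.2 hθ0.le
    refine map_mem_closure hγc hmem fun τ hτ ↦ ⟨?_, hsph τ⟩
    rw [mem_ball_zero_iff, hγ, norm_mul, hξ, one_mul]
    refine norm_one_sub_polar_lt hs ?_
    rw [← hcos]
    exact Real.cos_lt_cos_of_nonneg_of_le_pi hτ.1.le (Real.arccos_le_pi _) hτ.2

theorem lt_two_of_mem_arc {ξ z : ℂ} (hξ : ‖ξ‖ = 1) {s : ℝ} (hz : z ∈ Metric.ball (0 : ℂ) 1)
    (hzs : z ∈ Metric.sphere ξ s) : s < 2 := by
  rw [mem_sphere_iff_norm] at hzs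
  rw [mem_ball_zero_iff] at hz
  linarith [norm_sub_le z ξ]

/-! ### Cut-off functions with a maximum principle. -/

section TestFunction

variable {M : Type*} [TopologicalSpace M] [ChartedSpace (EuclideanHalfSpace 4) M]
  [IsManifold (𝓡∂ 4) ∞ M] {𝒥 : AlmostComplexStructure M} {Ω : TameSymplecticForm 𝒥} {p : M}

/-- A cut-off function near `p`, the energy of whose composition with holomorphic discs is
controlled by the energy of the discs, and which holomorphic discs of small energy satisfy a
maximum principle for. -/
structure IsTestFunction (cm : ChartModel 𝒥 Ω p) (l : M → ℝ) (C : NNReal) (c : ENNReal) :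
    Prop where
  continuous : Continuous l
  pos : 0 < c
  contDiffOn : ∀ u : ℂ → M, IsJHolomorphicDisc 𝒥 u →
    ContDiffOn ℝ 1 (fun z ↦ l (u z)) (Metric.ball 0 1)
  fderiv_le : ∀ u : ℂ → M, IsJHolomorphicDisc 𝒥 u → ∀ z ∈ Metric.ball (0 : ℂ) 1,
    ‖fderiv ℝ (fun z ↦ l (u z)) z‖ₑ ^ 2 ≤ C * cm.density u z
  le_lintegral : ∀ u : ℂ → M, IsJHolomorphicDisc 𝒥 u → ∀ U : Set ℂ, IsOpen U →
    U ⊆ Metric.ball 0 1 → ∀ z₀ ∈ U, ∀ b : ℝ, 0 < b → b ≤ l (u z₀) →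
    (∀ ζ ∈ Metric.closedBall (0 : ℂ) 1, ζ ∉ U → ∀ᶠ z in 𝓝[U] ζ, l (u z) < b - 1 / 8) →
    c ≤ ∫⁻ z in U, cm.density u z

/-- A bump function in the chart. If it is at least b at u(z₀), uniform continuity keeps it above b
- 1/8 on a coordinate ball around u(z₀). Values below b - 1/8 near the frontier of U therefore make
the curve proper over this ball, and monotonicity yields the energy c. -/
theorem ChartModel.exists_isTestFunction [T2Space M] (cm : ChartModel 𝒥 Ω p) {N : Set M}
    (hN : N ∈ 𝓝 p) : ∃ (l : M → ℝ) (C : NNReal) (c : ENNReal) (r : ℝ), IsTestFunction cm l C c ∧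
      0 < r ∧ (∀ x ∈ chartBall p r, l x = 1) ∧ ∀ x ∉ N, l x = 0 := by
  obtain ⟨ρ₀, hρ₀, hsub⟩ := exists_chartBall_subset p hN
  have hr := cm.radius_pos
  set φ := extChartAt (𝓡∂ 4) p with hφ
  set ρ := min (ρ₀ / 2) (cm.radius / 4) with hρ
  have hρ0 : 0 < ρ := lt_min (by positivity) (by positivity)
  have hρ1 : ρ ≤ ρ₀ / 2 := min_le_left _ _
  have hρ2 : ρ ≤ cm.radius / 4 := min_le_right _ _
  let θ : ContDiffBump (φ p) := ⟨ρ / 2, ρ, by positivity, by linarith⟩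
  set ψ : E4 → ℝ := fun y ↦ θ y with hψ
  have hψc : ContDiff ℝ 1 ψ := θ.contDiff
  have hψ0 : ∀ y, ρ < ‖y - φ p‖ → ψ y = 0 := fun y hy ↦
    θ.zero_of_le_dist (by rw [dist_eq_norm]; exact hy.le)
  obtain ⟨C, hC⟩ := cm.exists_fderiv_chartLift_le (ψ := ψ) (ρ := ρ) (by linarith) hψ0 hψc
  obtain ⟨t₀, ht₀, c, hc, hmono⟩ := cm.exists_monotonicity
  have huc : UniformContinuous ψ := θ.hasCompactSupport.uniformContinuous_of_continuous hψc.continuous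
  obtain ⟨t₁, ht₁, hunif⟩ := Metric.uniformContinuous_iff.1 huc (1 / 8) (by norm_num)
  -- The bounds serve, in turn, monotonicity, the strict use of uniform continuity, and the
  -- inclusion of the ball of radius t around u(z₀) in the ball of half the chart radius, since ρ is
  -- at most a quarter of it.
  set t := min (min t₀ (t₁ / 2)) (cm.radius / 8) with ht
  have htpos : 0 < t := lt_min (lt_min ht₀ (by positivity)) (by positivity)
  have htt₀ : t ≤ t₀ := (min_le_left _ _).trans (min_le_left _ _)
  have htt₁ : t < t₁ := lt_of_le_of_lt ((min_le_left _ _).trans (min_le_right _ _)) (by linarith)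
  have htr : t ≤ cm.radius / 8 := min_le_right _ _
  refine ⟨chartLift p ψ, C, ENNReal.ofReal (c * t ^ 2), ρ / 2, ⟨?_, ?_, ?_, ?_, ?_⟩, by positivity,
    ?_, ?_⟩
  · exact continuous_chartLift cm (by linarith) hψ0 hψc.continuous
  · exact ENNReal.ofReal_pos.2 (by positivity)
  · exact fun u hu ↦ contDiffOn_chartLift_comp cm hu (by linarith) hψ0 hψc
  · exact hC
  · intro u hu U hU hUD z₀ hz₀ b hb hbl hfr
    have hmem : u z₀ ∈ chartClosedBall p ρ := by
      by_contra hnot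
      rw [chartLift_eq_zero hψ0 hnot] at hbl
      linarith
    refine (hmono u hu U hU hUD z₀ hz₀ t htpos htt₀
      (chartClosedBall_subset p (by linarith) hmem) fun ζ hζ hζU ↦ ?_).trans
      (lintegral_mono_set inter_subset_left)
    filter_upwards [hfr ζ hζ hζU] with z hz hnear
    have h1 : dist (φ (u z)) (φ (u z₀)) < t₁ := by
      rw [dist_eq_norm]; exact hnear.2.trans_lt htt₁
    have h2 := hunif h1
    rw [Real.dist_eq] at h2
    have e1 : chartLift p ψ (u z) = ψ (φ (u z)) := indicator_of_mem hnear.1 _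
    have e2 : chartLift p ψ (u z₀) = ψ (φ (u z₀)) := indicator_of_mem hmem.1 _
    rw [e1] at hz
    rw [e2] at hbl
    linarith [(abs_lt.1 h2).1]
  · intro x hx
    rw [chartLift, indicator_of_mem hx.1]
    exact θ.one_of_mem_closedBall (mem_closedBall_iff_norm.2 hx.2.le)
  · intro x hx
    refine chartLift_eq_zero hψ0 fun h ↦ hx (hsub ?_)
    exact chartClosedBall_subset p (by linarith) h

/-- Discs of small energy near `ξ` have arcs around `ξ` on which a test function is almost
constant. -/
theorem IsTestFunction.exists_arc {cm : ChartModel 𝒥 Ω p} {l : M → ℝ} {C : NNReal} {c : ENNReal}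
    (hl : IsTestFunction cm l C c) {u : ℂ → M} (hu : IsJHolomorphicDisc 𝒥 u) {ξ : ℂ}
    (hξ : ‖ξ‖ = 1) {ρ : ℝ} (hρ : 0 < ρ)
    (he : 16 * (C * ∫⁻ z in Metric.ball (0 : ℂ) 1 ∩ Metric.ball ξ ρ, cm.density u z) ≤
      ENNReal.ofReal (1 / 8) ^ 2) :
    ∃ s ∈ Ioo (ρ / 2) ρ, ∀ z ∈ Metric.ball (0 : ℂ) 1 ∩ Metric.sphere ξ s,
      ∀ z' ∈ Metric.ball (0 : ℂ) 1 ∩ Metric.sphere ξ s, |l (u z) - l (u z')| ≤ 1 / 8 := by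
  obtain ⟨s, hs, harc⟩ := exists_short_arc (hl.contDiffOn u hu) hξ hρ
  refine ⟨s, hs, fun z hz z' hz' ↦ ?_⟩
  have h1 := harc z hz z' hz'
  have h2 : ∫⁻ z in Metric.ball (0 : ℂ) 1 ∩ Metric.ball ξ ρ, ‖fderiv ℝ (fun z ↦ l (u z)) z‖ₑ ^ 2 ≤
      C * ∫⁻ z in Metric.ball (0 : ℂ) 1 ∩ Metric.ball ξ ρ, cm.density u z := by
    rw [← lintegral_const_mul' _ _ ENNReal.coe_ne_top]
    exact setLIntegral_mono' (Metric.isOpen_ball.inter Metric.isOpen_ball).measurableSet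
      fun z hz ↦ hl.fderiv_le u hu z hz.1
  have h3 : ‖l (u z) - l (u z')‖ₑ ^ 2 ≤ ENNReal.ofReal (1 / 8) ^ 2 :=
    h1.trans (le_trans (by gcongr) he)
  have h4 : ‖l (u z) - l (u z')‖ₑ ≤ ENNReal.ofReal (1 / 8) :=
    (ENNReal.pow_le_pow_left_iff two_ne_zero).1 h3
  rw [← ofReal_norm, ENNReal.ofReal_le_ofReal_iff (by norm_num)] at h4
  exact h4

end TestFunction

/-- Below ε both mechanisms work at once: the energy is less than the quantum c of the maximum
principle, and short arcs have oscillation at most 1/8. Dividing by C + 1 avoids the case C = 0. -/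
theorem exists_small_energy (C : NNReal) {c : ENNReal} (hc : 0 < c) :
    ∃ ε : ENNReal, 0 < ε ∧ ε < c ∧ 16 * (C * ε) ≤ ENNReal.ofReal (1 / 8) ^ 2 := by
  set q : ENNReal := ENNReal.ofReal (1 / 8) ^ 2 with hq
  have hq0 : q ≠ 0 := by
    have : 0 < ENNReal.ofReal (1 / 8) := ENNReal.ofReal_pos.2 (by norm_num)
    exact pow_ne_zero 2 this.ne'
  have hd : (16 * (C + 1) : ENNReal) ≠ ⊤ := by
    exact ENNReal.mul_ne_top (by norm_num) (by simp)
  obtain ⟨ε, hε0, hε⟩ := exists_between (lt_min hc (ENNReal.div_pos hq0 hd))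
  refine ⟨ε, hε0, hε.trans_le (min_le_left _ _), ?_⟩
  calc 16 * (C * ε) = (16 * C) * ε := by ring
    _ ≤ (16 * (C + 1)) * (q / (16 * (C + 1))) := by
        gcongr
        · exact le_self_add
        · exact hε.le.trans (min_le_right _ _)
    _ ≤ q := ENNReal.mul_div_le

/-- Sequences of densities of bounded mass concentrate at finitely many points only. -/
theorem finite_concentration {d : ℕ → ℂ → ENNReal} {D : Set ℂ} (hD : MeasurableSet D) {K ε : ENNReal}
    (hK : K ≠ ⊤) (hε : 0 < ε) (hd : ∀ k, ∫⁻ z in D, d k z ≤ K) :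
    {ξ : ℂ | ∀ ρ > 0, ∀ᶠ k in atTop, ε < ∫⁻ z in D ∩ Metric.ball ξ ρ, d k z}.Finite := by
  by_contra hinf
  obtain ⟨n, hn⟩ := ENNReal.exists_nat_mul_gt hε.ne' hK
  obtain ⟨T, hT, hTn⟩ := Set.Infinite.exists_subset_card_eq hinf n
  obtain ⟨V, hV, hdisj⟩ := T.finite_toSet.t2_separation
  have hρ : ∀ ξ, ∃ ρ > 0, Metric.ball ξ ρ ⊆ V ξ := fun ξ ↦
    Metric.isOpen_iff.1 (hV ξ).2 ξ (hV ξ).1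
  choose ρ hρ0 hρV using hρ
  have hev : ∀ᶠ k in atTop, ∀ ξ ∈ T, ε < ∫⁻ z in D ∩ Metric.ball ξ (ρ ξ), d k z :=
    (Filter.eventually_all_finset T).2 fun ξ hξ ↦ hT hξ (ρ ξ) (hρ0 ξ)
  obtain ⟨k, hk⟩ := hev.exists
  have hpd : (T : Set ℂ).PairwiseDisjoint fun ξ ↦ D ∩ Metric.ball ξ (ρ ξ) := fun x hx y hy hxy ↦
    (hdisj hx hy hxy).mono (inter_subset_right.trans (hρV x)) (inter_subset_right.trans (hρV y))
  have h1 : (n : ENNReal) * ε ≤ K := by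
    calc (n : ENNReal) * ε = ∑ ξ ∈ T, ε := by rw [Finset.sum_const, hTn, nsmul_eq_mul]
      _ ≤ ∑ ξ ∈ T, ∫⁻ z in D ∩ Metric.ball ξ (ρ ξ), d k z :=
          Finset.sum_le_sum fun ξ hξ ↦ (hk ξ hξ).le
      _ = ∫⁻ z in ⋃ ξ ∈ T, D ∩ Metric.ball ξ (ρ ξ), d k z :=
          (lintegral_biUnion_finset hpd (fun ξ _ ↦ hD.inter measurableSet_ball) _).symm
      _ ≤ ∫⁻ z in D, d k z := lintegral_mono_set (iUnion₂_subset fun ξ _ ↦ inter_subset_left)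
      _ ≤ K := hd k
  exact absurd h1 (not_le.2 hn)

/-- Absolute continuity of the integral, as the area of the ball tends to zero. -/
theorem exists_ball_lintegral_lt {d : ℂ → ENNReal} {D : Set ℂ} (hd : ∫⁻ z in D, d z ≠ ⊤) (ζ : ℂ)
    {ε : ENNReal} (hε : 0 < ε) :
    ∃ ρ₀ > 0, ∀ ρ ≤ ρ₀, ∫⁻ z in D ∩ Metric.ball ζ ρ, d z < ε := by
  obtain ⟨δ, hδ, h⟩ := exists_pos_setLIntegral_lt_of_measure_lt hd hε.ne'
  have hlim : Tendsto (fun ρ : ℝ ↦ ENNReal.ofReal (ρ ^ 2 * Real.pi)) (𝓝 0) (𝓝 0) := by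
    have : Continuous fun ρ : ℝ ↦ ENNReal.ofReal (ρ ^ 2 * Real.pi) :=
      ENNReal.continuous_ofReal.comp (by fun_prop)
    simpa using this.tendsto 0
  obtain ⟨ρ₀, hρ₀, hlt⟩ := Metric.eventually_nhds_iff.1 (hlim.eventually (gt_mem_nhds hδ))
  refine ⟨ρ₀ / 2, by positivity, fun ρ hρ ↦ ?_⟩
  have hv : volume (Metric.ball ζ (ρ₀ / 2)) < δ := by
    have h1 := hlt (y := ρ₀ / 2) (by rw [Real.dist_eq, sub_zero, abs_of_pos] <;> linarith)
    rw [Complex.volume_ball]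
    rw [ENNReal.ofReal_mul (by positivity), ENNReal.ofReal_pow (by positivity)] at h1
    convert h1 using 2
    rw [ENNReal.ofReal, NNReal.pi]
    congr 1
    ext
    simp [Real.pi_pos.le]
    rfl
  have h2 := h (Metric.ball ζ (ρ₀ / 2)) (lt_of_le_of_lt (Measure.restrict_apply_le _ _) hv)
  rw [Measure.restrict_restrict measurableSet_ball, inter_comm] at h2
  exact lt_of_le_of_lt (lintegral_mono_set (inter_subset_inter_right _
    (Metric.ball_subset_ball hρ))) h2

/-- Near the boundary the limit disc is close to `S`. -/
theorem eventually_mem_of_mapClusterPt_subset {M : Type*} [TopologicalSpace M] [CompactSpace M]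
    {S : Set M} {f : ℂ → M} {F : Filter ℂ}
    (h : ∀ p, MapClusterPt p F f → p ∈ S) {N : Set M} (hN : IsOpen N) (hSN : S ⊆ N) :
    ∀ᶠ z in F, f z ∈ N := by
  by_contra hnot
  rw [not_eventually] at hnot
  obtain ⟨p, hp, hcl⟩ := hN.isClosed_compl.isCompact.exists_mapClusterPt_of_frequently hnot
  exact hp (hSN (h p hcl))

/-! ### The cluster set is contained in S. -/

section Cluster

variable {M : Type*} [TopologicalSpace M] [ChartedSpace (EuclideanHalfSpace 4) M]
  [IsManifold (𝓡∂ 4) ∞ M] {𝒥 : AlmostComplexStructure M} {Ω : TameSymplecticForm 𝒥} {p : M}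
  {cm : ChartModel 𝒥 Ω p} {l : M → ℝ} {C : NNReal} {c ε : ENNReal} {S : Set M}

/-- Points farther than s from ξ are not limits of U; the eventual falsehood makes every frontier
condition there trivial. -/
theorem eventually_notMem_of_lt_dist {U : Set ℂ} {ξ ζ : ℂ} {s : ℝ} (hU : U ⊆ Metric.ball ξ s)
    (h : s < dist ζ ξ) : ∀ᶠ _ in 𝓝[U] ζ, False := by
  rw [eventually_nhdsWithin_iff]
  have : (Metric.closedBall ξ s)ᶜ ∈ 𝓝 ζ :=
    Metric.isClosed_closedBall.isOpen_compl.mem_nhds (by simpa using h)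
  filter_upwards [this] with z hz hzU
  exact hz (Metric.ball_subset_closedBall (hU hzU))

/-- A Bishop disc of small energy near `ξ ∈ ∂𝔻` stays away from `p ∉ S` near `ξ`. -/
theorem IsTestFunction.le_half_of_isBishopDisc (hl : IsTestFunction cm l C c)
    (hlS : ∀ x ∈ S, l x = 0) (hεc : ε < c) (hεC : 16 * (C * ε) ≤ ENNReal.ofReal (1 / 8) ^ 2)
    {g : ℂ → M} (hg : IsBishopDisc 𝒥 S g) {ξ : ℂ} (hξ : ‖ξ‖ = 1) {ρ : ℝ} (hρ : 0 < ρ)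
    (he : ∫⁻ z in Metric.ball (0 : ℂ) 1 ∩ Metric.ball ξ ρ, cm.density g z ≤ ε) {z₀ : ℂ}
    (hz₀ : z₀ ∈ Metric.ball (0 : ℂ) 1 ∩ Metric.ball ξ (ρ / 2)) : l (g z₀) ≤ 1 / 2 := by
  obtain ⟨s, hs, harc⟩ := hl.exists_arc hg.holomorphic hξ hρ (le_trans (by gcongr) hεC)
  have hs0 : 0 < s := lt_trans (by positivity) hs.1
  have hlg : ContinuousOn (fun z ↦ l (g z)) (Metric.closedBall 0 1) :=
    hl.continuous.comp_continuousOn hg.continuousOn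
  by_contra hgt
  rw [not_le] at hgt
  set U := Metric.ball (0 : ℂ) 1 ∩ Metric.ball ξ s with hU
  have hUo : IsOpen U := Metric.isOpen_ball.inter Metric.isOpen_ball
  have hUD : U ⊆ Metric.ball 0 1 := inter_subset_left
  have hc := hl.le_lintegral g hg.holomorphic U hUo hUD z₀
    ⟨hz₀.1, Metric.ball_subset_ball hs.1.le hz₀.2⟩ (1 / 2) (by norm_num) hgt.le ?_
  · have h2 : ∫⁻ z in U, cm.density g z ≤ ε :=
      (lintegral_mono_set (inter_subset_inter_right _ (Metric.ball_subset_ball hs.2.le))).trans he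
    exact absurd (hc.trans h2) (not_le.2 hεc)
  intro ζ hζ hζU
  have hfin : l (g ζ) < 1 / 2 - 1 / 8 → ∀ᶠ z in 𝓝[U] ζ, l (g z) < 1 / 2 - 1 / 8 := fun h ↦ by
    have h1 : Tendsto (fun z ↦ l (g z)) (𝓝[U] ζ) (𝓝 (l (g ζ))) :=
      (hlg ζ hζ).mono_left (nhdsWithin_mono _ (hUD.trans Metric.ball_subset_closedBall))
    exact h1.eventually (gt_mem_nhds h)
  rw [← Metric.ball_union_sphere] at hζ
  rcases hζ with hζb | hζs
  · rcases lt_trichotomy s (dist ζ ξ) with h | h | h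
    · exact (eventually_notMem_of_lt_dist (U := U) inter_subset_right h).mono fun _ h ↦ h.elim
    · have hζarc : ζ ∈ Metric.ball (0 : ℂ) 1 ∩ Metric.sphere ξ s := ⟨hζb, h.symm⟩
      obtain ⟨η, hη1, -, hηcl⟩ := exists_mem_closure_arc hξ hs0 (lt_two_of_mem_arc hξ hζb h.symm)
      have hη0 : l (g η) = 0 := hlS _ (hg.boundary η hη1)
      have h1 : ∀ᶠ z in 𝓝[Metric.closedBall 0 1] η, l (g z) < 1 / 8 := by
        refine (hlg η (Metric.sphere_subset_closedBall hη1)).eventually (gt_mem_nhds ?_)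
        simp only [hη0]; norm_num
      obtain ⟨z', hz', hlt⟩ := ((mem_closure_iff_frequently.1 hηcl).and_eventually
        (eventually_nhdsWithin_iff.1 h1)).exists
      have h2 := hlt (Metric.ball_subset_closedBall hz'.1)
      have h3 := harc ζ hζarc z' hz'
      refine hfin ?_
      linarith [(abs_le.1 h3).2]
    · exact absurd ⟨hζb, h⟩ hζU
  · refine hfin ?_
    rw [hlS _ (hg.boundary ζ hζs)]
    norm_num

variable {g : ℕ → ℂ → M} {f : ℂ → M} {B : Set ℂ}

/-- Off the points of concentration of energy, the limit stays away from `p` as well. -/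
theorem IsTestFunction.eventually_le_half (hl : IsTestFunction cm l C c)
    (hlS : ∀ x ∈ S, l x = 0) (hεc : ε < c) (hεC : 16 * (C * ε) ≤ ENNReal.ofReal (1 / 8) ^ 2)
    (hg : ∀ k, IsBishopDisc 𝒥 S (g k)) (hf : IsJHolomorphicDisc 𝒥 f) (hB : B.Finite)
    (hlim : ∀ z ∈ Metric.ball (0 : ℂ) 1 \ B, Tendsto (fun k ↦ g k z) atTop (𝓝 (f z)))
    {ξ : ℂ} (hξ : ‖ξ‖ = 1)
    (hbad : ¬ ∀ ρ > 0, ∀ᶠ k in atTop,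
      ε < ∫⁻ z in Metric.ball (0 : ℂ) 1 ∩ Metric.ball ξ ρ, cm.density (g k) z) :
    ∀ᶠ z in 𝓝[Metric.ball 0 1] ξ, l (f z) ≤ 1 / 2 := by
  push Not at hbad
  obtain ⟨ρ, hρ, hfreq⟩ := hbad
  rw [eventually_nhdsWithin_iff]
  filter_upwards [Metric.ball_mem_nhds ξ (half_pos hρ)] with z hz hzD
  have hoff : ∀ y ∈ Metric.ball (0 : ℂ) 1 ∩ Metric.ball ξ (ρ / 2), y ∉ B → l (f y) ≤ 1 / 2 := by
    intro y hy hyB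
    have h1 : Tendsto (fun k ↦ l (g k y)) atTop (𝓝 (l (f y))) :=
      (hl.continuous.tendsto _).comp (hlim y ⟨hy.1, hyB⟩)
    refine le_of_tendsto_of_frequently h1 (hfreq.mono fun k hk ↦ ?_)
    exact hl.le_half_of_isBishopDisc hlS hεc hεC (hg k) hξ hρ hk hy
  -- The inequality is known off B only; as B is finite and l ∘ f continuous, a violation at z would
  -- spread to nearby points outside B.
  by_contra hgt
  rw [not_le] at hgt
  have hcont : ContinuousAt (fun z ↦ l (f z)) z :=
    hl.continuous.continuousAt.comp (hf.continuousOn.continuousAt (Metric.isOpen_ball.mem_nhds hzD))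
  have hev : ∀ᶠ y in 𝓝 z, 1 / 2 < l (f y) ∧ y ∈ Metric.ball (0 : ℂ) 1 ∩ Metric.ball ξ (ρ / 2) :=
    (hcont.eventually (lt_mem_nhds hgt)).and
      ((Metric.isOpen_ball.inter Metric.isOpen_ball).mem_nhds ⟨hzD, hz⟩)
  have hBc : ∀ᶠ y in 𝓝[≠] z, y ∉ B := by
    have h1 : (B \ {z})ᶜ ∈ 𝓝 z := (hB.subset sdiff_subset).isClosed.isOpen_compl.mem_nhds (by simp)
    filter_upwards [mem_nhdsWithin_of_mem_nhds h1, self_mem_nhdsWithin] with y hy hyz hyB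
    exact hy ⟨hyB, hyz⟩
  obtain ⟨y, ⟨hy1, hy2⟩, hyB⟩ := ((hev.filter_mono nhdsWithin_le_nhds).and hBc).exists
  exact absurd (hoff y hy2 hyB) (not_le.2 hy1)

theorem ChartModel.exists_energy_le [T2Space M] (cm : ChartModel 𝒥 Ω p) :
    ∃ C : NNReal, ∀ u, IsJHolomorphicDisc 𝒥 u →
      ∫⁻ z in Metric.ball (0 : ℂ) 1, cm.density u z ≤ C * area Ω u := by
  obtain ⟨C, hC⟩ := cm.exists_density_le
  refine ⟨C, fun u hu ↦ ?_⟩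
  rw [area, ← lintegral_const_mul' _ _ ENNReal.coe_ne_top]
  exact setLIntegral_mono' measurableSet_ball fun z hz ↦ hC u hu z hz

/-- The limit disc has finite energy near every point. -/
theorem ChartModel.energy_ne_top [T2Space M] (cm : ChartModel 𝒥 Ω p)
    (hg : ∀ k, IsJHolomorphicDisc 𝒥 (g k)) (hf : IsJHolomorphicDisc 𝒥 f) (hB : B.Finite)
    (hlim : ∀ z ∈ Metric.ball (0 : ℂ) 1 \ B, Tendsto (fun k ↦ g k z) atTop (𝓝 (f z)))
    {A : NNReal} (hA : ∀ k, area Ω (g k) ≤ A) :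
    ∫⁻ z in Metric.ball (0 : ℂ) 1, cm.density f z ≠ ⊤ := by
  obtain ⟨C, hC⟩ := cm.exists_energy_le
  have hr := cm.radius_pos
  have h := lintegral_fderiv_le_of_tendsto (g := fun k z ↦ chartLift p cm.vec (g k z))
    (w := fun z ↦ chartLift p cm.vec (f z)) hB (K := C * A)
    (fun k ↦ contDiffOn_chartLift_comp cm (hg k) (by linarith) cm.vec_eq_zero cm.contDiff_vec)
    (contDiffOn_chartLift_comp cm hf (by linarith) cm.vec_eq_zero cm.contDiff_vec)
    (fun z hz ↦ ((continuous_chartLift cm (by linarith) cm.vec_eq_zero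
      cm.contDiff_vec.continuous).tendsto _).comp (hlim z hz))
    (fun k ↦ (hC (g k) (hg k)).trans (by gcongr; exact hA k))
  exact ne_top_of_le_ne_top (ENNReal.mul_ne_top ENNReal.coe_ne_top ENNReal.coe_ne_top) h

/-- The cluster set of the limit disc at boundary points lies in `S`. -/
theorem mem_of_mapClusterPt [T2Space M] (Ω : TameSymplecticForm 𝒥) (hS : IsClosed S)
    (hg : ∀ k, IsBishopDisc 𝒥 S (g k)) (hf : IsJHolomorphicDisc 𝒥 f) (hB : B.Finite)
    (hlim : ∀ z ∈ Metric.ball (0 : ℂ) 1 \ B, Tendsto (fun k ↦ g k z) atTop (𝓝 (f z)))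
    {A : NNReal} (hA : ∀ k, area Ω (g k) ≤ A) {ζ : ℂ} (hζ : ‖ζ‖ = 1) {p : M}
    (hp : MapClusterPt p (𝓝[Metric.ball 0 1] ζ) f) : p ∈ S := by
  by_contra hpS
  obtain ⟨cm⟩ := exists_chartModel 𝒥 Ω p
  obtain ⟨l, C, c, r, hl, hr, hl1, hlS⟩ := cm.exists_isTestFunction (hS.isOpen_compl.mem_nhds hpS)
  replace hlS : ∀ x ∈ S, l x = 0 := fun x hx ↦ hlS x (fun h ↦ h hx)
  obtain ⟨ε, hε, hεc, hεC⟩ := exists_small_energy C hl.pos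
  obtain ⟨C', hC'⟩ := cm.exists_energy_le
  have hbad := finite_concentration (d := fun k ↦ cm.density (g k)) (D := Metric.ball (0 : ℂ) 1)
    measurableSet_ball (K := C' * A) (ENNReal.mul_ne_top ENNReal.coe_ne_top ENNReal.coe_ne_top) hε
    (fun k ↦ (hC' (g k) (hg k).holomorphic).trans (by gcongr; exact hA k))
  set Bad := {ξ : ℂ | ∀ ρ > 0, ∀ᶠ k in atTop,
    ε < ∫⁻ z in Metric.ball (0 : ℂ) 1 ∩ Metric.ball ξ ρ, cm.density (g k) z} with hBad
  have hgood : ∀ η ∈ Metric.sphere (0 : ℂ) 1, η ∉ Bad →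
      ∀ᶠ z in 𝓝[Metric.ball 0 1] η, l (f z) ≤ 1 / 2 := fun η hη hηB ↦
    hl.eventually_le_half hlS hεc hεC hg hf hB hlim (mem_sphere_zero_iff_norm.1 hη) hηB
  obtain ⟨ρ₀, hρ₀, hen⟩ := exists_ball_lintegral_lt
    (cm.energy_ne_top (fun k ↦ (hg k).holomorphic) hf hB hlim hA) ζ hε
  -- Within this ball only ζ itself may be a point of concentration, so arcs around ζ end at good
  -- points.
  obtain ⟨ρ₁, hρ₁, hρ₁B⟩ : ∃ ρ₁ > 0, Metric.ball ζ ρ₁ ⊆ (Bad \ {ζ})ᶜ :=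
    Metric.isOpen_iff.1 (hbad.subset sdiff_subset).isClosed.isOpen_compl ζ (by simp)
  set ρ := min (min ρ₀ ρ₁) 1 with hρdef
  have hρ : 0 < ρ := lt_min (lt_min hρ₀ hρ₁) one_pos
  have hρρ₀ : ρ ≤ ρ₀ := (min_le_left _ _).trans (min_le_left _ _)
  have hρρ₁ : ρ ≤ ρ₁ := (min_le_left _ _).trans (min_le_right _ _)
  have hρ1 : ρ ≤ 1 := min_le_right _ _
  have hgood' : ∀ η ∈ Metric.sphere (0 : ℂ) 1, η ≠ ζ → dist η ζ < ρ →
      ∀ᶠ z in 𝓝[Metric.ball 0 1] η, l (f z) ≤ 1 / 2 := fun η hη hne hd ↦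
    hgood η hη fun hηB ↦ hρ₁B (Metric.mem_ball.2 (hd.trans_le hρρ₁)) ⟨hηB, hne⟩
  -- Near the end of the arc l ∘ f is at most 1/2, and it oscillates by at most 1/8 along the arc.
  have harc : ∀ ρ' ≤ ρ, 0 < ρ' → ∃ s ∈ Ioo (ρ' / 2) ρ',
      ∀ z ∈ Metric.ball (0 : ℂ) 1 ∩ Metric.sphere ζ s, l (f z) ≤ 5 / 8 := by
    intro ρ' hρ' hρ'0
    obtain ⟨s, hs, h⟩ := hl.exists_arc hf hζ hρ'0
      (le_trans (by gcongr; exact (hen ρ' (hρ'.trans hρρ₀)).le) hεC)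
    have hs0 : 0 < s := lt_trans (by positivity) hs.1
    refine ⟨s, hs, fun z hz ↦ ?_⟩
    obtain ⟨η, hη1, hη2, hηcl⟩ := exists_mem_closure_arc hζ hs0 (by linarith [hs.2])
    have h1 := hgood' η hη1 (by rintro rfl; simp at hη2; exact hs0.ne hη2)
      (by rw [Metric.mem_sphere.1 hη2]; linarith [hs.2])
    obtain ⟨z', hz', hle⟩ := ((mem_closure_iff_frequently.1 hηcl).and_eventually
      (eventually_nhdsWithin_iff.1 h1)).exists
    have h2 := hle hz'.1
    have h3 := h z hz z' hz'
    linarith [(abs_le.1 h3).2]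
  obtain ⟨s₁, hs₁, harc₁⟩ := harc ρ le_rfl hρ
  -- a point of the disc near `ζ` mapped close to `p`
  obtain ⟨z₀, hz₀, hz₀ζ, hz₀D⟩ : ∃ z, 7 / 8 < l (f z) ∧ z ∈ Metric.ball ζ (ρ / 2) ∧
      z ∈ Metric.ball (0 : ℂ) 1 := by
    have h1 : {x | 7 / 8 < l x} ∈ 𝓝 p :=
      hl.continuous.continuousAt.eventually (lt_mem_nhds (by
        rw [hl1 p (mem_chartBall_self p hr)]; norm_num))
    have h2 := hp.frequently h1
    have h3 : ∀ᶠ z in 𝓝[Metric.ball 0 1] ζ, z ∈ Metric.ball ζ (ρ / 2) :=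
      nhdsWithin_le_nhds (Metric.ball_mem_nhds ζ (half_pos hρ))
    obtain ⟨z, hz1, hz2, hz3⟩ := (h2.and_eventually (h3.and self_mem_nhdsWithin)).exists
    exact ⟨z, hz1, hz2, hz3⟩
  have hz₀ne : 0 < dist z₀ ζ := by
    rw [dist_pos]
    rintro rfl
    rw [mem_ball_zero_iff, hζ] at hz₀D
    exact lt_irrefl _ hz₀D
  -- A second arc, between ζ and z₀, cuts off a neighbourhood of ζ, where nothing is known about l ∘
  -- f.
  obtain ⟨s₂, hs₂, harc₂⟩ := harc (min ρ (dist z₀ ζ)) (min_le_left _ _) (lt_min hρ hz₀ne)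
  have hs₂0 : 0 < s₂ := lt_trans (half_pos (lt_min hρ hz₀ne)) hs₂.1
  have hs₂z : s₂ < dist z₀ ζ := hs₂.2.trans_le (min_le_right _ _)
  set U := Metric.ball (0 : ℂ) 1 ∩ Metric.ball ζ s₁ ∩ (Metric.closedBall ζ s₂)ᶜ with hU
  have hUo : IsOpen U := (Metric.isOpen_ball.inter Metric.isOpen_ball).inter
    Metric.isClosed_closedBall.isOpen_compl
  have hUD : U ⊆ Metric.ball 0 1 := inter_subset_left.trans inter_subset_left
  have hUs₁ : U ⊆ Metric.ball ζ s₁ := inter_subset_left.trans inter_subset_right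
  have hout : ∀ η, dist η ζ < s₂ → ∀ᶠ z in 𝓝[U] η, False := fun η hη ↦ by
    rw [eventually_nhdsWithin_iff]
    filter_upwards [Metric.isOpen_ball.mem_nhds (Metric.mem_ball.2 hη)] with z hz hzU
    exact hzU.2 (Metric.ball_subset_closedBall hz)
  -- The maximum principle at level 7/8 requires frontier values below 3/4; they are at most 5/8 on
  -- the arcs and at most 1/2 near the unit circle.
  have hc := hl.le_lintegral f hf U hUo hUD z₀
    ⟨⟨hz₀D, Metric.ball_subset_ball hs₁.1.le hz₀ζ⟩, by simpa using hs₂z⟩ (7 / 8) (by norm_num)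
    hz₀.le ?_
  · have h2 : ∫⁻ z in U, cm.density f z < ε := lt_of_le_of_lt
      (lintegral_mono_set (inter_subset_left.trans (inter_subset_inter_right _
        (Metric.ball_subset_ball hs₁.2.le)))) (hen ρ hρρ₀)
    exact absurd (hc.trans_lt h2) (not_lt.2 hεc.le)
  intro η hη hηU
  rw [← Metric.ball_union_sphere] at hη
  rcases lt_or_ge (dist η ζ) s₂ with h2 | h2
  · exact (hout η h2).mono fun _ h ↦ h.elim
  rcases lt_or_ge s₁ (dist η ζ) with h1 | h1
  · exact (eventually_notMem_of_lt_dist hUs₁ h1).mono fun _ h ↦ h.elim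
  rcases hη with hηb | hηs
  · have hcont : ContinuousAt (fun z ↦ l (f z)) η := hl.continuous.continuousAt.comp
      (hf.continuousOn.continuousAt (Metric.isOpen_ball.mem_nhds hηb))
    have hle : l (f η) ≤ 5 / 8 := by
      rcases h2.eq_or_lt with h2' | h2'
      · exact harc₂ η ⟨hηb, h2'.symm⟩
      rcases h1.eq_or_lt with h1' | h1'
      · exact harc₁ η ⟨hηb, h1'⟩
      · exact absurd ⟨⟨hηb, h1'⟩, by simpa using h2'⟩ hηU
    exact (hcont.eventually (gt_mem_nhds (by linarith))).filter_mono nhdsWithin_le_nhds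
  · have h := hgood' η hηs (by rintro rfl; simp at h2; linarith) (by linarith [hs₁.2])
    filter_upwards [nhdsWithin_mono _ hUD h] with z hz
    linarith

end Cluster

/-! ### Local coordinates at a totally real point. -/

open scoped RealInnerProductSpace

/-- The plane. -/
abbrev E2 : Type := EuclideanSpace ℝ (Fin 2)

/-- A totally real surface is locally the zero set of a map `β` such that `dβ` and a suitable linear
map `a` form complex coordinates at the base point. -/
theorem exists_totallyReal_coordinates {i : E2 → E4} {t₀ : E2} {D : E2 →L[ℝ] E4} {J : E4 →L[ℝ] E4}
    (hi : ContDiffAt ℝ 1 i t₀) (hD : HasFDerivAt i D t₀) (hJ : ∀ v, J (J v) = -v)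
    (hinj : Function.Injective D) (htr : ∀ v w, D w = J (D v) → v = 0) :
    ∃ (β : E4 → E2) (a : E4 →L[ℝ] E2), ContDiffAt ℝ 1 β (i t₀) ∧ (∀ᶠ t in 𝓝 t₀, β (i t) = 0) ∧
      ∀ v, v ≠ 0 → 0 < ⟪fderiv ℝ β (i t₀) (J v), a v⟫ - ⟪fderiv ℝ β (i t₀) v, a (J v)⟫ := by
  -- Total reality says that the tangent plane and its image under J meet only in 0, so T is
  -- injective, and bijective by dimension.
  set T : E2 × E2 →L[ℝ] E4 := D.comp (ContinuousLinearMap.fst ℝ E2 E2) +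
    (J.comp D).comp (ContinuousLinearMap.snd ℝ E2 E2) with hT
  have hTa : ∀ t w, T (t, w) = D t + J (D w) := fun t w ↦ rfl
  have hTinj : Function.Injective T := by
    rw [injective_iff_map_eq_zero]
    rintro ⟨t, w⟩ h
    rw [hTa] at h
    have h1 : D t = J (D (-w)) := by rw [map_neg, map_neg]; exact eq_neg_of_add_eq_zero_left h
    have h2 : w = 0 := neg_eq_zero.1 (htr _ _ h1)
    subst h2
    have h3 : D t = D 0 := by simpa using h1
    rw [hinj h3]; rfl
  let e : (E2 × E2) ≃L[ℝ] E4 := (LinearEquiv.ofInjectiveOfFinrankEq (T : E2 × E2 →ₗ[ℝ] E4) hTinj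
    (by simp)).toContinuousLinearEquiv
  have he : (e : E2 × E2 →L[ℝ] E4) = T := by
    refine ContinuousLinearMap.ext fun x ↦ ?_
    rfl
  have hea : ∀ x, e x = T x := fun x ↦ congrArg (fun S : E2 × E2 →L[ℝ] E4 ↦ S x) he
  -- A local diffeomorphism that carries the first plane to the surface. The map β is the second
  -- component of its inverse, and a is the first component of the inverse differential. In these
  -- linear coordinates J sends (t, w) to (-w, t), and the form becomes |t|² + |w|².
  set Φ : E2 × E2 → E4 := fun x ↦ i x.1 + J (D x.2) with hΦ
  have hΦ0 : Φ (t₀, 0) = i t₀ := by simp [hΦ]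
  have hΦc : ContDiffAt ℝ 1 Φ (t₀, 0) := by
    have h1 : ContDiffAt ℝ 1 (fun x : E2 × E2 ↦ i x.1) (t₀, 0) :=
      ContDiffAt.comp (t₀, (0 : E2)) (f := Prod.fst) hi contDiffAt_fst
    have h2 : ContDiff ℝ 1 (fun x : E2 × E2 ↦ J (D x.2)) := by fun_prop
    exact h1.add h2.contDiffAt
  have hΦd : HasFDerivAt Φ (e : E2 × E2 →L[ℝ] E4) (t₀, 0) := by
    rw [he]
    have h1 : HasFDerivAt (fun x : E2 × E2 ↦ i x.1) (D.comp (ContinuousLinearMap.fst ℝ E2 E2))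
        (t₀, (0 : E2)) := HasFDerivAt.comp (t₀, (0 : E2)) hD hasFDerivAt_fst
    exact h1.add ((J.comp D).comp (ContinuousLinearMap.snd ℝ E2 E2)).hasFDerivAt
  set Ψ := hΦc.localInverse hΦd one_ne_zero with hΨ
  have hst : HasStrictFDerivAt Φ (e : E2 × E2 →L[ℝ] E4) (t₀, 0) :=
    hΦc.hasStrictFDerivAt' hΦd one_ne_zero
  have hΨc : ContDiffAt ℝ 1 Ψ (i t₀) := by
    rw [← hΦ0]; exact hΦc.to_localInverse hΦd one_ne_zero
  have hΨd : HasFDerivAt Ψ (e.symm : E4 →L[ℝ] E2 × E2) (i t₀) := by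
    rw [← hΦ0]; exact hst.to_localInverse.hasFDerivAt
  have hleft : ∀ᶠ x in 𝓝 (t₀, (0 : E2)), Ψ (Φ x) = x := hst.eventually_left_inverse
  have hJe : ∀ v, e.symm (J v) = (-(e.symm v).2, (e.symm v).1) := fun v ↦ by
    rw [e.symm_apply_eq, hea, hTa]
    have h1 : v = D (e.symm v).1 + J (D (e.symm v).2) := by
      rw [← hTa, ← hea]; exact (e.apply_symm_apply v).symm
    conv_lhs => rw [h1]
    rw [map_add, hJ, map_neg, add_comm]
  refine ⟨fun y ↦ (Ψ y).2, (ContinuousLinearMap.fst ℝ E2 E2).comp (e.symm : E4 →L[ℝ] E2 × E2),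
    hΨc.snd, ?_, fun v hv ↦ ?_⟩
  · have h1 : Tendsto (fun t : E2 ↦ (t, (0 : E2))) (𝓝 t₀) (𝓝 (t₀, 0)) :=
      (by fun_prop : Continuous fun t : E2 ↦ (t, (0 : E2))).tendsto t₀
    filter_upwards [h1.eventually hleft] with t ht
    have h2 : Φ (t, 0) = i t := by simp [hΦ]
    rw [h2] at ht
    rw [ht]
  · have h2 : fderiv ℝ (fun y ↦ (Ψ y).2) (i t₀) =
        (ContinuousLinearMap.snd ℝ E2 E2).comp (e.symm : E4 →L[ℝ] E2 × E2) := hΨd.snd.fderiv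
    rw [h2]
    have e1 : ∀ v, ((ContinuousLinearMap.snd ℝ E2 E2).comp (e.symm : E4 →L[ℝ] E2 × E2)) v =
        (e.symm v).2 := fun v ↦ rfl
    have e2 : ∀ v, ((ContinuousLinearMap.fst ℝ E2 E2).comp (e.symm : E4 →L[ℝ] E2 × E2)) v =
        (e.symm v).1 := fun v ↦ rfl
    rw [e1, e2, e1, e2, hJe v]
    simp only [inner_neg_right, real_inner_self_eq_norm_sq, sub_neg_eq_add]
    have h3 : e.symm v ≠ 0 := by simpa using hv
    rcases Prod.mk_eq_zero.not.1 h3 |> not_and_or.1 with h4 | h4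
    · have : 0 < ‖(e.symm v).1‖ := norm_pos_iff.2 h4
      positivity
    · have : 0 < ‖(e.symm v).2‖ := norm_pos_iff.2 h4
      positivity

section RealModel

variable {M : Type*} [TopologicalSpace M] [ChartedSpace (EuclideanHalfSpace 4) M]
  [IsManifold (𝓡∂ 4) ∞ M] {𝒥 : AlmostComplexStructure M} {Ω : TameSymplecticForm 𝒥} {p : M}

/-- Coordinates at a totally real point `p` of `S`. -/
structure RealModel (cm : ChartModel 𝒥 Ω p) (S : Set M) where
  R : ℝ
  β : E4 → E2
  a : E4 →L[ℝ] E2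
  L : ℝ
  κ : ℝ
  R_pos : 0 < R
  R_le : R ≤ cm.radius / 2
  L_pos : 0 < L
  κ_pos : 0 < κ
  contDiffOn : ContDiffOn ℝ 1 β (Metric.ball (extChartAt (𝓡∂ 4) p p) R)
  norm_fderiv_le : ∀ y ∈ Metric.ball (extChartAt (𝓡∂ 4) p p) R, ‖fderiv ℝ β y‖ ≤ L
  zero : ∀ x ∈ S, x ∈ chartBall p R → β (extChartAt (𝓡∂ 4) p x) = 0
  norm_le : ∀ x ∈ chartBall p R, ∀ v, ‖v‖ ^ 2 ≤ κ *
    (⟪fderiv ℝ β (extChartAt (𝓡∂ 4) p x) (cm.Jc (extChartAt (𝓡∂ 4) p x) v), a v⟫ -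
      ⟪fderiv ℝ β (extChartAt (𝓡∂ 4) p x) v, a (cm.Jc (extChartAt (𝓡∂ 4) p x) v)⟫)

theorem ChartModel.continuousAt_Jc (cm : ChartModel 𝒥 Ω p) :
    ContinuousAt (fun x ↦ cm.Jc (extChartAt (𝓡∂ 4) p x)) p := by
  have hr := cm.radius_pos
  rw [ContinuousAt, tendsto_iff_norm_sub_tendsto_zero]
  have h1 : Tendsto (fun x ↦ cm.lip * ‖extChartAt (𝓡∂ 4) p x - extChartAt (𝓡∂ 4) p p‖) (𝓝 p)
      (𝓝 0) := by
    have h2 : ContinuousAt (fun x ↦ cm.lip * ‖extChartAt (𝓡∂ 4) p x - extChartAt (𝓡∂ 4) p p‖) p :=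
      (((continuousAt_extChartAt p).sub continuousAt_const).norm).const_mul _
    simpa using h2.tendsto
  refine squeeze_zero' (Eventually.of_forall fun x ↦ norm_nonneg _) ?_ h1
  filter_upwards [chartBall_mem_nhds p hr] with x hx
  exact cm.Jc_lip x hx p (mem_chartBall_self p hr)

/-- The linear algebra applies to the coordinate expression of ι and the matrix of J at the point.
Positivity of the form is an open condition, so it persists, with a uniform constant, on a small
ball. -/
theorem exists_realModel [T2Space M] {ι : Sphere2 → M} (hι : IsSphereInBoundary ι)
    {s₀ : Sphere2} (hs₀ : IsTotallyRealAt 𝒥 ι s₀) (cm : ChartModel 𝒥 Ω (ι s₀)) :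
    Nonempty (RealModel cm (range ι)) := by
  have hr := cm.radius_pos
  set φ := extChartAt (𝓡∂ 4) (ι s₀) with hφ
  set χ := extChartAt (𝓡 2) s₀ with hχ
  set i : E2 → E4 := writtenInExtChartAt (𝓡 2) (𝓡∂ 4) s₀ ι with hi
  set t₀ : E2 := χ s₀ with ht₀
  have hit₀ : i t₀ = φ (ι s₀) := by simp [hi, ht₀, hχ, hφ, writtenInExtChartAt]
  have hrange : range (𝓡 2) = univ := by simp
  have hic : ContDiffAt ℝ 1 i t₀ := by
    have h1 := (contMDiffAt_iff.1 ((hι.smooth s₀).of_le (m := 1) (by simp))).2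
    rw [hrange, contDiffWithinAt_univ] at h1
    exact h1
  set D : E2 →L[ℝ] E4 := mfderiv (𝓡 2) (𝓡∂ 4) ι s₀ with hDdef
  have hD : HasFDerivAt i D t₀ := by
    have h1 : D = fderiv ℝ i t₀ := by
      rw [hDdef, ((hι.smooth s₀).mdifferentiableAt (by simp)).mfderiv, hrange, fderivWithin_univ]
    rw [h1]
    exact (hic.differentiableAt one_ne_zero).hasFDerivAt
  set J : E4 →L[ℝ] E4 := cm.Jc (φ (ι s₀)) with hJ
  have hpm : (ι s₀) ∈ chartBall (ι s₀) cm.radius := mem_chartBall_self (ι s₀) hr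
  have hJsq : ∀ v, J (J v) = -v := cm.Jc_sq (ι s₀) hpm
  have hself : ∀ v : E4, chartDeriv (ι s₀) (ι s₀) v = v := fun v ↦ by
    have : IsManifold (𝓡∂ 4) 1 M := IsManifold.of_le (n := ∞) (by simp)
    rw [chartDeriv, mfderiv_extChartAt_self]; rfl
  have hJ𝒥 : ∀ v : E4, 𝒥.J (ι s₀) v = J v := fun v ↦ by
    have h1 := cm.Jc_comm (ι s₀) hpm v
    rw [hself v] at h1
    exact (hself _).symm.trans h1
  obtain ⟨β, a, hβc, hβ0, hpos⟩ := exists_totallyReal_coordinates hic hD hJsq (hι.immersion s₀)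
    (fun v w h ↦ hs₀ v w (h.trans (hJ𝒥 (D v)).symm))
  rw [hit₀] at hβc hpos
  -- positivity near `(ι s₀)`
  have hφc : ContinuousAt φ (ι s₀) := continuousAt_extChartAt (ι s₀)
  have hfβ : ContinuousAt (fderiv ℝ β) (φ (ι s₀)) :=
    (hβc.fderiv_right (m := 0) (by simp)).continuousAt
  have hfβφ : ContinuousAt (fun x ↦ fderiv ℝ β (φ x)) (ι s₀) := ContinuousAt.comp (f := φ) hfβ hφc
  have hJc := cm.continuousAt_Jc
  obtain ⟨κ, hκ, hκev⟩ := exists_norm_sq_le_of_posDef (E := E4) (x₀ := (ι s₀))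
    (Q := fun x v ↦ ⟪fderiv ℝ β (φ x) (cm.Jc (φ x) v), a v⟫ -
      ⟪fderiv ℝ β (φ x) v, a (cm.Jc (φ x) v)⟫) (fun v ↦ by
      have c1 : ContinuousAt (fun z : M × E4 ↦ fderiv ℝ β (φ z.1)) (ι s₀, v) := ContinuousAt.comp (f := Prod.fst) (x := (ι s₀, v)) hfβφ continuousAt_fst
      have c2 : ContinuousAt (fun z : M × E4 ↦ cm.Jc (φ z.1)) (ι s₀, v) := ContinuousAt.comp (f := Prod.fst) (x := (ι s₀, v)) hJc continuousAt_fst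
      have c3 : ContinuousAt (fun z : M × E4 ↦ z.2) (ι s₀, v) := continuousAt_snd
      exact ((c1.clm_apply (c2.clm_apply c3)).inner (𝕜 := ℝ) (a.continuous.continuousAt.comp c3)).sub
        ((c1.clm_apply c3).inner (𝕜 := ℝ) (a.continuous.continuousAt.comp (c2.clm_apply c3))))
    (fun x c v ↦ by
      simp only [map_smul, real_inner_smul_left, real_inner_smul_right]; ring) hpos
  -- the zero set
  have hemb := hι.smooth.continuous.isClosedEmbedding hι.injective
  have hzero : ∀ᶠ x in 𝓝 (ι s₀), x ∈ range ι → β (φ x) = 0 := by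
    have h1 : ∀ᶠ s in 𝓝 s₀, β (φ (ι s)) = 0 := by
      have h2 : Tendsto χ (𝓝 s₀) (𝓝 t₀) := continuousAt_extChartAt s₀
      filter_upwards [h2.eventually hβ0, (isOpen_extChartAt_source (I := 𝓡 2) s₀).mem_nhds
        (mem_extChartAt_source s₀)] with s hs hsrc
      have : i (χ s) = φ (ι s) := by
        simp only [hi, writtenInExtChartAt, Function.comp_apply]
        rw [(extChartAt (𝓡 2) s₀).left_inv hsrc]
      rwa [this] at hs
    rw [hemb.isInducing.nhds_eq_comap, eventually_comap] at h1
    filter_upwards [h1] with x hx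
    rintro ⟨s, rfl⟩
    exact hx s rfl
  obtain ⟨ρ₁, hρ₁, hsub₁⟩ := exists_chartBall_subset (ι s₀) (inter_mem hκev hzero)
  obtain ⟨ρ₂, hρ₂, hsub₂⟩ := Metric.eventually_nhds_iff_ball.1
    ((hβc.eventually (by simp)).and (hfβ.norm.eventually (gt_mem_nhds (lt_add_one _))))
  set R := min (min ρ₁ ρ₂) (cm.radius / 2) with hR
  have hR1 : R ≤ ρ₁ := (min_le_left _ _).trans (min_le_left _ _)
  have hR2 : R ≤ ρ₂ := (min_le_left _ _).trans (min_le_right _ _)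
  exact ⟨{
    R := R
    β := β
    a := a
    L := ‖fderiv ℝ β (φ (ι s₀))‖ + 1
    κ := κ
    R_pos := lt_min (lt_min hρ₁ hρ₂) (by positivity)
    R_le := min_le_right _ _
    L_pos := by positivity
    κ_pos := hκ
    contDiffOn := fun y hy ↦
      (hsub₂ y (Metric.ball_subset_ball hR2 hy)).1.contDiffWithinAt
    norm_fderiv_le := fun y hy ↦ (hsub₂ y (Metric.ball_subset_ball hR2 hy)).2.le
    zero := fun x hxS hx ↦ (hsub₁ (chartBall_mono (ι s₀) hR1 hx)).2 hxS
    norm_le := fun x hx v ↦ (hsub₁ (chartBall_mono (ι s₀) hR1 hx)).1 v }⟩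

end RealModel

/-! ### The reverse Poincaré inequality. -/

section Caccioppoli

open scoped RealInnerProductSpace

/-- The function is composed with n |β|²; the bound on x θ'(x) is invariant under scaling and hence
gives estimates uniform in n. -/
theorem exists_cutoff : ∃ (θ : ℝ → ℝ) (K : ℝ), ContDiff ℝ 1 θ ∧ 0 ≤ K ∧ (∀ x ≤ 1, θ x = 0) ∧
    (∀ x, 2 ≤ x → θ x = 1) ∧ (∀ x, 0 ≤ θ x) ∧ (∀ x, θ x ≤ 1) ∧ (∀ x, |x * deriv θ x| ≤ K) ∧
    (∀ x, x < 1 → deriv θ x = 0) ∧ ∀ x, 2 < x → deriv θ x = 0 := by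
  set θ : ℝ → ℝ := fun x ↦ Real.smoothTransition (x - 1) with hθ
  have hc : ContDiff ℝ 1 θ := Real.smoothTransition.contDiff.comp (contDiff_id.sub contDiff_const)
  have h0 : ∀ x ≤ 1, θ x = 0 := fun x hx ↦ Real.smoothTransition.zero_of_nonpos (by linarith)
  have h1 : ∀ x, 2 ≤ x → θ x = 1 := fun x hx ↦ Real.smoothTransition.one_of_one_le (by linarith)
  have d0 : ∀ x, x < 1 → deriv θ x = 0 := fun x hx ↦ by
    have : θ =ᶠ[𝓝 x] fun _ ↦ 0 := by
      filter_upwards [gt_mem_nhds hx] with y hy using h0 y hy.le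
    rw [this.deriv_eq, deriv_const]
  have d1 : ∀ x, 2 < x → deriv θ x = 0 := fun x hx ↦ by
    have : θ =ᶠ[𝓝 x] fun _ ↦ 1 := by
      filter_upwards [lt_mem_nhds hx] with y hy using h1 y hy.le
    rw [this.deriv_eq, deriv_const]
  have hdc : Continuous (deriv θ) := hc.continuous_deriv le_rfl
  obtain ⟨K, hK⟩ := (isCompact_Icc (a := (1 : ℝ)) (b := 2)).exists_bound_of_continuousOn
    (f := fun x ↦ x * deriv θ x) (by fun_prop)
  have hK0 : 0 ≤ K := (norm_nonneg _).trans (hK 1 (by norm_num))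
  refine ⟨θ, K, hc, hK0, h0, h1, fun x ↦ Real.smoothTransition.nonneg _,
    fun x ↦ Real.smoothTransition.le_one _, fun x ↦ ?_, d0, d1⟩
  rcases lt_or_ge x 1 with hx | hx
  · simp [d0 x hx, hK0]
  rcases lt_or_ge 2 x with hx' | hx'
  · simp [d1 x hx', hK0]
  · exact hK x ⟨hx, hx'⟩

variable {E F : Type*} [NormedAddCommGroup E] [InnerProductSpace ℝ E] [NormedAddCommGroup F]
  [InnerProductSpace ℝ F] {Jc : E → E →L[ℝ] E} {Λ L L' : ℝ} {W : Set ℂ} {u : ℂ → E}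

/-- A reverse Poincaré inequality for a holomorphic curve with boundary on the zero set of `β`. -/
theorem IsJCurveOn.caccioppoli (hu : IsJCurveOn Jc Λ L' W u) (hΛ : 0 ≤ Λ) {y₀ : E} {R ρ : ℝ}
    (huR : ∀ z ∈ W, u z ∈ Metric.ball y₀ R) {β : E → F} {a : E →L[ℝ] F} {κ : ℝ} (hL : 0 ≤ L)
    (hκ : 0 < κ) (hβ : ContDiffOn ℝ 1 β (Metric.ball y₀ R))
    (hβL : ∀ y ∈ Metric.ball y₀ R, ‖fderiv ℝ β y‖ ≤ L)
    (hpos : ∀ z ∈ W, ∀ v, ‖v‖ ^ 2 ≤ κ * (⟪fderiv ℝ β (u z) (Jc (u z) v), a v⟫ -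
      ⟪fderiv ℝ β (u z) v, a (Jc (u z) v)⟫))
    {η : E → ℝ} (hη : ContDiff ℝ 1 η) (hη0 : ∀ y, 0 ≤ η y) (hη1 : ∀ y, η y ≤ 1) {Kη : ℝ}
    (hηK : ∀ y, ‖fderiv ℝ η y‖ ≤ Kη)
    (hηρ : ∀ y, ρ ≤ ‖y - y₀‖ → η y = 0 ∧ fderiv ℝ η y = 0)
    (hcpt : ∀ δ > 0, IsCompact {z | z ∈ W ∧ ‖u z - y₀‖ ≤ ρ ∧ δ ≤ ‖β (u z)‖ ^ 2})
    (hint : IntegrableOn (fun z ↦ ‖fderiv ℝ u z 1‖ ^ 2) W) {b : ℝ} (hb0 : 0 ≤ b)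
    (hb : ∀ z ∈ W, ‖u z - y₀‖ < ρ → ‖β (u z)‖ ≤ b) :
    ∫ z in {z | z ∈ W ∧ β (u z) ≠ 0}, η (u z) * ‖fderiv ℝ u z 1‖ ^ 2 ≤
      κ * (2 * Λ * ‖a‖ * Kη * b) *
        ∫ z in {z | z ∈ W ∧ ‖u z - y₀‖ < ρ ∧ β (u z) ≠ 0}, ‖fderiv ℝ u z 1‖ ^ 2 := by
  obtain ⟨θ, Kθ, hθc, hKθ, hθ0, hθ1, hθnn, hθle, hθK, hθd0, hθd1⟩ := exists_cutoff
  have hW := hu.isOpen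
  have hcu : ContinuousOn u W := hu.contDiffOn.continuousOn
  have hcv := hu.continuousOn_fderiv 1
  have hKη : 0 ≤ Kη := (norm_nonneg _).trans (hηK y₀)
  set γ : ℂ → F := fun z ↦ β (u z) with hγ
  have hγd : ContDiffOn ℝ 1 γ W := hβ.comp hu.contDiffOn huR
  have hγc : ContinuousOn γ W := hγd.continuousOn
  have hηd : ContDiffOn ℝ 1 (fun z ↦ η (u z)) W := hη.comp_contDiffOn hu.contDiffOn
  -- A cut-off that vanishes near β = 0. It makes the support of the test map Φ compact by `hcpt`,
  -- so that Stokes' theorem has no boundary term although u need not extend to the boundary.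
  set ψ : ℕ → ℂ → ℝ := fun n z ↦ θ (n * ‖γ z‖ ^ 2) with hψ
  have hψd : ∀ n, ContDiffOn ℝ 1 (ψ n) W := fun n ↦
    hθc.comp_contDiffOn (contDiffOn_const.mul (hγd.norm_sq ℝ))
  set Φ : ℕ → ℂ → F := fun n z ↦ (η (u z) * ψ n z) • γ z with hΦ
  have hΦd : ∀ n, ContDiffOn ℝ 1 (Φ n) W := fun n ↦ (hηd.mul (hψd n)).smul hγd
  have hfγ : ∀ z ∈ W, HasFDerivAt γ ((fderiv ℝ β (u z)).comp (fderiv ℝ u z)) z := fun z hz ↦ by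
    have h1 : DifferentiableAt ℝ β (u z) :=
      (hβ.contDiffAt (Metric.isOpen_ball.mem_nhds (huR z hz))).differentiableAt one_ne_zero
    exact h1.hasFDerivAt.comp z (hu.differentiableAt hz).hasFDerivAt
  have hfΦ : ∀ n, ∀ z ∈ W, ∀ h, fderiv ℝ (Φ n) z h =
      (η (u z) * ψ n z) • fderiv ℝ β (u z) (fderiv ℝ u z h) +
      (η (u z) * (deriv θ (n * ‖γ z‖ ^ 2) * (n * (2 * ⟪γ z, fderiv ℝ β (u z) (fderiv ℝ u z h)⟫))) +
        ψ n z * fderiv ℝ η (u z) (fderiv ℝ u z h)) • γ z := fun n z hz h ↦ by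
    have h1 : HasFDerivAt (fun z ↦ η (u z)) ((fderiv ℝ η (u z)).comp (fderiv ℝ u z)) z :=
      (hη.differentiable one_ne_zero _).hasFDerivAt.comp z (hu.differentiableAt hz).hasFDerivAt
    have h2 := (hfγ z hz).norm_sq.const_mul (n : ℝ)
    have h3 : HasFDerivAt (ψ n) _ z :=
      (hθc.differentiable one_ne_zero _).hasDerivAt.comp_hasFDerivAt z h2
    have h4 := (h1.mul h3).smul (hfγ z hz)
    have h5 : fderiv ℝ (Φ n) z = _ := h4.fderiv
    rw [h5]
    simp [smul_eq_mul]
  set Kn : ℕ → Set ℂ := fun n ↦ {z | z ∈ W ∧ ‖u z - y₀‖ ≤ ρ ∧ 1 / (n + 1 : ℝ) ≤ ‖β (u z)‖ ^ 2}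
    with hKn
  have hKnW : ∀ n, Kn n ⊆ W := fun n z hz ↦ hz.1
  have hψ0 : ∀ (n : ℕ) (z : ℂ), ‖γ z‖ ^ 2 < 1 / (n + 1 : ℝ) →
      ψ n z = 0 ∧ deriv θ (n * ‖γ z‖ ^ 2) = 0 := fun n z hz ↦ by
    have h1 : n * ‖γ z‖ ^ 2 < 1 := by
      rw [lt_div_iff₀ (by positivity)] at hz
      nlinarith [sq_nonneg ‖γ z‖]
    exact ⟨hθ0 _ h1.le, hθd0 _ h1⟩
  have hoff : ∀ n, ∀ z ∈ W, z ∉ Kn n → (η (u z) = 0 ∧ fderiv ℝ η (u z) = 0) ∨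
      (ψ n z = 0 ∧ deriv θ (n * ‖γ z‖ ^ 2) = 0) := fun n z hz hzK ↦ by
    by_cases h1 : ‖u z - y₀‖ ≤ ρ
    · right
      exact hψ0 n z (not_le.1 fun h2 ↦ hzK ⟨hz, h1, h2⟩)
    · left
      exact hηρ _ (not_le.1 h1).le
  have hΦ0 : ∀ n, ∀ z ∈ W, z ∉ Kn n → Φ n z = 0 := fun n z hz hzK ↦ by
    rcases hoff n z hz hzK with h | h <;> simp [hΦ, h.1]
  have hΦ'0 : ∀ n, ∀ z ∈ W, z ∉ Kn n → ∀ h, fderiv ℝ (Φ n) z h = 0 := fun n z hz hzK h ↦ by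
    rw [hfΦ n z hz h]
    rcases hoff n z hz hzK with h | h <;> simp [h.1, h.2]
  have hcΦ : ∀ n h, ContinuousOn (fun z ↦ fderiv ℝ (Φ n) z h) W := fun n h ↦
    ((hΦd n).continuousOn_fderiv_of_isOpen hW le_rfl).clm_apply continuousOn_const
  have hau : ∀ z ∈ W, ∀ h, fderiv ℝ (fun z ↦ a (u z)) z h = a (fderiv ℝ u z h) := fun z hz h ↦ by
    have e3 : fderiv ℝ (fun z ↦ a (u z)) z = _ :=
      (a.hasFDerivAt.comp z (hu.differentiableAt hz).hasFDerivAt).fderiv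
    rw [e3]; rfl
  have hi : ∀ n h k, IntegrableOn (fun z ↦ ⟪fderiv ℝ (Φ n) z h, a (fderiv ℝ u z k)⟫) W :=
    fun n h k ↦ by
    refine integrableOn_of_eq_zero_off_compact hW (hcpt (1 / (n + 1 : ℝ)) (by positivity)) (hKnW n)
      ?_ fun z hz hzK ↦ by simp [hΦ'0 n z hz hzK]
    have := hcΦ n h
    have := hu.continuousOn_fderiv k
    fun_prop
  set I : ℕ → ℂ → ℝ := fun n z ↦ ⟪fderiv ℝ (Φ n) z 1, a (fderiv ℝ u z Complex.I)⟫ -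
    ⟪fderiv ℝ (Φ n) z Complex.I, a (fderiv ℝ u z 1)⟫ with hIdef
  have hIint : ∀ n, IntegrableOn (I n) W := fun n ↦ (hi n 1 Complex.I).sub (hi n Complex.I 1)
  have hI0 : ∀ n, ∫ z in W, I n z = 0 := fun n ↦ by
    have st := setIntegral_inner_fderiv_comm hW (hcpt (1 / (n + 1 : ℝ)) (by positivity)) (hKnW n)
      (hΦd n) (hΦ0 n) (a.contDiff.comp_contDiffOn hu.contDiffOn) 1 Complex.I
    rw [setIntegral_congr_fun hW.measurableSet
      (g := fun z ↦ ⟪fderiv ℝ (Φ n) z 1, a (fderiv ℝ u z Complex.I)⟫)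
      (fun z hz ↦ by
        show ⟪fderiv ℝ (Φ n) z 1, fderiv ℝ (fun z ↦ a (u z)) z Complex.I⟫ = _
        simp only [hau z hz])] at st
    rw [setIntegral_congr_fun hW.measurableSet
      (f := fun z ↦ ⟪fderiv ℝ (Φ n) z Complex.I, fderiv ℝ (a ∘ u) z 1⟫)
      (g := fun z ↦ ⟪fderiv ℝ (Φ n) z Complex.I, a (fderiv ℝ u z 1)⟫)
      (fun z hz ↦ by
        show ⟪fderiv ℝ (Φ n) z Complex.I, fderiv ℝ (fun z ↦ a (u z)) z 1⟫ = _
        simp only [hau z hz])] at st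
    simp only [hIdef]
    rw [integral_sub (hi n 1 Complex.I) (hi n Complex.I 1), st, sub_self]
  -- the pointwise bound
  set A : Set ℂ := {z | z ∈ W ∧ ‖u z - y₀‖ < ρ} with hA
  have hAo : IsOpen A :=
    (by fun_prop : ContinuousOn (fun z ↦ ‖u z - y₀‖) W).isOpen_inter_preimage hW isOpen_Iio
  set q : ℝ := 2 * Λ * ‖a‖ * Kη * b with hq
  have hq0 : 0 ≤ q := by positivity
  set m : ℂ → ℝ := fun z ↦ ‖fderiv ℝ u z 1‖ ^ 2 with hm
  have hm0 : ∀ z, 0 ≤ m z := fun z ↦ by simp only [hm]; positivity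
  set H : ℕ → ℂ → ℝ := fun n z ↦
    ψ n z * ((-(η (u z) / κ) + A.indicator (fun _ ↦ q) z) * m z) +
      4 * L * Λ * ‖a‖ * |(n * ‖γ z‖ ^ 2) * deriv θ (n * ‖γ z‖ ^ 2)| * m z with hHdef
  have hIH : ∀ n, ∀ z ∈ W, I n z ≤ H n z := fun n z hz ↦ by
    set v := fderiv ℝ u z 1 with hv
    set T := fderiv ℝ β (u z) with hT
    have hw : fderiv ℝ u z Complex.I = Jc (u z) v := hu.fderiv_I z hz
    set w := Jc (u z) v with hwdef
    have hwn : ‖w‖ ≤ Λ * ‖v‖ := ContinuousLinearMap.le_of_opNorm_le _ (hu.norm_le z hz) _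
    have hTn : ∀ x, ‖T x‖ ≤ L * ‖x‖ := fun x ↦
      ContinuousLinearMap.le_of_opNorm_le _ (hβL _ (huR z hz)) _
    have han : ∀ x, ‖a x‖ ≤ ‖a‖ * ‖x‖ := fun x ↦ a.le_opNorm x
    have hηn : ∀ x, ‖fderiv ℝ η (u z) x‖ ≤ Kη * ‖x‖ := fun x ↦
      ContinuousLinearMap.le_of_opNorm_le _ (hηK _) _
    have hP := hpos z hz v
    set s := ‖γ z‖ with hs
    set dθ := deriv θ (n * s ^ 2) with hdθ
    have hIexp : I n z = -(η (u z) * ψ n z * (⟪T w, a v⟫ - ⟪T v, a w⟫)) +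
        2 * η (u z) * (dθ * n) * (⟪γ z, T v⟫ * ⟪γ z, a w⟫ - ⟪γ z, T w⟫ * ⟪γ z, a v⟫) +
        ψ n z * (fderiv ℝ η (u z) v * ⟪γ z, a w⟫ - fderiv ℝ η (u z) w * ⟪γ z, a v⟫) := by
      simp only [hIdef]
      rw [hfΦ n z hz, hfΦ n z hz, hw, ← hv, ← hT]
      simp only [inner_add_left, real_inner_smul_left]
      ring
    have hmz : m z = ‖v‖ ^ 2 := rfl
    have b1 : -(η (u z) * ψ n z * (⟪T w, a v⟫ - ⟪T v, a w⟫)) ≤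
        -(ψ n z * (η (u z) / κ * m z)) := by
      rw [neg_le_neg_iff]
      have : ‖v‖ ^ 2 / κ ≤ ⟪T w, a v⟫ - ⟪T v, a w⟫ := by
        rw [div_le_iff₀ hκ]; linarith
      have h0 : 0 ≤ η (u z) * ψ n z := mul_nonneg (hη0 _) (hθnn _)
      calc ψ n z * (η (u z) / κ * m z) = η (u z) * ψ n z * (‖v‖ ^ 2 / κ) := by rw [hmz]; ring
        _ ≤ _ := mul_le_mul_of_nonneg_left this h0
    have hin : ∀ x, |⟪γ z, a x⟫| ≤ s * (‖a‖ * ‖x‖) := fun x ↦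
      (abs_real_inner_le_norm _ _).trans (mul_le_mul_of_nonneg_left (han x) (norm_nonneg _))
    have hiT : ∀ x, |⟪γ z, T x⟫| ≤ s * (L * ‖x‖) := fun x ↦
      (abs_real_inner_le_norm _ _).trans (mul_le_mul_of_nonneg_left (hTn x) (norm_nonneg _))
    have hs0 : 0 ≤ s := norm_nonneg _
    -- The terms with the derivative of ψ: the two factors γ combine with n to n |γ|² θ'(n |γ|²),
    -- which is bounded independently of n.
    have b2 : 2 * η (u z) * (dθ * n) * (⟪γ z, T v⟫ * ⟪γ z, a w⟫ - ⟪γ z, T w⟫ * ⟪γ z, a v⟫) ≤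
        4 * L * Λ * ‖a‖ * |(n * s ^ 2) * dθ| * m z := by
      have c1 : |⟪γ z, T v⟫ * ⟪γ z, a w⟫ - ⟪γ z, T w⟫ * ⟪γ z, a v⟫| ≤
          2 * L * Λ * ‖a‖ * (s ^ 2 * ‖v‖ ^ 2) := by
        refine (abs_sub _ _).trans ?_
        rw [abs_mul, abs_mul]
        calc _ ≤ (s * (L * ‖v‖)) * (s * (‖a‖ * ‖w‖)) + (s * (L * ‖w‖)) * (s * (‖a‖ * ‖v‖)) := by
              gcongr
              exacts [hiT v, hin w, hiT w, hin v]
          _ ≤ (s * (L * ‖v‖)) * (s * (‖a‖ * (Λ * ‖v‖))) +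
              (s * (L * (Λ * ‖v‖))) * (s * (‖a‖ * ‖v‖)) := by gcongr
          _ = _ := by ring
      refine (le_abs_self _).trans ?_
      rw [abs_mul, abs_mul, abs_mul, abs_of_nonneg (hη0 (u z)), abs_two]
      have c2 : |(n * s ^ 2) * dθ| = |dθ * n| * s ^ 2 := by
        rw [show (n * s ^ 2) * dθ = (dθ * n) * s ^ 2 by ring, abs_mul, abs_of_nonneg (sq_nonneg s)]
      rw [c2, hmz]
      calc _ ≤ 2 * 1 * |dθ * n| * (2 * L * Λ * ‖a‖ * (s ^ 2 * ‖v‖ ^ 2)) := by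
            gcongr
            exact hη1 _
        _ = _ := by ring
    have b3 : ψ n z * (fderiv ℝ η (u z) v * ⟪γ z, a w⟫ - fderiv ℝ η (u z) w * ⟪γ z, a v⟫) ≤
        ψ n z * (A.indicator (fun _ ↦ q) z * m z) := by
      refine mul_le_mul_of_nonneg_left ?_ (hθnn _)
      by_cases hzA : z ∈ A
      · rw [indicator_of_mem hzA]
        have hsb : s ≤ b := hb z hz hzA.2
        refine (le_abs_self _).trans ((abs_sub _ _).trans ?_)
        rw [abs_mul, abs_mul]
        calc _ ≤ (Kη * ‖v‖) * (s * (‖a‖ * ‖w‖)) + (Kη * ‖w‖) * (s * (‖a‖ * ‖v‖)) := by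
              gcongr
              exacts [hηn v, hin w, hηn w, hin v]
          _ ≤ (Kη * ‖v‖) * (b * (‖a‖ * (Λ * ‖v‖))) + (Kη * (Λ * ‖v‖)) * (b * (‖a‖ * ‖v‖)) := by
              gcongr
          _ = q * m z := by rw [hq, hmz]; ring
      · have h0 := (hηρ (u z) (not_lt.1 fun h ↦ hzA ⟨hz, h⟩)).2
        rw [indicator_of_notMem hzA, h0]
        simp
    rw [hIexp]
    simp only [hHdef]
    linarith
  -- passage to the limit
  set Z : Set ℂ := {z | z ∈ W ∧ β (u z) ≠ 0} with hZ
  have hZo : IsOpen Z := hγc.isOpen_inter_preimage hW isOpen_compl_singleton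
  set G : ℂ → ℝ := Z.indicator fun z ↦ (-(η (u z) / κ) + A.indicator (fun _ ↦ q) z) * m z with hG
  have hmc : ContinuousOn m W := hcv.norm.pow 2
  have hηc : ContinuousOn (fun z ↦ η (u z)) W := hηd.continuousOn
  have hind : Measurable (A.indicator fun _ ↦ q) := measurable_const.indicator hAo.measurableSet
  have hHm : ∀ n, AEStronglyMeasurable (H n) (volume.restrict W) := fun n ↦ by
    have m1 := ((hψd n).continuousOn).aestronglyMeasurable (μ := volume) hW.measurableSet
    have m2 := hηc.aestronglyMeasurable (μ := volume) hW.measurableSet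
    have m3 := hmc.aestronglyMeasurable (μ := volume) hW.measurableSet
    have m4 : AEStronglyMeasurable (fun z ↦ |(n * ‖γ z‖ ^ 2) * deriv θ (n * ‖γ z‖ ^ 2)|)
        (volume.restrict W) := by
      refine ContinuousOn.aestronglyMeasurable ?_ hW.measurableSet
      have : Continuous (deriv θ) := hθc.continuous_deriv le_rfl
      fun_prop
    exact (m1.mul (((m2.mul_const κ⁻¹).neg.add hind.aestronglyMeasurable).mul m3)).add
      ((m4.const_mul _).mul m3)
  have hbound : ∀ n, ∀ z, |H n z| ≤ (1 / κ + q + 4 * L * Λ * ‖a‖ * Kθ) * m z := fun n z ↦ by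
    have c1 : |-(η (u z) / κ) + A.indicator (fun _ ↦ q) z| ≤ 1 / κ + q := by
      refine (abs_add_le _ _).trans (add_le_add ?_ ?_)
      · rw [abs_neg, abs_of_nonneg (div_nonneg (hη0 _) hκ.le)]
        exact div_le_div_of_nonneg_right (hη1 _) hκ.le
      · by_cases h : z ∈ A
        · rw [indicator_of_mem h, abs_of_nonneg hq0]
        · rw [indicator_of_notMem h]; simpa
    have c2 : |ψ n z * ((-(η (u z) / κ) + A.indicator (fun _ ↦ q) z) * m z)| ≤
        1 * ((1 / κ + q) * m z) := by
      rw [abs_mul, abs_mul, abs_of_nonneg (hm0 z), abs_of_nonneg (hθnn _)]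
      exact mul_le_mul (hθle _) (mul_le_mul_of_nonneg_right c1 (hm0 z))
        (mul_nonneg (abs_nonneg _) (hm0 z)) zero_le_one
    have c3 : |4 * L * Λ * ‖a‖ * |(n * ‖γ z‖ ^ 2) * deriv θ (n * ‖γ z‖ ^ 2)| * m z| ≤
        4 * L * Λ * ‖a‖ * Kθ * m z := by
      rw [abs_of_nonneg (mul_nonneg (by positivity) (hm0 z))]
      have := hm0 z
      gcongr
      exact hθK _
    refine (abs_add_le _ _).trans ((add_le_add c2 c3).trans_eq ?_)
    ring
  -- Where β ≠ 0, ψ is eventually 1 with θ' = 0; where β = 0 both vanish for every n. So the terms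
  -- with θ' disappear pointwise, and they are dominated by Kθ times the energy density.
  have hlimpt : ∀ z ∈ W, Tendsto (fun n ↦ H n z) atTop (𝓝 (G z)) := fun z hz ↦ by
    refine tendsto_const_nhds.congr' ?_
    by_cases h0 : β (u z) = 0
    · have hzZ : z ∉ Z := fun h ↦ h.2 h0
      refine Eventually.of_forall fun n ↦ ?_
      obtain ⟨e1, e2⟩ := hψ0 n z (by simp only [hγ, h0]; simp; positivity)
      simp only [hG, indicator_of_notMem hzZ, hHdef, e1, e2]
      simp
    · have hzZ : z ∈ Z := ⟨hz, h0⟩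
      have hpos : 0 < ‖γ z‖ ^ 2 := by
        have : 0 < ‖γ z‖ := norm_pos_iff.2 h0
        positivity
      have hev : ∀ᶠ n : ℕ in atTop, 2 < n * ‖γ z‖ ^ 2 :=
        (tendsto_natCast_atTop_atTop.atTop_mul_const hpos).eventually_gt_atTop 2
      filter_upwards [hev] with n hn
      simp only [hG, indicator_of_mem hzZ, hHdef, hψ, hθ1 _ hn.le, hθd1 _ hn]
      simp
  have hlim : Tendsto (fun n ↦ ∫ z in W, H n z) atTop (𝓝 (∫ z in W, G z)) :=
    tendsto_integral_of_dominated_convergence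
      (fun z ↦ (1 / κ + q + 4 * L * Λ * ‖a‖ * Kθ) * m z) hHm (hint.const_mul _)
      (fun n ↦ Eventually.of_forall fun z ↦ hbound n z)
      ((ae_restrict_iff' hW.measurableSet).2 (Eventually.of_forall hlimpt))
  have hHint : ∀ n, IntegrableOn (H n) W := fun n ↦
    Integrable.mono' (hint.const_mul (1 / κ + q + 4 * L * Λ * ‖a‖ * Kθ)) (hHm n)
      (Eventually.of_forall fun z ↦ hbound n z)
  have hG0 : 0 ≤ ∫ z in W, G z := by
    refine ge_of_tendsto' hlim fun n ↦ ?_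
    rw [← hI0 n]
    exact setIntegral_mono_on (hIint n) (hHint n) hW.measurableSet (hIH n)
  have hZW : Z ⊆ W := fun z hz ↦ hz.1
  have hmZ : IntegrableOn m Z := hint.mono_set hZW
  rw [hG, setIntegral_indicator hZo.measurableSet, inter_eq_self_of_subset_right hZW] at hG0
  have hηm : IntegrableOn (fun z ↦ η (u z) * m z) Z := by
    refine Integrable.mono' hmZ (((hηc.mul hmc).mono hZW).aestronglyMeasurable hZo.measurableSet)
      (Eventually.of_forall fun z ↦ ?_)
    rw [Real.norm_eq_abs, abs_of_nonneg (mul_nonneg (hη0 _) (hm0 z))]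
    exact mul_le_of_le_one_left (hm0 z) (hη1 _)
  have hqm : IntegrableOn (A.indicator fun z ↦ q * m z) Z :=
    (hmZ.const_mul q).indicator hAo.measurableSet
  have hsplit : ∫ z in Z, (-(η (u z) / κ) + A.indicator (fun _ ↦ q) z) * m z =
      -(1 / κ) * (∫ z in Z, η (u z) * m z) + ∫ z in Z, A.indicator (fun z ↦ q * m z) z := by
    rw [← integral_const_mul, ← integral_add (hηm.const_mul _) hqm]
    refine integral_congr_ae (Eventually.of_forall fun z ↦ ?_)
    by_cases h : z ∈ A
    · simp only [indicator_of_mem h]; ring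
    · simp only [indicator_of_notMem h]; ring
  have hset : Z ∩ A = {z | z ∈ W ∧ ‖u z - y₀‖ < ρ ∧ β (u z) ≠ 0} := by
    ext z
    exact ⟨fun h ↦ ⟨h.1.1, h.2.2, h.1.2⟩, fun h ↦ ⟨⟨h.1, h.2.2⟩, h.1, h.2.1⟩⟩
  rw [hsplit, setIntegral_indicator hAo.measurableSet, hset, integral_const_mul] at hG0
  have h5 : 1 / κ * (∫ z in Z, η (u z) * m z) ≤
      q * ∫ z in {z | z ∈ W ∧ ‖u z - y₀‖ < ρ ∧ β (u z) ≠ 0}, m z := by linarith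
  rw [div_mul_eq_mul_div, one_mul, div_le_iff₀ hκ] at h5
  linarith

end Caccioppoli

/-! ### Cut-off functions and De Giorgi's iteration. -/

section Iteration

/-- Radial cut-off functions with the expected bound of the gradient. -/
theorem exists_radial_cutoff (E : Type*) [NormedAddCommGroup E] [InnerProductSpace ℝ E] :
    ∃ K : ℝ, 0 ≤ K ∧ ∀ (y₀ : E) (ρ h : ℝ), 0 < ρ → 0 < h → ∃ η : E → ℝ, ContDiff ℝ 1 η ∧
      (∀ y, 0 ≤ η y) ∧ (∀ y, η y ≤ 1) ∧ (∀ y, ‖y - y₀‖ ≤ ρ → η y = 1) ∧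
      (∀ y, ρ + h ≤ ‖y - y₀‖ → η y = 0 ∧ fderiv ℝ η y = 0) ∧ ∀ y, ‖fderiv ℝ η y‖ ≤ K / h := by
  obtain ⟨θ, K, hθc, hK, hθ0, hθ1, hθnn, hθle, hθK, hθd0, -⟩ := exists_cutoff
  have hθ' : ∀ x, |deriv θ x| ≤ K := fun x ↦ by
    rcases lt_or_ge x 1 with hx | hx
    · simp [hθd0 x hx, hK]
    · refine le_trans ?_ (hθK x)
      rw [abs_mul, abs_of_nonneg (by linarith : 0 ≤ x)]
      exact le_mul_of_one_le_left (abs_nonneg _) hx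
  refine ⟨2 * K, by positivity, fun y₀ ρ h hρ hh ↦ ?_⟩
  -- This is (ρ + h)² - ρ², so that g falls from 2 to 1 between the two spheres. The squared norm
  -- keeps g smooth at the centre.
  set d := h * (2 * ρ + h) with hd
  have hd0 : 0 < d := by positivity
  set g : E → ℝ := fun y ↦ 2 - (‖y - y₀‖ ^ 2 - ρ ^ 2) / d with hg
  have hgc : ContDiff ℝ 1 g :=
    contDiff_const.sub ((((contDiff_id.sub contDiff_const).norm_sq ℝ).sub contDiff_const).div_const d)
  set η : E → ℝ := fun y ↦ θ (g y) with hη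
  have hηc : ContDiff ℝ 1 η := hθc.comp hgc
  have hzero : ∀ y, ρ + h ≤ ‖y - y₀‖ → η y = 0 ∧ fderiv ℝ η y = 0 := fun y hy ↦ by
    have h1 : η y = 0 := by
      refine hθ0 _ ?_
      have : 1 ≤ (‖y - y₀‖ ^ 2 - ρ ^ 2) / d := by
        rw [le_div_iff₀ hd0, hd]
        nlinarith
      simp only [hg]; linarith
    -- Zero is the minimum of η, so the derivative vanishes also on the bounding sphere.
    refine ⟨h1, IsLocalMin.fderiv_eq_zero (Eventually.of_forall fun x ↦ ?_)⟩
    rw [h1]; exact hθnn _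
  refine ⟨η, hηc, fun y ↦ hθnn _, fun y ↦ hθle _, fun y hy ↦ hθ1 _ ?_, hzero, fun y ↦ ?_⟩
  · have : (‖y - y₀‖ ^ 2 - ρ ^ 2) / d ≤ 0 := by
      refine div_nonpos_of_nonpos_of_nonneg ?_ hd0.le
      nlinarith [norm_nonneg (y - y₀)]
    simp only [hg]; linarith
  · rcases le_total (ρ + h) ‖y - y₀‖ with hy | hy
    · rw [(hzero y hy).2, norm_zero]; positivity
    have h1 : HasFDerivAt (fun y : E ↦ y - y₀) (ContinuousLinearMap.id ℝ E) y :=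
      (hasFDerivAt_id y).sub_const y₀
    have h2 := ((h1.norm_sq.sub_const (ρ ^ 2)).mul_const d⁻¹).const_sub 2
    have h3 := (hθc.differentiable one_ne_zero _).hasDerivAt.comp_hasFDerivAt y h2
    have h4 : fderiv ℝ η y = _ := h3.fderiv
    rw [h4]
    refine ContinuousLinearMap.opNorm_le_bound _ (by positivity) fun v ↦ ?_
    simp only [smul_apply, neg_apply, ContinuousLinearMap.comp_apply,
      ContinuousLinearMap.id_apply, innerSL_apply_apply, smul_eq_mul, norm_mul, norm_neg,
      Real.norm_eq_abs, nsmul_eq_mul]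
    rw [abs_of_pos (inv_pos.2 hd0)]
    have h5 : |inner ℝ (y - y₀) v| ≤ (ρ + h) * ‖v‖ :=
      (abs_real_inner_le_norm _ _).trans (by gcongr)
    have h6 : (ρ + h) * d⁻¹ ≤ 1 / h := by
      rw [← div_eq_mul_inv, div_le_div_iff₀ hd0 hh, hd]
      nlinarith
    calc _ ≤ K * (d⁻¹ * (2 * ((ρ + h) * ‖v‖))) := by
          gcongr
          · exact hθ' _
          · simp
      _ = 2 * K * ((ρ + h) * d⁻¹) * ‖v‖ := by ring
      _ ≤ 2 * K * (1 / h) * ‖v‖ := by gcongr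
      _ = _ := by ring

/-- De Giorgi's iteration. -/
theorem exists_eq_zero_of_iteration {r c C : ℝ} (hr : 0 < r) (hc : 0 < c) (hC : 0 ≤ C) :
    ∃ ε > 0, ∀ A : ℝ → ℝ, (∀ ρ, 0 ≤ A ρ) → Monotone A →
      (∀ ρ h, 0 < h → h ≤ r → r ≤ ρ → ρ + 2 * h ≤ 2 * r → A (ρ + 2 * h) < c * h ^ 2 →
        A ρ ≤ C / h * Real.sqrt (A (ρ + 2 * h)) * A (ρ + 2 * h)) →
      A (2 * r) ≤ ε → A r = 0 := by
  -- The first bound yields the smallness hypothesis of each step, ε q⁴ < c (r q/4)² for q = 2⁻ⁿ;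
  -- the second makes the step gain the factor 1/16.
  set ε := min (c * r ^ 2 / 32) ((r / (64 * (C + 1))) ^ 2) with hε
  have hε0 : 0 < ε := lt_min (by positivity) (by positivity)
  have hε1 : ε ≤ c * r ^ 2 / 32 := min_le_left _ _
  have hε2 : Real.sqrt ε ≤ r / (64 * (C + 1)) := by
    rw [Real.sqrt_le_left (by positivity)]
    exact min_le_right _ _
  refine ⟨ε, hε0, fun A hA0 hAm hstep hA ↦ ?_⟩
  -- With h = r q/4 the step bounds the next value by a multiple of √ε q · ε q⁴. The exponent 4
  -- leaves a spare factor q ≤ 1, which beats the loss 1/h.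
  have key : ∀ n : ℕ, A (r * (1 + (1 / 2) ^ n)) ≤ ε * ((1 / 2) ^ n) ^ 4 := by
    intro n
    induction n with
    | zero =>
      simp only [pow_zero, one_pow, mul_one]
      rwa [show r * (1 + 1) = 2 * r by ring]
    | succ n ih =>
      set q : ℝ := (1 / 2) ^ n with hq
      have hq0 : 0 < q := by positivity
      have hq1 : q ≤ 1 := pow_le_one₀ (by norm_num) (by norm_num)
      have hqs : (1 / 2 : ℝ) ^ (n + 1) = q / 2 := by rw [pow_succ]; ring
      rw [hqs]
      have hsum : r * (1 + q / 2) + 2 * (r * q / 4) = r * (1 + q) := by ring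
      have h1 := hstep (r * (1 + q / 2)) (r * q / 4) (by positivity) (by nlinarith) (by nlinarith)
        (by rw [hsum]; nlinarith) (by
          rw [hsum]
          refine ih.trans_lt ?_
          have hq4 : q ^ 4 ≤ q ^ 2 := pow_le_pow_of_le_one hq0.le hq1 (by norm_num)
          calc ε * q ^ 4 ≤ c * r ^ 2 / 32 * q ^ 2 := by gcongr
            _ < c * (r * q / 4) ^ 2 := by
                have : 0 < c * r ^ 2 * q ^ 2 := by positivity
                nlinarith)
      rw [hsum] at h1
      have hs : Real.sqrt (A (r * (1 + q))) ≤ r / (64 * (C + 1)) * q ^ 2 := by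
        calc Real.sqrt (A (r * (1 + q))) ≤ Real.sqrt (ε * q ^ 4) := Real.sqrt_le_sqrt ih
          _ = Real.sqrt ε * q ^ 2 := by
              rw [Real.sqrt_mul hε0.le, show q ^ 4 = (q ^ 2) ^ 2 by ring,
                Real.sqrt_sq (by positivity)]
          _ ≤ _ := by gcongr
      calc A (r * (1 + q / 2)) ≤ C / (r * q / 4) * Real.sqrt (A (r * (1 + q))) * A (r * (1 + q)) := h1
        _ ≤ C / (r * q / 4) * (r / (64 * (C + 1)) * q ^ 2) * (ε * q ^ 4) := by
            gcongr
            exact hA0 _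
        _ = (C / (C + 1)) * q * (ε * (q / 2) ^ 4) := by
            field_simp
            ring
        _ ≤ 1 * 1 * (ε * (q / 2) ^ 4) := by
            gcongr
            rw [div_le_one (by positivity)]
            linarith
        _ = _ := by ring
  refine le_antisymm ?_ (hA0 r)
  have hlim : Tendsto (fun n : ℕ ↦ ε * ((1 / 2 : ℝ) ^ n) ^ 4) atTop (𝓝 0) := by
    have h1 : Tendsto (fun n : ℕ ↦ (1 / 2 : ℝ) ^ n) atTop (𝓝 0) :=
      tendsto_pow_atTop_nhds_zero_of_lt_one (by norm_num) (by norm_num)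
    simpa using (h1.pow 4).const_mul ε
  refine ge_of_tendsto' hlim fun n ↦ (hAm ?_).trans (key n)
  have : (0 : ℝ) ≤ (1 / 2) ^ n := by positivity
  nlinarith

end Iteration

theorem mem_ball_of_mem_chartBall {M : Type*} [TopologicalSpace M]
    [ChartedSpace (EuclideanHalfSpace 4) M] {p x : M} {ρ : ℝ} (hx : x ∈ chartBall p ρ) :
    extChartAt (𝓡∂ 4) p x ∈ Metric.ball (extChartAt (𝓡∂ 4) p p) ρ :=
  mem_ball_iff_norm.2 hx.2

/-! ### The energy off the zero set of β, for curves with boundary in S. -/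

section TotallyReal

open scoped RealInnerProductSpace

variable {M : Type*} [TopologicalSpace M] [ChartedSpace (EuclideanHalfSpace 4) M]
  [IsManifold (𝓡∂ 4) ∞ M] {𝒥 : AlmostComplexStructure M} {Ω : TameSymplecticForm 𝒥} {p : M}
  {cm : ChartModel 𝒥 Ω p} {S : Set M}

/-- A piece `f : U → M` of a holomorphic disc of finite energy, which over the coordinate ball of
radius `2 r` at `p` has its boundary in `S` only. -/
structure IsBoundaryPiece (rm : RealModel cm S) (f : ℂ → M) (U : Set ℂ) (r : ℝ) : Prop where
  hol : IsJHolomorphicDisc 𝒥 f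
  isOpen : IsOpen U
  subset : U ⊆ Metric.ball 0 1
  boundary : ∀ ζ ∈ Metric.sphere (0 : ℂ) 1, ∀ N, IsOpen N → S ⊆ N →
    ∀ᶠ z in 𝓝[Metric.ball 0 1] ζ, f z ∈ N
  interior : ∀ ζ ∈ Metric.ball (0 : ℂ) 1, ζ ∉ U →
    ∀ᶠ z in 𝓝[U] ζ, f z ∉ chartClosedBall p (2 * r)
  pos : 0 < r
  lt : 2 * r < rm.R
  energy : ∫⁻ z in Metric.ball (0 : ℂ) 1, cm.density f z ≠ ⊤

namespace RealModel

/-- The part of `U` over the coordinate ball of radius `ρ` that is not mapped to `{β = 0}`. -/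
def offSet (rm : RealModel cm S) (f : ℂ → M) (U : Set ℂ) (ρ : ℝ) : Set ℂ :=
  {z | z ∈ U ∩ f ⁻¹' chartBall p rm.R ∧
    ‖extChartAt (𝓡∂ 4) p (f z) - extChartAt (𝓡∂ 4) p p‖ < ρ ∧
    rm.β (extChartAt (𝓡∂ 4) p (f z)) ≠ 0}

/-- The energy of `f` on `offSet`. -/
def offEnergy (rm : RealModel cm S) (f : ℂ → M) (U : Set ℂ) (ρ : ℝ) : ℝ :=
  ∫ z in rm.offSet f U ρ, ‖fderiv ℝ (fun z ↦ extChartAt (𝓡∂ 4) p (f z)) z 1‖ ^ 2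

theorem norm_β_sub_le (rm : RealModel cm S) {y y' : E4}
    (hy : y ∈ Metric.ball (extChartAt (𝓡∂ 4) p p) rm.R)
    (hy' : y' ∈ Metric.ball (extChartAt (𝓡∂ 4) p p) rm.R) :
    ‖rm.β y' - rm.β y‖ ≤ rm.L * ‖y' - y‖ :=
  Convex.norm_image_sub_le_of_norm_fderiv_le (𝕜 := ℝ)
    (fun _ hx ↦ (rm.contDiffOn.contDiffAt (Metric.isOpen_ball.mem_nhds hx)).differentiableAt
      one_ne_zero) rm.norm_fderiv_le (convex_ball _ _) hy hy'

/-- The points near `p` where `β` is bounded away from zero form a closed set. -/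
theorem isClosed_le_norm_β [T2Space M] (rm : RealModel cm S) {ρ : ℝ} (hρ : ρ < rm.R) (δ : ℝ) :
    IsClosed {x : M | x ∈ chartClosedBall p ρ ∧ δ ≤ ‖rm.β (extChartAt (𝓡∂ 4) p x)‖ ^ 2} := by
  have hr := cm.radius_pos
  have h1 := cm.isClosed_chartClosedBall (ρ := ρ) (by linarith [rm.R_le])
  refine ContinuousOn.preimage_isClosed_of_isClosed
    (f := fun x ↦ ‖rm.β (extChartAt (𝓡∂ 4) p x)‖ ^ 2) (t := Ici δ) ?_ h1 isClosed_Ici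
  refine ((rm.contDiffOn.continuousOn.comp
    ((continuousOn_extChartAt p).mono fun y hy ↦ hy.1) fun x hx ↦ ?_).norm).pow 2
  exact mem_ball_of_mem_chartBall (chartClosedBall_subset p hρ hx)

end RealModel

namespace IsBoundaryPiece

variable {rm : RealModel cm S} {f : ℂ → M} {U : Set ℂ} {r : ℝ}

theorem eventually_notMem (h : IsBoundaryPiece rm f U r) {K : Set M} (hK : IsClosed K)
    (hKp : K ⊆ chartClosedBall p (2 * r)) (hKS : Disjoint K S) {ζ : ℂ}
    (hζ : ζ ∈ Metric.closedBall (0 : ℂ) 1) (hζU : ζ ∉ U) : ∀ᶠ z in 𝓝[U] ζ, f z ∉ K := by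
  rw [← Metric.ball_union_sphere] at hζ
  rcases hζ with hζ | hζ
  · filter_upwards [h.interior ζ hζ hζU] with z hz hzK
    exact hz (hKp hzK)
  · exact nhdsWithin_mono _ h.subset
      (h.boundary ζ hζ Kᶜ hK.isOpen_compl hKS.symm.subset_compl_right)

/-- This properness replaces continuity up to the boundary: at the unit circle f is only known to
approach S, and K stays away from S. -/
theorem isCompact_inter_preimage (h : IsBoundaryPiece rm f U r) {K : Set M} (hK : IsClosed K)
    (hKp : K ⊆ chartClosedBall p (2 * r)) (hKS : Disjoint K S) : IsCompact (U ∩ f ⁻¹' K) := by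
  refine (isCompact_closedBall (0 : ℂ) 1).of_isClosed_subset ?_
    (inter_subset_left.trans (h.subset.trans Metric.ball_subset_closedBall))
  refine isClosed_of_closure_subset fun ζ hζ ↦ ?_
  have hfreq := mem_closure_iff_frequently.1 hζ
  have hζD : ζ ∈ Metric.closedBall (0 : ℂ) 1 :=
    Metric.isClosed_closedBall.closure_subset_iff.2
      (inter_subset_left.trans (h.subset.trans Metric.ball_subset_closedBall)) hζ
  by_cases hζU : ζ ∈ U
  · refine ⟨hζU, ?_⟩
    have hcont : ContinuousAt f ζ :=
      h.hol.continuousOn.continuousAt (Metric.isOpen_ball.mem_nhds (h.subset hζU))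
    by_contra hnot
    obtain ⟨z, hz1, hz2⟩ :=
      (hfreq.and_eventually (hcont.eventually (hK.isOpen_compl.mem_nhds hnot))).exists
    exact hz2 hz1.2
  · exfalso
    obtain ⟨z, hz1, hz2⟩ := (hfreq.and_eventually
      (eventually_nhdsWithin_iff.1 (h.eventually_notMem hK hKp hKS hζD hζU))).exists
    exact hz2 hz1.1 hz1.2

theorem isJCurveOn (h : IsBoundaryPiece rm f U r) :
    IsJCurveOn cm.Jc cm.bound cm.lip (U ∩ f ⁻¹' chartBall p rm.R)
      (fun z ↦ extChartAt (𝓡∂ 4) p (f z)) :=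
  h.hol.isJCurveOn cm h.isOpen h.subset (by linarith [rm.R_le, cm.radius_pos])

theorem density_eq (h : IsBoundaryPiece rm f U r) {z : ℂ} (hz : z ∈ U ∩ f ⁻¹' chartBall p rm.R) :
    cm.density f z = ‖fderiv ℝ (fun z ↦ extChartAt (𝓡∂ 4) p (f z)) z 1‖ₑ ^ 2 := by
  rw [ChartModel.density, cm.fderiv_vec h.hol (h.subset hz.1) (chartBall_mono p rm.R_le hz.2)]

theorem integrableOn (h : IsBoundaryPiece rm f U r) :
    IntegrableOn (fun z ↦ ‖fderiv ℝ (fun z ↦ extChartAt (𝓡∂ 4) p (f z)) z 1‖ ^ 2)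
      (U ∩ f ⁻¹' chartBall p rm.R) := by
  have hW := h.isJCurveOn.isOpen
  refine ⟨((h.isJCurveOn.continuousOn_fderiv 1).norm.pow 2).aestronglyMeasurable hW.measurableSet,
    ?_⟩
  rw [hasFiniteIntegral_iff_enorm]
  refine lt_of_le_of_lt ?_ h.energy.lt_top
  calc _ = ∫⁻ z in U ∩ f ⁻¹' chartBall p rm.R, cm.density f z := by
        refine setLIntegral_congr_fun hW.measurableSet fun z hz ↦ ?_
        rw [h.density_eq hz, enorm_pow, enorm_norm]
    _ ≤ _ := lintegral_mono_set (inter_subset_left.trans h.subset)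

theorem isOpen_offSet (h : IsBoundaryPiece rm f U r) (ρ : ℝ) : IsOpen (rm.offSet f U ρ) := by
  have hc := h.isJCurveOn.contDiffOn.continuousOn
  have h1 : ContinuousOn (fun z ↦ rm.β (extChartAt (𝓡∂ 4) p (f z)))
      (U ∩ f ⁻¹' chartBall p rm.R) :=
    rm.contDiffOn.continuousOn.comp hc fun z hz ↦ mem_ball_of_mem_chartBall hz.2
  have h2 : ContinuousOn (fun z ↦ ‖extChartAt (𝓡∂ 4) p (f z) - extChartAt (𝓡∂ 4) p p‖)
      (U ∩ f ⁻¹' chartBall p rm.R) := (hc.sub continuousOn_const).norm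
  have h3 := (h2.prodMk h1).isOpen_inter_preimage h.isJCurveOn.isOpen
    (isOpen_Iio (a := ρ) |>.prod (isOpen_compl_singleton (x := (0 : E2))))
  exact h3

theorem offSet_subset (ρ : ℝ) : rm.offSet f U ρ ⊆ U ∩ f ⁻¹' chartBall p rm.R := fun _ hz ↦ hz.1

theorem offEnergy_nonneg (ρ : ℝ) : 0 ≤ rm.offEnergy f U ρ :=
  integral_nonneg fun _ ↦ by positivity

theorem offEnergy_mono (h : IsBoundaryPiece rm f U r) : Monotone (rm.offEnergy f U) :=
  fun _ _ hρ ↦ setIntegral_mono_set (h.integrableOn.mono_set (offSet_subset _))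
    (Eventually.of_forall fun _ ↦ by positivity)
    (Eventually.of_forall fun _ hz ↦ ⟨hz.1, hz.2.1.trans_le hρ, hz.2.2⟩)

theorem ofReal_offEnergy (h : IsBoundaryPiece rm f U r) (ρ : ℝ) :
    ENNReal.ofReal (rm.offEnergy f U ρ) = ∫⁻ z in rm.offSet f U ρ, cm.density f z := by
  rw [RealModel.offEnergy, ofReal_integral_eq_lintegral_ofReal
    (h.integrableOn.mono_set (offSet_subset _)) (Eventually.of_forall fun _ ↦ by positivity)]
  refine setLIntegral_congr_fun (h.isOpen_offSet ρ).measurableSet fun z hz ↦ ?_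
  rw [h.density_eq hz.1, ENNReal.ofReal_pow (norm_nonneg _), ofReal_norm]

/-- Monotonicity bounds `β` by the energy. -/
theorem le_offEnergy [T2Space M] (h : IsBoundaryPiece rm f U r) {t₀ c : ℝ}
    (hmono : ∀ u : ℂ → M, IsJHolomorphicDisc 𝒥 u → ∀ U : Set ℂ, IsOpen U →
      U ⊆ Metric.ball 0 1 → ∀ z₀ ∈ U, ∀ t : ℝ, 0 < t → t ≤ t₀ →
      u z₀ ∈ chartBall p (cm.radius / 2 - t) →
      (∀ ζ ∈ Metric.closedBall (0 : ℂ) 1, ζ ∉ U → ∀ᶠ z in 𝓝[U] ζ, u z ∉ chartNear p (u z₀) t) →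
      ENNReal.ofReal (c * t ^ 2) ≤
        ∫⁻ z in U ∩ u ⁻¹' chartNear p (u z₀) t, cm.density u z)
    {z₀ : ℂ} (hz₀ : z₀ ∈ U) {ρ t : ℝ} (ht : 0 < t) (htt : t ≤ t₀)
    (hzρ : f z₀ ∈ chartBall p (ρ - t)) (hρ : ρ ≤ 2 * r)
    (htβ : t * (2 * rm.L) ≤ ‖rm.β (extChartAt (𝓡∂ 4) p (f z₀))‖)
    (hβ : rm.β (extChartAt (𝓡∂ 4) p (f z₀)) ≠ 0) :
    c * t ^ 2 ≤ rm.offEnergy f U ρ := by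
  set τ := ‖rm.β (extChartAt (𝓡∂ 4) p (f z₀))‖ with hτ
  have hτ0 : 0 < τ := norm_pos_iff.2 hβ
  have hlt := h.lt
  have hRr := rm.R_le
  have hnear : chartNear p (f z₀) t ⊆ chartBall p ρ := chartNear_subset hzρ
  have hρR : ρ < rm.R := by linarith
  have hz₀R : f z₀ ∈ chartBall p rm.R := chartBall_mono p (by linarith) hzρ
  -- As β is Lipschitz with constant L and t ≤ τ/(2 L), it keeps norm at least τ/2 on the ball. So
  -- the ball avoids S, the curve is proper over it, and its energy there counts in `offEnergy`.
  have hβnear : ∀ x ∈ chartNear p (f z₀) t, τ / 2 ≤ ‖rm.β (extChartAt (𝓡∂ 4) p x)‖ := by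
    intro x hx
    have h1 := rm.norm_β_sub_le (mem_ball_of_mem_chartBall hz₀R)
      (mem_ball_of_mem_chartBall (chartBall_mono p hρR.le (hnear hx)))
    have h2 : rm.L * ‖extChartAt (𝓡∂ 4) p x - extChartAt (𝓡∂ 4) p (f z₀)‖ ≤ rm.L * t :=
      mul_le_mul_of_nonneg_left hx.2 rm.L_pos.le
    have h3 := norm_sub_norm_le (rm.β (extChartAt (𝓡∂ 4) p (f z₀)))
      (rm.β (extChartAt (𝓡∂ 4) p x))
    rw [norm_sub_rev] at h3
    linarith
  have hcl : IsClosed (chartNear p (f z₀) t) :=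
    cm.isClosed_chartNear (chartBall_mono p (by linarith [cm.radius_pos]) hzρ)
  have hdisj : Disjoint (chartNear p (f z₀) t) S := by
    rw [Set.disjoint_left]
    intro x hx hxS
    have h1 := hβnear x hx
    rw [rm.zero x hxS (chartBall_mono p hρR.le (hnear hx)), norm_zero] at h1
    linarith
  have key := hmono f h.hol U h.isOpen h.subset z₀ hz₀ t ht htt
    (chartBall_mono p (by linarith) hzρ) fun ζ hζ hζU ↦
      h.eventually_notMem hcl (hnear.trans (chartBall_subset p hρ)) hdisj hζ hζU
  have h2 : ENNReal.ofReal (c * t ^ 2) ≤ ENNReal.ofReal (rm.offEnergy f U ρ) := by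
    rw [h.ofReal_offEnergy]
    refine key.trans (lintegral_mono_set fun z hz ↦ ?_)
    have h3 := hnear hz.2
    refine ⟨⟨hz.1, chartBall_mono p hρR.le h3⟩, h3.2, fun h4 ↦ ?_⟩
    have h5 := hβnear _ hz.2
    rw [h4, norm_zero] at h5
    linarith
  exact (ENNReal.ofReal_le_ofReal_iff (offEnergy_nonneg _)).1 h2

/-- The step of De Giorgi's iteration. -/
theorem offEnergy_le [T2Space M] (h : IsBoundaryPiece rm f U r) {t₀ c K : ℝ} (hc : 0 < c)
    (hmono : ∀ u : ℂ → M, IsJHolomorphicDisc 𝒥 u → ∀ U : Set ℂ, IsOpen U →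
      U ⊆ Metric.ball 0 1 → ∀ z₀ ∈ U, ∀ t : ℝ, 0 < t → t ≤ t₀ →
      u z₀ ∈ chartBall p (cm.radius / 2 - t) →
      (∀ ζ ∈ Metric.closedBall (0 : ℂ) 1, ζ ∉ U → ∀ᶠ z in 𝓝[U] ζ, u z ∉ chartNear p (u z₀) t) →
      ENNReal.ofReal (c * t ^ 2) ≤
        ∫⁻ z in U ∩ u ⁻¹' chartNear p (u z₀) t, cm.density u z)
    (hK : 0 ≤ K) (hcut : ∀ (y₀ : E4) (ρ h : ℝ), 0 < ρ → 0 < h → ∃ η : E4 → ℝ, ContDiff ℝ 1 η ∧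
      (∀ y, 0 ≤ η y) ∧ (∀ y, η y ≤ 1) ∧ (∀ y, ‖y - y₀‖ ≤ ρ → η y = 1) ∧
      (∀ y, ρ + h ≤ ‖y - y₀‖ → η y = 0 ∧ fderiv ℝ η y = 0) ∧ ∀ y, ‖fderiv ℝ η y‖ ≤ K / h)
    {ρ d : ℝ} (hρ : 0 < ρ) (hd : 0 < d) (hdt : d ≤ t₀) (hρd : ρ + 2 * d ≤ 2 * r)
    (hsmall : rm.offEnergy f U (ρ + 2 * d) < c * d ^ 2) :
    rm.offEnergy f U ρ ≤ (rm.κ * (2 * cm.bound * ‖rm.a‖ * K * (2 * rm.L / Real.sqrt c))) / d *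
      Real.sqrt (rm.offEnergy f U (ρ + 2 * d)) * rm.offEnergy f U (ρ + 2 * d) := by
  set A := rm.offEnergy f U (ρ + 2 * d) with hA
  have hA0 : 0 ≤ A := offEnergy_nonneg _
  have hL := rm.L_pos
  have hsc : 0 < Real.sqrt c := Real.sqrt_pos.2 hc
  set b := 2 * rm.L / Real.sqrt c * Real.sqrt A with hb
  have hb0 : 0 ≤ b := by positivity
  set u : ℂ → E4 := fun z ↦ extChartAt (𝓡∂ 4) p (f z) with hu
  set y₀ := extChartAt (𝓡∂ 4) p p with hy₀
  have hlt := h.lt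
  have hbound : ∀ z ∈ U ∩ f ⁻¹' chartBall p rm.R, ‖u z - y₀‖ < ρ + d → ‖rm.β (u z)‖ ≤ b := by
    intro z hz hzρ
    by_cases h0 : rm.β (u z) = 0
    · rw [h0, norm_zero]; exact hb0
    set τ := ‖rm.β (u z)‖ with hτ
    have hτ0 : 0 < τ := norm_pos_iff.2 h0
    -- If the minimum were d, monotonicity would give energy at least c d², against `hsmall`. So t =
    -- τ/(2 L), and monotonicity bounds τ by a multiple of √A.
    set t := min (τ / (2 * rm.L)) d with ht
    have ht0 : 0 < t := lt_min (by positivity) hd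
    have htd : t ≤ d := min_le_right _ _
    have h1 := h.le_offEnergy hmono hz.1 (ρ := ρ + 2 * d) ht0 (htd.trans hdt)
      ⟨hz.2.1, by show ‖u z - y₀‖ < _; linarith⟩ hρd (by
        have : t ≤ τ / (2 * rm.L) := min_le_left _ _
        rwa [le_div_iff₀ (by positivity)] at this) h0
    have h2 : t = τ / (2 * rm.L) := by
      rcases min_choice (τ / (2 * rm.L)) d with h3 | h3
      · exact h3
      · exfalso
        have h4 : t = d := h3
        rw [h4] at h1
        linarith
    rw [h2] at h1
    have h3 : Real.sqrt c * (τ / (2 * rm.L)) ≤ Real.sqrt A := by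
      refine Real.le_sqrt_of_sq_le ?_
      rw [mul_pow, Real.sq_sqrt hc.le]
      exact h1
    have h4 : τ = 2 * rm.L / Real.sqrt c * (Real.sqrt c * (τ / (2 * rm.L))) := by
      field_simp
    rw [h4]
    exact mul_le_mul_of_nonneg_left h3 (by positivity)
  -- The cut-off uses the shell from ρ to ρ + d; the monotonicity balls centred there use a further
  -- d, whence the radius ρ + 2 d.
  obtain ⟨η, hηc, hη0, hη1, hηρ, hηz, hηK⟩ := hcut y₀ ρ d hρ hd
  have hcpt : ∀ δ > 0, IsCompact {z | z ∈ U ∩ f ⁻¹' chartBall p rm.R ∧ ‖u z - y₀‖ ≤ ρ + d ∧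
      δ ≤ ‖rm.β (u z)‖ ^ 2} := by
    intro δ hδ
    have hcl := rm.isClosed_le_norm_β (ρ := ρ + d) (by linarith) δ
    have h1 := h.isCompact_inter_preimage hcl
      (fun x hx ↦ ⟨hx.1.1, hx.1.2.trans (by linarith)⟩) (by
        rw [Set.disjoint_left]
        rintro x ⟨hx1, hx2⟩ hxS
        rw [rm.zero x hxS (chartClosedBall_subset p (by linarith) hx1)] at hx2
        simp at hx2
        linarith)
    convert h1 using 1
    ext z
    constructor
    · rintro ⟨⟨h1, h2⟩, h3, h4⟩
      exact ⟨h1, ⟨h2.1, h3⟩, h4⟩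
    · rintro ⟨h1, h2, h4⟩
      exact ⟨⟨h1, chartClosedBall_subset p (by linarith) h2⟩, h2.2, h4⟩
  have hcac := h.isJCurveOn.caccioppoli cm.bound_nonneg (y₀ := y₀) (R := rm.R) (ρ := ρ + d)
    (fun z hz ↦ mem_ball_of_mem_chartBall hz.2) (β := rm.β) (a := rm.a) hL.le rm.κ_pos
    rm.contDiffOn rm.norm_fderiv_le (fun z hz v ↦ rm.norm_le _ hz.2 v) hηc hη0 hη1 hηK
    hηz hcpt h.integrableOn hb0 hbound
  have hint := h.integrableOn
  have hηcont : ContinuousOn (fun z ↦ η (u z)) (U ∩ f ⁻¹' chartBall p rm.R) :=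
    hηc.continuous.comp_continuousOn h.isJCurveOn.contDiffOn.continuousOn
  have hηm : IntegrableOn (fun z ↦ η (u z) * ‖fderiv ℝ u z 1‖ ^ 2) (U ∩ f ⁻¹' chartBall p rm.R) := by
    refine Integrable.mono' hint ((hηcont.mul
      ((h.isJCurveOn.continuousOn_fderiv 1).norm.pow 2)).aestronglyMeasurable
      h.isJCurveOn.isOpen.measurableSet) (Eventually.of_forall fun z ↦ ?_)
    rw [Real.norm_eq_abs, abs_of_nonneg (mul_nonneg (hη0 _) (by positivity))]
    exact mul_le_of_le_one_left (by positivity) (hη1 _)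
  have hlow : rm.offEnergy f U ρ ≤
      ∫ z in {z | z ∈ U ∩ f ⁻¹' chartBall p rm.R ∧ rm.β (u z) ≠ 0},
        η (u z) * ‖fderiv ℝ u z 1‖ ^ 2 := by
    have h1 : rm.offEnergy f U ρ = ∫ z in rm.offSet f U ρ, η (u z) * ‖fderiv ℝ u z 1‖ ^ 2 := by
      refine setIntegral_congr_fun (h.isOpen_offSet ρ).measurableSet fun z hz ↦ ?_
      have : η (u z) = 1 := hηρ _ hz.2.1.le
      simp only [this, one_mul]
      rfl
    rw [h1]
    exact setIntegral_mono_set (hηm.mono_set fun z hz ↦ hz.1)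
      (Eventually.of_forall fun z ↦ mul_nonneg (hη0 _) (by positivity))
      (Eventually.of_forall fun z hz ↦ ⟨hz.1, hz.2.2⟩)
  have hA' : rm.offEnergy f U (ρ + d) ≤ A := h.offEnergy_mono (by linarith)
  have hκ := rm.κ_pos
  have hbd := cm.bound_nonneg
  calc rm.offEnergy f U ρ ≤ _ := hlow
    _ ≤ rm.κ * (2 * cm.bound * ‖rm.a‖ * (K / d) * b) * rm.offEnergy f U (ρ + d) := hcac
    _ ≤ rm.κ * (2 * cm.bound * ‖rm.a‖ * (K / d) * b) * A := by gcongr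
    _ = _ := by rw [hb]; ring

end IsBoundaryPiece
end TotallyReal

/-- A map of the disc with finite cluster set at a boundary point has a limit there. -/
theorem exists_tendsto_of_finite_cluster {M : Type*} [TopologicalSpace M] [CompactSpace M]
    [T2Space M] {f : ℂ → M} (hf : ContinuousOn f (Metric.ball 0 1)) {ζ : ℂ}
    (hζ : ζ ∈ closure (Metric.ball (0 : ℂ) 1))
    (hfin : {p | MapClusterPt p (𝓝[Metric.ball 0 1] ζ) f}.Finite) :
    ∃ y, Tendsto f (𝓝[Metric.ball 0 1] ζ) (𝓝 y) := by
  have : (𝓝[Metric.ball (0 : ℂ) 1] ζ).NeBot := mem_closure_iff_nhdsWithin_neBot.1 hζ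
  set T := {p | MapClusterPt p (𝓝[Metric.ball 0 1] ζ) f} with hT
  obtain ⟨y, -, hy⟩ := (isCompact_univ (X := M)).exists_mapClusterPt_of_frequently
    (l := 𝓝[Metric.ball (0 : ℂ) 1] ζ) (f := f) (Frequently.of_forall fun _ ↦ mem_univ _)
  refine ⟨y, tendsto_nhds.2 fun N hN hyN ↦ ?_⟩
  -- The cluster value y is separated from the finitely many others. Near ζ the values of f lie in
  -- the union of two disjoint open sets; the image of a half-disc is connected and meets the one
  -- around y, so it lies there.
  obtain ⟨V, V', hV, hV', hyV, hTV', hVV'⟩ := normal_separation (isClosed_singleton (x := y))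
    (hfin.subset (sdiff_subset (t := {y}))).isClosed (by simp)
  have hcov : T ⊆ (V ∩ N) ∪ V' := fun x hx ↦ by
    by_cases hxy : x = y
    · left
      rw [hxy]
      exact ⟨hyV rfl, hyN⟩
    · exact Or.inr (hTV' ⟨hx, hxy⟩)
  have hev := eventually_mem_of_mapClusterPt_subset (S := T) (fun p hp ↦ hp)
    ((hV.inter hN).union hV') hcov
  rw [eventually_nhdsWithin_iff, Metric.eventually_nhds_iff_ball] at hev
  obtain ⟨s, hs, hsub⟩ := hev
  have hconn : IsPreconnected (f '' (Metric.ball 0 1 ∩ Metric.ball ζ s)) :=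
    ((convex_ball (0 : ℂ) 1).inter (convex_ball ζ s)).isPreconnected.image f
      (hf.mono inter_subset_left)
  have hball : ∀ᶠ z in 𝓝[Metric.ball 0 1] ζ, z ∈ Metric.ball (0 : ℂ) 1 ∩ Metric.ball ζ s :=
    inter_mem self_mem_nhdsWithin (mem_nhdsWithin_of_mem_nhds (Metric.ball_mem_nhds ζ hs))
  have hmeet : (f '' (Metric.ball 0 1 ∩ Metric.ball ζ s) ∩ (V ∩ N)).Nonempty := by
    obtain ⟨z, hz1, hz2⟩ := ((hy.frequently ((hV.inter hN).mem_nhds ⟨hyV rfl, hyN⟩)).and_eventually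
      hball).exists
    exact ⟨f z, mem_image_of_mem f hz2, hz1⟩
  have hfinal := hconn.subset_left_of_subset_union (hV.inter hN) hV'
    (hVV'.mono_left inter_subset_left)
    (image_subset_iff.2 fun z hz ↦ hsub z hz.2 hz.1) hmeet
  filter_upwards [hball] with z hz
  exact (hfinal (mem_image_of_mem f hz)).2

/-! ### At most one totally real cluster value at each boundary point. -/

section TotallyReal

open scoped RealInnerProductSpace

variable {M : Type*} [TopologicalSpace M] [ChartedSpace (EuclideanHalfSpace 4) M]
  [IsManifold (𝓡∂ 4) ∞ M] {𝒥 : AlmostComplexStructure M} {Ω : TameSymplecticForm 𝒥} {p : M}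
  {cm : ChartModel 𝒥 Ω p} {S : Set M}

/-- If `β` vanishes along the piece over the ball of radius `r`, then the piece is constant as soon
as it meets that ball. -/
theorem IsBoundaryPiece.eq_of_β_eq_zero [T2Space M] {rm : RealModel cm S} {f : ℂ → M} {U : Set ℂ}
    {r : ℝ} (h : IsBoundaryPiece rm f U r) (hU : IsPreconnected U)
    (hβ : ∀ z ∈ U, f z ∈ chartBall p r → rm.β (extChartAt (𝓡∂ 4) p (f z)) = 0) {z₀ : ℂ}
    (hz₀ : z₀ ∈ U) (hz₀r : f z₀ ∈ chartBall p r) : ∀ z ∈ U, f z = f z₀ := by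
  have hr := h.pos
  have hlt := h.lt
  set u : ℂ → E4 := fun z ↦ extChartAt (𝓡∂ 4) p (f z) with hu
  have hcont : ContinuousOn f U := h.hol.continuousOn.mono h.subset
  have hO : IsOpen (U ∩ f ⁻¹' chartBall p r) :=
    hcont.isOpen_inter_preimage h.isOpen (isOpen_chartBall p r)
  have hOR : U ∩ f ⁻¹' chartBall p r ⊆ U ∩ f ⁻¹' chartBall p rm.R :=
    inter_subset_inter_right _ (preimage_mono (chartBall_mono p (by linarith)))
  have hcurve := h.isJCurveOn
  -- As β ∘ u vanishes near z, dβ kills both the derivative v in direction 1 and Jv, the derivative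
  -- in direction i. Both terms of the positive form at v are then zero, so v = 0.
  have hfd : ∀ z ∈ U ∩ f ⁻¹' chartBall p r, ‖fderiv ℝ u z‖ ≤ 0 := by
    intro z hz
    have hzR := hOR hz
    have h1 : DifferentiableAt ℝ rm.β (u z) :=
      (rm.contDiffOn.contDiffAt (Metric.isOpen_ball.mem_nhds
        (mem_ball_of_mem_chartBall hzR.2))).differentiableAt one_ne_zero
    have h2 := h1.hasFDerivAt.comp z (hcurve.differentiableAt hzR).hasFDerivAt
    have h3 : (rm.β ∘ u) =ᶠ[𝓝 z] fun _ ↦ 0 := by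
      filter_upwards [hO.mem_nhds hz] with w hw
      exact hβ w hw.1 hw.2
    have h4 : (fderiv ℝ rm.β (u z)).comp (fderiv ℝ u z) = 0 :=
      h2.unique ((hasFDerivAt_const (0 : E2) z).congr_of_eventuallyEq h3)
    have h5 : ∀ v, fderiv ℝ rm.β (u z) (fderiv ℝ u z v) = 0 := fun v ↦
      congrArg (fun T : ℂ →L[ℝ] E2 ↦ T v) h4
    have h6 := rm.norm_le (f z) hzR.2 (fderiv ℝ u z 1)
    have h7 : fderiv ℝ rm.β (u z) (cm.Jc (u z) (fderiv ℝ u z 1)) = 0 := by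
      rw [← hcurve.fderiv_I z hzR]; exact h5 _
    have h8 : ‖fderiv ℝ u z 1‖ ^ 2 ≤ 0 := by
      refine h6.trans_eq ?_
      show rm.κ * (⟪fderiv ℝ rm.β (u z) (cm.Jc (u z) (fderiv ℝ u z 1)), _⟫ -
        ⟪fderiv ℝ rm.β (u z) (fderiv ℝ u z 1), _⟫) = 0
      rw [h7, h5]
      simp
    have h9 : ‖fderiv ℝ u z 1‖ = 0 := by
      have := sq_nonneg ‖fderiv ℝ u z 1‖
      exact pow_eq_zero_iff two_ne_zero |>.1 (le_antisymm h8 this)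
    have h10 := hcurve.norm_fderiv_le hzR
    rwa [h9, mul_zero] at h10
  set Z := {z | z ∈ U ∧ f z = f z₀} with hZ
  have hZo : IsOpen Z := by
    rw [Metric.isOpen_iff]
    rintro z ⟨hzU, hz⟩
    have hzO : z ∈ U ∩ f ⁻¹' chartBall p r := ⟨hzU, by
      show f z ∈ chartBall p r
      rwa [hz]⟩
    obtain ⟨ε, hε, hεO⟩ := Metric.isOpen_iff.1 hO z hzO
    refine ⟨ε, hε, fun w hw ↦ ⟨(hεO hw).1, ?_⟩⟩
    have h1 := Convex.norm_image_sub_le_of_norm_fderiv_le (𝕜 := ℝ) (f := u)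
      (C := 0) (s := Metric.ball z ε)
      (fun y hy ↦ hcurve.differentiableAt (hOR (hεO hy)))
      (fun y hy ↦ hfd y (hεO hy)) (convex_ball z ε) (Metric.mem_ball_self hε) hw
    rw [zero_mul, norm_le_zero_iff, sub_eq_zero] at h1
    rw [← hz]
    exact (extChartAt (𝓡∂ 4) p).injOn (hεO hw).2.1 hzO.2.1 h1
  have hsub : U ⊆ Z := by
    refine hU.subset_of_closure_inter_subset hZo ⟨z₀, hz₀, hz₀, rfl⟩ ?_
    rintro ζ ⟨hζ, hζU⟩
    refine ⟨hζU, ?_⟩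
    have h1 : ContinuousAt f ζ := hcont.continuousAt (h.isOpen.mem_nhds hζU)
    by_contra hne
    obtain ⟨z, hz1, hz2⟩ := ((mem_closure_iff_frequently.1 hζ).and_eventually
      (h1.eventually (isOpen_ne.mem_nhds hne))).exists
    exact hz2 hz1.2
  exact fun z hz ↦ (hsub hz).2

/-- A piece of small energy with boundary in `S` near a totally real point is constant as soon as
it comes close to that point. -/
theorem RealModel.exists_eq_of_small_energy [T2Space M] (rm : RealModel cm S) :
    ∃ r₀ > 0, 2 * r₀ < rm.R ∧ ∀ r, 0 < r → r ≤ r₀ → ∃ ε : ENNReal, 0 < ε ∧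
      ∀ (f : ℂ → M) (U : Set ℂ), IsBoundaryPiece rm f U r → IsPreconnected U →
        ∫⁻ z in U, cm.density f z ≤ ε → ∀ z₀ ∈ U, f z₀ ∈ chartBall p r → ∀ z ∈ U, f z = f z₀ := by
  obtain ⟨t₀, ht₀, c, hc, hmono⟩ := cm.exists_monotonicity
  obtain ⟨K, hK, hcut⟩ := exists_radial_cutoff E4
  have hR := rm.R_pos
  have hL := rm.L_pos
  have hκ := rm.κ_pos
  have hbd := cm.bound_nonneg
  refine ⟨min t₀ (rm.R / 4), lt_min ht₀ (by positivity),
    by linarith [min_le_right t₀ (rm.R / 4)], fun r hr hrr ↦ ?_⟩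
  have hrt : r ≤ t₀ := hrr.trans (min_le_left _ _)
  obtain ⟨ε, hε, hit⟩ := exists_eq_zero_of_iteration hr hc
    (C := rm.κ * (2 * cm.bound * ‖rm.a‖ * K * (2 * rm.L / Real.sqrt c))) (by positivity)
  refine ⟨ENNReal.ofReal ε, ENNReal.ofReal_pos.2 hε, fun f U h hU he z₀ hz₀ hz₀r ↦ ?_⟩
  have hA : rm.offEnergy f U (2 * r) ≤ ε := by
    refine (ENNReal.ofReal_le_ofReal_iff hε.le).1 ?_
    rw [h.ofReal_offEnergy]
    exact (lintegral_mono_set ((IsBoundaryPiece.offSet_subset _).trans inter_subset_left)).trans he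
  have hzero : rm.offEnergy f U r = 0 :=
    hit (rm.offEnergy f U) (fun ρ ↦ IsBoundaryPiece.offEnergy_nonneg ρ) h.offEnergy_mono
      (fun ρ d hd hdr hrρ hρd hsmall ↦ h.offEnergy_le hc hmono hK hcut (by linarith) hd
        (hdr.trans hrt) hρd hsmall) hA
  refine h.eq_of_β_eq_zero hU (fun z hz hzr ↦ ?_) hz₀ hz₀r
  by_contra hne
  set τ := ‖rm.β (extChartAt (𝓡∂ 4) p (f z))‖ with hτ
  have hτ0 : 0 < τ := norm_pos_iff.2 hne
  -- A point with β ≠ 0 would have positive energy near it by monotonicity, on a ball that t ≤ g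
  -- keeps inside radius r; but the energy off {β = 0} over this radius is zero.
  set g := (r - ‖extChartAt (𝓡∂ 4) p (f z) - extChartAt (𝓡∂ 4) p p‖) / 2 with hg
  have hg0 : 0 < g := by
    have := hzr.2
    simp only [hg]; linarith
  set t := min (min t₀ (τ / (2 * rm.L))) g with ht
  have ht0 : 0 < t := lt_min (lt_min ht₀ (by positivity)) hg0
  have h1 := h.le_offEnergy hmono hz (ρ := r) ht0 ((min_le_left _ _).trans (min_le_left _ _))
    ⟨hzr.1, by
      have : t ≤ g := min_le_right _ _
      simp only [hg] at this hg0
      linarith⟩ (by linarith) (by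
        have : t ≤ τ / (2 * rm.L) := (min_le_left _ _).trans (min_le_right _ _)
        rwa [le_div_iff₀ (by positivity)] at this) hne
  rw [hzero] at h1
  have : 0 < c * t ^ 2 := by positivity
  linarith

/-- Inside the disc, the frontier of the region cut off by an arc lies on the arc, which is mapped
away from p. -/
theorem isBoundaryPiece_of_arc [T2Space M] {rm : RealModel cm S} {f : ℂ → M}
    (hf : IsJHolomorphicDisc 𝒥 f)
    (hbd : ∀ ζ ∈ Metric.sphere (0 : ℂ) 1, ∀ N, IsOpen N → S ⊆ N →
      ∀ᶠ z in 𝓝[Metric.ball 0 1] ζ, f z ∈ N)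
    (hen : ∫⁻ z in Metric.ball (0 : ℂ) 1, cm.density f z ≠ ⊤) {r s : ℝ} (hr : 0 < r)
    (hrR : 2 * r < rm.R) {ξ : ℂ}
    (harc : ∀ z ∈ Metric.ball (0 : ℂ) 1 ∩ Metric.sphere ξ s, f z ∉ chartClosedBall p (2 * r)) :
    IsBoundaryPiece rm f (Metric.ball 0 1 ∩ Metric.ball ξ s) r where
  hol := hf
  isOpen := Metric.isOpen_ball.inter Metric.isOpen_ball
  subset := inter_subset_left
  boundary := hbd
  interior ζ hζ hζU := by
    rcases lt_trichotomy s (dist ζ ξ) with h | h | h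
    · exact (eventually_notMem_of_lt_dist inter_subset_right h).mono fun _ h ↦ h.elim
    · have h1 : ContinuousAt f ζ :=
        hf.continuousOn.continuousAt (Metric.isOpen_ball.mem_nhds hζ)
      have hcl := cm.isClosed_chartClosedBall (ρ := 2 * r)
        (by linarith [rm.R_le, cm.radius_pos])
      exact (h1.eventually (hcl.isOpen_compl.mem_nhds (harc ζ ⟨hζ, h.symm⟩))).filter_mono
        nhdsWithin_le_nhds
    · exact absurd ⟨hζ, h⟩ hζU
  pos := hr
  lt := hrR
  energy := hen

/-- If a totally real point `p` is in the cluster set at `ζ`, then the arcs around `ζ` bounding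
regions of small energy come close to `p`. -/
theorem RealModel.exists_arc_mem [T2Space M] (rm : RealModel cm S) :
    ∃ r₀ > 0, ∀ r, 0 < r → r ≤ r₀ → ∃ ε : ENNReal, 0 < ε ∧
      ∀ f : ℂ → M, IsJHolomorphicDisc 𝒥 f →
      (∀ ζ ∈ Metric.sphere (0 : ℂ) 1, ∀ N, IsOpen N → S ⊆ N →
        ∀ᶠ z in 𝓝[Metric.ball 0 1] ζ, f z ∈ N) →
      ∫⁻ z in Metric.ball (0 : ℂ) 1, cm.density f z ≠ ⊤ → ∀ (ζ : ℂ) (s : ℝ), ‖ζ‖ = 1 → 0 < s →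
      s < 2 → MapClusterPt p (𝓝[Metric.ball 0 1] ζ) f →
      ∫⁻ z in Metric.ball (0 : ℂ) 1 ∩ Metric.ball ζ s, cm.density f z ≤ ε →
      ∃ z ∈ Metric.ball (0 : ℂ) 1 ∩ Metric.sphere ζ s, f z ∈ chartClosedBall p (2 * r) := by
  obtain ⟨r₀, hr₀, hr₀R, hsmall⟩ := rm.exists_eq_of_small_energy
  refine ⟨r₀, hr₀, fun r hr hrr ↦ ?_⟩
  obtain ⟨ε, hε, h⟩ := hsmall r hr hrr
  refine ⟨ε, hε, fun f hf hbd hen ζ s hζ hs hs2 hcl he ↦ ?_⟩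
  by_contra hnot
  push Not at hnot
  have hpiece := isBoundaryPiece_of_arc (rm := rm) hf hbd hen hr (by linarith) hnot
  set U := Metric.ball (0 : ℂ) 1 ∩ Metric.ball ζ s with hU
  obtain ⟨z₀, hz₀, hz₀U⟩ : ∃ z, f z ∈ chartBall p r ∧ z ∈ U :=
    ((hcl.frequently (chartBall_mem_nhds p hr)).and_eventually (inter_mem self_mem_nhdsWithin
      (mem_nhdsWithin_of_mem_nhds (Metric.ball_mem_nhds ζ hs)))).exists
  -- The region is mapped to a single point within r of p, so by continuity the arc, which lies in
  -- its closure, is too. This contradicts the choice of the arc.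
  have hconst := h f U hpiece ((convex_ball (0 : ℂ) 1).inter (convex_ball ζ s)).isPreconnected he
    z₀ hz₀U hz₀
  obtain ⟨η, -, -, hη⟩ := exists_mem_closure_arc hζ hs hs2
  obtain ⟨w, hw⟩ := closure_nonempty_iff.1 ⟨η, hη⟩
  have hwU : w ∈ closure U := by
    refine Metric.isOpen_ball.inter_closure ⟨hw.1, ?_⟩
    rw [closure_ball ζ hs.ne']
    exact Metric.sphere_subset_closedBall hw.2
  have hcont : ContinuousAt f w := hf.continuousOn.continuousAt (Metric.isOpen_ball.mem_nhds hw.1)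
  have hclosed := cm.isClosed_chartClosedBall (ρ := 2 * r) (by linarith [rm.R_le, cm.radius_pos])
  obtain ⟨z, hzU, hz⟩ := ((mem_closure_iff_frequently.1 hwU).and_eventually
    (hcont.eventually (hclosed.isOpen_compl.mem_nhds (hnot w hw)))).exists
  refine hz ?_
  rw [hconst z hzU]
  exact chartBall_subset p (by linarith) hz₀

/-- The cluster set at a boundary point contains at most one totally real point. -/
theorem eq_of_mapClusterPt_of_realModel [T2Space M] {q : M} {cq : ChartModel 𝒥 Ω q}
    (rp : RealModel cm S) (rq : RealModel cq S) {f : ℂ → M} (hf : IsJHolomorphicDisc 𝒥 f)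
    (hbd : ∀ ζ ∈ Metric.sphere (0 : ℂ) 1, ∀ N, IsOpen N → S ⊆ N →
      ∀ᶠ z in 𝓝[Metric.ball 0 1] ζ, f z ∈ N)
    (hep : ∫⁻ z in Metric.ball (0 : ℂ) 1, cm.density f z ≠ ⊤)
    (heq : ∫⁻ z in Metric.ball (0 : ℂ) 1, cq.density f z ≠ ⊤) {ζ : ℂ} (hζ : ‖ζ‖ = 1)
    (hp : MapClusterPt p (𝓝[Metric.ball 0 1] ζ) f) (hq : MapClusterPt q (𝓝[Metric.ball 0 1] ζ) f) :
    p = q := by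
  by_contra hpq
  obtain ⟨Np, Nq, hNp, hNq, hpN, hqN, hdisj⟩ := t2_separation hpq
  obtain ⟨l, C, c, r₁, hl, hr₁, hl1, hl0⟩ := cm.exists_isTestFunction (hNp.mem_nhds hpN)
  obtain ⟨ε, hε, -, hεC⟩ := exists_small_energy C hl.pos
  obtain ⟨rp₀, hrp₀, hrp⟩ := rp.exists_arc_mem
  obtain ⟨rq₀, hrq₀, hrq⟩ := rq.exists_arc_mem
  obtain ⟨ρq, hρq, hρqN⟩ := exists_chartBall_subset q (hNq.mem_nhds hqN)
  -- With a quarter of r₁ the doubled closed ball lies where l = 1; likewise the ball at q lies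
  -- where l = 0. Every arc enclosing little energy meets both preimages, in particular the short
  -- one, on which l oscillates by at most 1/8.
  obtain ⟨εp, hεp, harcp⟩ := hrp (min rp₀ (r₁ / 4)) (lt_min hrp₀ (by positivity)) (min_le_left _ _)
  obtain ⟨εq, hεq, harcq⟩ := hrq (min rq₀ (ρq / 4)) (lt_min hrq₀ (by positivity)) (min_le_left _ _)
  obtain ⟨ρ₁, hρ₁, hen₁⟩ := exists_ball_lintegral_lt hep ζ (lt_min hε hεp)
  obtain ⟨ρ₂, hρ₂, hen₂⟩ := exists_ball_lintegral_lt heq ζ hεq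
  set ρ := min (min ρ₁ ρ₂) 1 with hρdef
  have hρ : 0 < ρ := lt_min (lt_min hρ₁ hρ₂) one_pos
  have hρρ₁ : ρ ≤ ρ₁ := (min_le_left _ _).trans (min_le_left _ _)
  have hρρ₂ : ρ ≤ ρ₂ := (min_le_left _ _).trans (min_le_right _ _)
  have hρ1 : ρ ≤ 1 := min_le_right _ _
  obtain ⟨s, hs, harc⟩ := hl.exists_arc hf hζ hρ (le_trans (by
    gcongr
    exact ((hen₁ ρ hρρ₁).trans_le (min_le_left _ _)).le) hεC)
  have hs0 : 0 < s := lt_trans (by positivity) hs.1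
  obtain ⟨z, hz, hzp⟩ := harcp f hf hbd hep ζ s hζ hs0 (by linarith [hs.2]) hp
    ((hen₁ s (hs.2.le.trans hρρ₁)).trans_le (min_le_right _ _)).le
  obtain ⟨w, hw, hwq⟩ := harcq f hf hbd heq ζ s hζ hs0 (by linarith [hs.2]) hq
    (hen₂ s (hs.2.le.trans hρρ₂)).le
  have h1 : l (f z) = 1 := hl1 _ (chartClosedBall_subset p
    (by linarith [min_le_right rp₀ (r₁ / 4)]) hzp)
  have h2 : f w ∈ Nq := hρqN (chartClosedBall_subset q
    (by linarith [min_le_right rq₀ (ρq / 4)]) hwq)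
  have h3 : l (f w) = 0 := hl0 _ fun h ↦ Set.disjoint_left.1 hdisj h h2
  have h4 := harc z hz w hw
  rw [h1, h3] at h4
  norm_num at h4

end TotallyReal

end BishopDisc

end

/-! ### The main theorem. -/

theorem mainTheorem4
    {M : Type*} [TopologicalSpace M] [T2Space M] [CompactSpace M]
    [ChartedSpace (EuclideanHalfSpace 4) M] [IsManifold (𝓡∂ 4) ∞ M]
    (𝒥 : BishopDisc.AlmostComplexStructure M) (Ω : BishopDisc.TameSymplecticForm 𝒥)
    (ι : BishopDisc.Sphere2 → M) (hι : BishopDisc.IsSphereInBoundary ι)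
    (hcomplex : (BishopDisc.complexPoints 𝒥 ι).Finite)
    (F : ℕ → ℂ → M) (hF : ∀ k, BishopDisc.IsBishopDisc 𝒥 (Set.range ι) (F k))
    (A : NNReal) (harea : ∀ k, BishopDisc.area Ω (F k) ≤ A)
    (f : ℂ → M) (hf : BishopDisc.IsJHolomorphicDisc 𝒥 f)
    (hnonconst : ∃ z ∈ Metric.ball (0 : ℂ) 1, ∃ w ∈ Metric.ball (0 : ℂ) 1, f z ≠ f w)
    (hlim : BishopDisc.IsLimitDisc F f) :
    BishopDisc.clusterSet f (Metric.sphere 0 1) ⊆ Set.range ι ∧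
      ∃ g : ℂ → M, ContinuousOn g (Metric.closedBall 0 1) ∧
        Set.EqOn g f (Metric.ball 0 1) := by
  obtain ⟨n, c, a, B, -, hc, ha, hB, hlim⟩ := hlim
  have hpt : ∀ z ∈ Metric.ball (0 : ℂ) 1 \ B,
      Tendsto (fun k ↦ F (n k) (BishopDisc.mobius (c k) (a k) z)) atTop (𝓝 (f z)) := by
    let _ : UniformSpace M := uniformSpaceOfCompactR1
    exact fun z hz ↦ hlim.tendsto_at hz
  have hg : ∀ k, BishopDisc.IsBishopDisc 𝒥 (Set.range ι)
      (fun z ↦ F (n k) (BishopDisc.mobius (c k) (a k) z)) := fun k ↦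
    (hF (n k)).comp_mobius (hc k) (ha k)
  have hA : ∀ k, BishopDisc.area Ω (fun z ↦ F (n k) (BishopDisc.mobius (c k) (a k) z)) ≤ A :=
    fun k ↦ (BishopDisc.area_comp_mobius_le (hF (n k)).holomorphic (hc k) (ha k)).trans
      (harea (n k))
  have hS : IsClosed (Set.range ι) := (isCompact_range hι.smooth.continuous).isClosed
  have hcluster : ∀ ζ ∈ Metric.sphere (0 : ℂ) 1, ∀ p,
      MapClusterPt p (𝓝[Metric.ball 0 1] ζ) f → p ∈ Set.range ι := fun ζ hζ p hp ↦
    BishopDisc.mem_of_mapClusterPt Ω hS hg hf hB hpt hA (mem_sphere_zero_iff_norm.1 hζ) hp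
  refine ⟨?_, ?_⟩
  · rintro p ⟨ζ, hζ, u, hu, huζ, hup⟩
    refine hcluster ζ hζ p (MapClusterPt.of_comp ?_ hup.mapClusterPt)
    exact tendsto_nhdsWithin_iff.2 ⟨huζ, Eventually.of_forall hu⟩
  have hbd : ∀ ζ ∈ Metric.sphere (0 : ℂ) 1, ∀ N, IsOpen N → Set.range ι ⊆ N →
      ∀ᶠ z in 𝓝[Metric.ball 0 1] ζ, f z ∈ N := fun ζ hζ N hN hSN ↦
    BishopDisc.eventually_mem_of_mapClusterPt_subset (hcluster ζ hζ) hN hSN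
  have hen : ∀ (p : M) (cm : BishopDisc.ChartModel 𝒥 Ω p),
      ∫⁻ z in Metric.ball (0 : ℂ) 1, cm.density f z ≠ ⊤ := fun p cm ↦
    cm.energy_ne_top (fun k ↦ (hg k).holomorphic) hf hB hpt hA
  have hcl : closure (Metric.ball (0 : ℂ) 1) = Metric.closedBall 0 1 := closure_ball 0 one_ne_zero
  have hlimit : ∀ ζ ∈ Metric.sphere (0 : ℂ) 1, ∃ y, Tendsto f (𝓝[Metric.ball 0 1] ζ) (𝓝 y) := by
    intro ζ hζ
    refine BishopDisc.exists_tendsto_of_finite_cluster hf.continuousOn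
      (hcl ▸ Metric.sphere_subset_closedBall hζ) ?_
    set T := {p | MapClusterPt p (𝓝[Metric.ball 0 1] ζ) f} with hT
    -- Cluster values lie in S, so each is complex or totally real. The former are finitely many by
    -- hypothesis, the latter at most one.
    have hsub : (T \ ι '' BishopDisc.complexPoints 𝒥 ι).Subsingleton := by
      rintro p ⟨hp, hpc⟩ q ⟨hq, hqc⟩
      obtain ⟨s, rfl⟩ := hcluster ζ hζ p hp
      obtain ⟨t, rfl⟩ := hcluster ζ hζ q hq
      have hs : BishopDisc.IsTotallyRealAt 𝒥 ι s := by
        by_contra h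
        exact hpc ⟨s, h, rfl⟩
      have ht : BishopDisc.IsTotallyRealAt 𝒥 ι t := by
        by_contra h
        exact hqc ⟨t, h, rfl⟩
      obtain ⟨cs⟩ := BishopDisc.exists_chartModel 𝒥 Ω (ι s)
      obtain ⟨ct⟩ := BishopDisc.exists_chartModel 𝒥 Ω (ι t)
      obtain ⟨rs⟩ := BishopDisc.exists_realModel hι hs cs
      obtain ⟨rt⟩ := BishopDisc.exists_realModel hι ht ct
      exact BishopDisc.eq_of_mapClusterPt_of_realModel rs rt hf hbd (hen _ cs) (hen _ ct)
        (mem_sphere_zero_iff_norm.1 hζ) hp hq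
    refine ((hcomplex.image ι).union hsub.finite).subset fun p hp ↦ ?_
    by_cases h : p ∈ ι '' BishopDisc.complexPoints 𝒥 ι
    · exact Or.inl h
    · exact Or.inr ⟨hp, h⟩
  -- In a regular space the extension by limits is continuous as soon as limits exist at every point
  -- of the closed disc.
  refine ⟨extendFrom (Metric.ball 0 1) f, continuousOn_extendFrom hcl.ge fun ζ hζ ↦ ?_,
    fun z hz ↦ extendFrom_eq (subset_closure hz) (hf.continuousOn z hz)⟩
  rw [← Metric.ball_union_sphere] at hζ
  rcases hζ with hζ | hζ
  · exact ⟨f ζ, hf.continuousOn ζ hζ⟩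
  · exact hlimit ζ hζ
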